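/- Let $\mathbb T^2=\mathbb R^2/\mathbb Z^2$, let $F_A(x,y)=(13x+8y,\,8x+5y)$ on $\mathbb T^2$, let $\sigma=\ln(9+4\sqrt5)$, and consider the four fixed points $\Omega_0=(0,0)$, $\Omega_1=(\tfrac12,\tfrac12)$, $\Omega_2=(\tfrac12,0)$, $\Omega_3=(0,\tfrac12)$ of $F_A$. Fix linear coordinates $(x,y)$ centred at each $\Omega_i$, obtained from the standard ones by one matrix of determinant $1$ in which $F_A$ becomes $(x,y)\mapsto(e^{\sigma}x,e^{-\sigma}y)$, and the polar coordinates $(x,y)=(\sqrt{2\rho}\cos\theta,\sqrt{2\rho}\sin\theta)$. Let $0<\delta<\varepsilon$, and let $V_i\subset V_i'$ be the closed discs of radii $\delta$ and $\varepsilon$ about $\Omega_i$ in these coordinates, where the $V_i'$ are pairwise disjoint. Let $\psi:[\delta^2/2,\varepsilon^2/2]\to[0,\varepsilon^2/2]$ be a $C^\infty$-diffeomorphism with $\psi(\rho)=\rho-\delta^2/2$ near $\delta^2/2$ and $\psi(\rho)=\rho$ near $\varepsilon^2/2$, and let $\xi$ be a $C^\infty$ function on $\mathbb R$ with $\xi=0$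 near $0$ and $\xi(\rho)=1$ for $\rho\ge\delta^2/2$. Put $\hat I=\mathbb T^2\setminus\bigsqcup_i V_i$ and let $\Psi:\hat I\to\mathbb T^2\setminus\{\Omega_0,\dots,\Omega_3\}$ be the diffeomorphism equal to $(\rho,\theta)\mapsto(\psi(\rho),\theta)$ in $V_i'\setminus V_i$ and to the identity outside $\bigsqcup_i V_i'$. Let $\hat F:\mathbb T^2\to\mathbb T^2$ be equal to $\Psi^{-1}\circ F_A\circ\Psi$ on $\hat I$ and, on each $V_i$, to the time-$\sigma$ map of the flow $\dot x=\partial_y\hat H$, $\dot y=-\partial_x\hat H$ of the Hamiltonian $\hat H=(\rho-\delta^2/2)\sin(2\theta)\,\xi(\rho)$. Then every point of $\hat I$ has positive maximal Lyapunov exponent $\limsup_{n\to\infty}\frac1n\log\|D\hat F^n(\cdot)\|$ for $\hat F$, and $\hat F$ leaves $\hat I$ invariant and is topologically transitive on $\hat I$. Moreover, there is a $C^2$-neighbourhood of $\hat F$ such that for every (not necessarily conservative) $C^2$-diffeomorphism $\tilde F$ of $\mathbb T^2$ in this neighbourhood which keeps each circle $\partial V_i$ invariant ($i=0,1,2,3$),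 the set $\hat I$ is invariant under $\tilde F$, every point of $\hat I$ has positive maximal Lyapunov exponent for $\tilde F$, the restrictions $\tilde F|_{\hat I}$ and $\hat F|_{\hat I}$ are topologically conjugate, and $\tilde F|_{\hat I}$ is topologically transitive. -/

import Mathlib

open Set Filter Topology
open scoped ContDiff

noncomputable section

namespace BlowUp

/-- The Euclidean plane. -/
abbrev Plane := EuclideanSpace ℝ (Fin 2)

/-- The torus `ℝ² / ℤ²`. -/
abbrev Torus := UnitAddTorus (Fin 2)

/-- The projection `ℝ² → ℝ² / ℤ²`. -/
def proj (z : Plane) : Torus := fun i => (z i : UnitAddCircle)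

/-! ### Differential calculus on the flat torus -/

/-- `f : 𝕋² → 𝕋²` is of class `C^r`: it has a `C^r` lift to the universal cover. -/
def TorusContDiff (r : ℕ∞) (f : Torus → Torus) : Prop :=
  ∃ g : Plane → Plane, ContDiff ℝ r g ∧ ∀ z, proj (g z) = f (proj z)

/-- `L` is the derivative of `f : 𝕋² → 𝕋²` at `p`, the tangent spaces of `𝕋²` being identified
with `ℝ²`: some local lift of `f` near a point over `p` has derivative `L` there. -/
def HasTorusFDerivAt (f : Torus → Torus) (L : Plane →L[ℝ] Plane) (p : Torus) : Prop :=
  ∃ (z : Plane) (g : Plane → Plane), proj z = p ∧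
    (∀ᶠ w in 𝓝 z, proj (g w) = f (proj w)) ∧ HasFDerivAt g L z

open Classical in
/-- The derivative `Df(p)` of `f : 𝕋² → 𝕋²` (zero if `f` is not differentiable at `p`). -/
def torusFDeriv (f : Torus → Torus) (p : Torus) : Plane →L[ℝ] Plane :=
  if h : ∃ L, HasTorusFDerivAt f L p then h.choose else 0

/-- The maximal Lyapunov exponent `limsup (1/n) log ‖Df^n(p)‖`. -/
def lyapunov (f : Torus → Torus) (p : Torus) : EReal :=
  limsup (fun n : ℕ => ((1 / (n : ℝ) * Real.log ‖torusFDeriv f^[n] p‖ : ℝ) : EReal)) atTop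

/-- `f` and `g` are `η`-close in the uniform `C²` topology: the difference `f - g` lifts to a
`C²` map `u : ℝ² → ℝ²` which is less than `η` together with its first two derivatives. -/
def C2Close (η : ℝ) (f g : Torus → Torus) : Prop :=
  ∃ u : Plane → Plane, ContDiff ℝ 2 u ∧ (∀ z, f (proj z) = g (proj z) + proj (u z)) ∧
    ∀ k : ℕ, k ≤ 2 → ∀ z, ‖iteratedFDeriv ℝ k u z‖ < η

/-! ### Topological dynamics on an invariant set -/

/-- `K` is invariant under `f` and the restriction of `f` to `K` is topologically transitive. -/
def TransitiveOn (f : Torus → Torus) (K : Set Torus) : Prop :=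
  f '' K = K ∧ ∀ U V : Set Torus, IsOpen U → IsOpen V → (U ∩ K).Nonempty → (V ∩ K).Nonempty →
    ∃ n : ℕ, (f^[n] '' (U ∩ K) ∩ (V ∩ K)).Nonempty

/-- `K` is invariant under `f` and `g`, and a homeomorphism of `K` conjugates `f` to `g`. -/
def ConjugateOn (f g : Torus → Torus) (K : Set Torus) : Prop :=
  ∃ (hf : BijOn f K K) (hg : BijOn g K K) (h : K ≃ₜ K),
    Function.Semiconj h (hf.mapsTo.restrict f K K) (hg.mapsTo.restrict g K K)

/-! ### Hamiltonian flows in the plane -/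

/-- The Hamiltonian vector field `ẋ = ∂H/∂y`, `ẏ = -∂H/∂x`. -/
def hamField (H : Plane → ℝ) (w : Plane) : Plane :=
  !₂[fderiv ℝ H w (EuclideanSpace.single 1 1), -fderiv ℝ H w (EuclideanSpace.single 0 1)]

open Classical in
/-- The time-`t` map of the flow of the vector field `X` (with value `w` at points `w` that are
not on a complete integral curve). -/
def timeMap (X : Plane → Plane) (t : ℝ) (w : Plane) : Plane :=
  if h : ∃ γ : ℝ → Plane, γ 0 = w ∧ IsIntegralCurve γ (fun _ => X) then h.choose t else w

/-! ### The Anosov map and its blow-up -/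

/-- The linear map `A (x, y) = (13 x + 8 y, 8 x + 5 y)` of the plane. -/
def planeA (z : Plane) : Plane := !₂[13 * z 0 + 8 * z 1, 8 * z 0 + 5 * z 1]

/-- The Anosov map `F_A (x, y) = (13 x + 8 y, 8 x + 5 y)` of the torus. -/
def torusA (p : Torus) : Torus :=
  ![(13 : ℕ) • p 0 + (8 : ℕ) • p 1, (8 : ℕ) • p 0 + (5 : ℕ) • p 1]

/-- The logarithm of the unstable eigenvalue of `A`. -/
def sigma : ℝ := Real.log (9 + 4 * √5)

/-- Representatives in the plane of the fixed points `Ω₀, …, Ω₃` of the Anosov map. -/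
def center : Fin 4 → Plane := ![!₂[0, 0], !₂[1 / 2, 1 / 2], !₂[1 / 2, 0], !₂[0, 1 / 2]]

/-- Given linear coordinates `w = P (z - Ωᵢ)` near `Ωᵢ`, the point with coordinates `w`. -/
def chartAt (P : Plane ≃L[ℝ] Plane) (i : Fin 4) (w : Plane) : Torus :=
  proj (center i + P.symm w)

/-- The choices made in the blow-up construction. -/
structure Data where
  /-- linear symplectic coordinates that diagonalize `A` -/
  P : Plane ≃L[ℝ] Plane
  /-- radius of the discs `Vᵢ` -/
  δ : ℝ
  /-- radius of the discs `Vᵢ'` -/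
  ε : ℝ
  /-- the radial diffeomorphism `[δ²/2, ε²/2] → [0, ε²/2]` -/
  ψ : ℝ → ℝ
  /-- the inverse of `ψ` -/
  ψinv : ℝ → ℝ
  /-- the cut-off function of the Hamiltonian -/
  ξ : ℝ → ℝ
  det_P : LinearMap.det (P : Plane →ₗ[ℝ] Plane) = 1
  P_planeA : ∀ z, P (planeA z) = !₂[Real.exp sigma * P z 0, Real.exp (-sigma) * P z 1]
  δ_pos : 0 < δ
  δ_lt : δ < ε
  disjoint_discs : ∀ i j, i ≠ j →
    Disjoint (chartAt P i '' Metric.closedBall 0 ε) (chartAt P j '' Metric.closedBall 0 ε)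
  ψ_smooth : ContDiffOn ℝ ∞ ψ (Icc (δ ^ 2 / 2) (ε ^ 2 / 2))
  ψ_bij : BijOn ψ (Icc (δ ^ 2 / 2) (ε ^ 2 / 2)) (Icc 0 (ε ^ 2 / 2))
  ψinv_smooth : ContDiffOn ℝ ∞ ψinv (Icc 0 (ε ^ 2 / 2))
  ψinv_inv : InvOn ψinv ψ (Icc (δ ^ 2 / 2) (ε ^ 2 / 2)) (Icc 0 (ε ^ 2 / 2))
  ψ_inner : ∀ᶠ ρ in 𝓝[≥] (δ ^ 2 / 2), ψ ρ = ρ - δ ^ 2 / 2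
  ψ_outer : ∀ᶠ ρ in 𝓝[≤] (ε ^ 2 / 2), ψ ρ = ρ
  ξ_smooth : ContDiff ℝ ∞ ξ
  ξ_zero : ∀ᶠ ρ in 𝓝 0, ξ ρ = 0
  ξ_one : ∀ ρ, δ ^ 2 / 2 ≤ ρ → ξ ρ = 1

namespace Data

variable (D : Data)

/-- The closed disc `Vᵢ` of radius `δ` about `Ωᵢ`. -/
def V (i : Fin 4) : Set Torus := chartAt D.P i '' Metric.closedBall 0 D.δ

/-- The circle `∂Vᵢ`. -/
def circle (i : Fin 4) : Set Torus := chartAt D.P i '' Metric.sphere 0 D.δ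

/-- The island `𝕋² \ ⋃ᵢ Vᵢ`. -/
def island : Set Torus := (⋃ i, D.V i)ᶜ

/-- The map `(ρ, θ) ↦ (χ ρ, θ)` in the symplectic polar coordinates
`w = (√(2ρ) cos θ, √(2ρ) sin θ)`, where `ρ = ‖w‖² / 2`. -/
def radial (χ : ℝ → ℝ) (w : Plane) : Plane := (√(2 * χ (‖w‖ ^ 2 / 2)) / ‖w‖) • w

open Classical in
/-- The map of the torus that is `radial χ` in the discs `Vᵢ'` and the identity elsewhere. -/
def surgery (χ : ℝ → ℝ) (p : Torus) : Torus :=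
  if h : ∃ q : Fin 4 × Plane, ‖q.2‖ ≤ D.ε ∧ chartAt D.P q.1 q.2 = p then
    chartAt D.P h.choose.1 (radial χ h.choose.2)
  else p

/-- The diffeomorphism `Ψ` from the island onto `𝕋² \ {Ω₀, Ω₁, Ω₂, Ω₃}`. -/
def Psi : Torus → Torus := D.surgery D.ψ

/-- The inverse of `Ψ`. -/
def PsiInv : Torus → Torus := D.surgery D.ψinv

/-- The Hamiltonian `(ρ - δ²/2) sin(2θ) ξ(ρ)`; note that `ρ sin(2θ) = x y` and `2 ρ = ‖(x, y)‖²`. -/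
def ham (w : Plane) : ℝ := (1 - D.δ ^ 2 / ‖w‖ ^ 2) * (w 0 * w 1) * D.ξ (‖w‖ ^ 2 / 2)

open Classical in
/-- The blown-up map: the time-`σ` map of the Hamiltonian flow in the discs `Vᵢ`, and
`Ψ⁻¹ ∘ F_A ∘ Ψ` on the island. -/
def hatF (p : Torus) : Torus :=
  if h : ∃ q : Fin 4 × Plane, ‖q.2‖ ≤ D.δ ∧ chartAt D.P q.1 q.2 = p then
    chartAt D.P h.choose.1 (timeMap (hamField D.ham) sigma h.choose.2)
  else D.PsiInv (torusA (D.Psi p))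

end Data

end BlowUp

end

/-
Collapsing the discs conjugates the perturbed map on the island, through `Ψ`, to a map of the
plane that fixes the lifts of the points `Ωᵢ` and is a bounded perturbation, with small Lipschitz
constant, of the linear saddle `w ↦ (λ w₀, λ⁻¹ w₁)`. That the Lipschitz constant stays small near
the collapsed circles is the crux: in polar coordinates about a circle the perturbation is `C¹`
small, and because it keeps the circle it vanishes there to first order in the radial direction.

The global Hartman–Grobman theorem for Lipschitz perturbations then gives a homeomorphism of the
plane conjugating the saddle to the perturbed map. By uniqueness it fixes the lifts of the `Ωᵢ`
and commutes with the deck transformations, so it induces a conjugacy of the island, and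
transitivity is inherited from the linear map. For the exponents, the perturbed map expands the
unstable cone uniformly, and the blow-up stretches unstable directions by a definite factor except
at points near some `Ωᵢ` that are displaced from it mainly in the unstable direction. Orbits avoid
such points infinitely often: they leave the neighbourhoods of the `Ωᵢ` again and again, or end up
near one of them and then approach it along the stable direction.
-/

noncomputable section

namespace BlowUp

/-! ### Lipschitz perturbations of hyperbolic linear maps -/

section Hyperbolic

variable {𝕜 E F : Type*} [NontriviallyNormedField 𝕜] [NormedAddCommGroup E] [NormedSpace 𝕜 E]
  [NormedAddCommGroup F] [NormedSpace 𝕜 F]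

/-- The linear map `A × B` is hyperbolic with rate `μ`: its unstable part `A` expands by at least
`μ⁻¹` and its stable part `B` contracts by at least `μ`. -/
structure IsHyperbolic (A : E ≃L[𝕜] E) (B : F ≃L[𝕜] F) (μ : NNReal) : Prop where
  norm_symm_le : ∀ x, ‖A.symm x‖ ≤ μ * ‖x‖
  norm_le : ∀ y, ‖B y‖ ≤ μ * ‖y‖

/-- The operator whose fixed points `w` are the solutions of `(1 + w) ∘ T = G ∘ (1 + w)`: that
equation is solved for `w x` in the unstable component and for `w (T x)` in the stable one. -/
def conjOperator (A : E ≃L[𝕜] E) (B : F ≃L[𝕜] F) (G : E × F → E × F) (T : E × F ≃ₜ E × F)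
    (w : E × F → E × F) (x : E × F) : E × F :=
  (A.symm (T x + w (T x) - (G (x + w x) - A.prodCongr B (w x))).1,
    (G (T.symm x + w (T.symm x)) - x).2)

variable {A : E ≃L[𝕜] E} {B : F ≃L[𝕜] F} {μ κ : NNReal} {G : E × F → E × F}

namespace IsHyperbolic

theorem norm_fst_sub_le (hAB : IsHyperbolic A B μ)
    (hG : ApproximatesLinearOn G (A.prodCongr B : E × F →L[𝕜] E × F) univ κ) (x y : E × F) :
    ‖(x - y).1‖ ≤ μ * (‖(G x - G y).1‖ + κ * ‖x - y‖) := by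
  set r := G x - G y - A.prodCongr B (x - y) with hr
  have hA : (x - y).1 = A.symm ((G x - G y).1 - r.1) := by simp [hr]
  rw [hA]
  refine (hAB.norm_symm_le _).trans ?_
  gcongr
  calc ‖(G x - G y).1 - r.1‖ ≤ ‖(G x - G y).1‖ + ‖r.1‖ := norm_sub_le _ _
    _ ≤ ‖(G x - G y).1‖ + κ * ‖x - y‖ := by
      gcongr
      exact (norm_fst_le r).trans (hG x trivial y trivial)

theorem norm_snd_sub_le (hAB : IsHyperbolic A B μ)
    (hG : ApproximatesLinearOn G (A.prodCongr B : E × F →L[𝕜] E × F) univ κ) (x y : E × F) :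
    ‖(G x - G y).2‖ ≤ μ * ‖(x - y).2‖ + κ * ‖x - y‖ := by
  set r := G x - G y - A.prodCongr B (x - y) with hr
  have hB : (G x - G y).2 = B (x - y).2 + r.2 := by simp [hr]
  rw [hB]
  exact (norm_add_le _ _).trans (add_le_add (hAB.norm_le _)
    ((norm_snd_le r).trans (hG x trivial y trivial)))

/-- Two semiconjugacies to `G` at a bounded distance agree: the unstable component of their
difference is controlled one step later and the stable one a step earlier. -/
theorem eqOn_of_semiconj (hAB : IsHyperbolic A B μ)
    (hG : ApproximatesLinearOn G (A.prodCongr B : E × F →L[𝕜] E × F) univ κ) (hμκ : μ + κ < 1)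
    {X : Type*} {S : Set X} {T : X ≃ X} (hT : MapsTo T S S) (hT' : MapsTo T.symm S S)
    {h k : X → E × F} {K : ℝ} (hb : ∀ x ∈ S, ‖h x - k x‖ ≤ K)
    (hh : ∀ x ∈ S, h (T x) = G (h x)) (hk : ∀ x ∈ S, k (T x) = G (k x)) : EqOn h k S := by
  have hsum : (μ + κ : ℝ) < 1 := mod_cast hμκ
  have hμ : (μ : ℝ) ≤ 1 := (le_add_of_nonneg_right κ.2).trans hsum.le
  have contract : ∀ K : ℝ, (∀ x ∈ S, ‖h x - k x‖ ≤ K) →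
      ∀ x ∈ S, ‖h x - k x‖ ≤ (μ + κ) * K := fun K hK x hx => by
    have hK0 : 0 ≤ K := (norm_nonneg _).trans (hK x hx)
    refine max_le ?_ ?_
    · calc ‖(h x - k x).1‖ ≤ μ * (‖(h (T x) - k (T x)).1‖ + κ * ‖h x - k x‖) := by
            rw [hh x hx, hk x hx]
            exact hAB.norm_fst_sub_le hG _ _
        _ ≤ μ * (K + κ * K) := by
            gcongr
            exacts [(norm_fst_le _).trans (hK _ (hT hx)), hK x hx]
        _ ≤ (μ + κ) * K := by
            rw [mul_add, add_mul]
            exact add_le_add le_rfl (mul_le_of_le_one_left (mul_nonneg κ.2 hK0) hμ)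
    · have hx' := hT' hx
      have hh' := hh _ hx'
      have hk' := hk _ hx'
      rw [T.apply_symm_apply] at hh' hk'
      calc ‖(h x - k x).2‖
          ≤ μ * ‖(h (T.symm x) - k (T.symm x)).2‖ + κ * ‖h (T.symm x) - k (T.symm x)‖ := by
            rw [hh', hk']
            exact hAB.norm_snd_sub_le hG _ _
        _ ≤ μ * K + κ * K := by
            gcongr
            exacts [(norm_snd_le _).trans (hK _ hx'), hK _ hx']
        _ = (μ + κ) * K := by ring
  have iterate : ∀ n : ℕ, ∀ x ∈ S, ‖h x - k x‖ ≤ (μ + κ) ^ n * K := fun n => by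
    induction n with
    | zero => simpa using hb
    | succ n ih =>
      rw [pow_succ', mul_assoc]
      exact contract _ ih
  intro x hx
  have hlim : Tendsto (fun n : ℕ => (μ + κ : ℝ) ^ n * K) atTop (𝓝 0) := by
    simpa using (tendsto_pow_atTop_nhds_zero_of_lt_one (by positivity) hsum).mul_const K
  exact sub_eq_zero.1 (norm_le_zero_iff.1 (ge_of_tendsto' hlim fun n => iterate n x hx))

theorem norm_conjOperator_sub_le (hAB : IsHyperbolic A B μ)
    (hG : ApproximatesLinearOn G (A.prodCongr B : E × F →L[𝕜] E × F) univ κ) (hμ : μ ≤ 1)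
    (T : E × F ≃ₜ E × F) {w w' : E × F → E × F} {M : ℝ} (hM : ∀ x, ‖w x - w' x‖ ≤ M)
    (x : E × F) :
    ‖conjOperator A B G T w x - conjOperator A B G T w' x‖ ≤ (μ + κ) * M := by
  have hμ' : (μ : ℝ) ≤ 1 := mod_cast hμ
  have hM0 : 0 ≤ M := (norm_nonneg _).trans (hM 0)
  have hdefect : ∀ y, ‖G (y + w y) - G (y + w' y) - A.prodCongr B (w y - w' y)‖ ≤ κ * M :=
    fun y => by
      have := hG (y + w y) trivial (y + w' y) trivial
      rw [add_sub_add_left_eq_sub] at this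
      exact this.trans (by gcongr; exact hM y)
  refine max_le ?_ ?_
  · have hfst : (conjOperator A B G T w x - conjOperator A B G T w' x).1 =
        A.symm ((w (T x) - w' (T x)) -
          (G (x + w x) - G (x + w' x) - A.prodCongr B (w x - w' x))).1 := by
      simp only [conjOperator, Prod.fst_sub, ← map_sub]
      congr 1
      simp only [map_sub, Prod.fst_sub, Prod.fst_add]
      abel
    rw [hfst]
    calc _ ≤ μ * (M + κ * M) := by
          refine (hAB.norm_symm_le _).trans ?_
          gcongr
          exact (norm_fst_le _).trans ((norm_sub_le _ _).trans (add_le_add (hM _) (hdefect x)))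
      _ ≤ (μ + κ) * M := by
          rw [mul_add, add_mul]
          exact add_le_add le_rfl (mul_le_of_le_one_left (mul_nonneg κ.2 hM0) hμ')
  · set y := T.symm x with hy
    have hsnd : (conjOperator A B G T w x - conjOperator A B G T w' x).2 =
        B (w y - w' y).2 + (G (y + w y) - G (y + w' y) - A.prodCongr B (w y - w' y)).2 := by
      simp [conjOperator, ← hy]
    rw [hsnd, add_mul]
    refine (norm_add_le _ _).trans (add_le_add ((hAB.norm_le _).trans ?_)
      ((norm_snd_le _).trans (hdefect y)))
    gcongr
    exact (norm_snd_le _).trans (hM y)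

theorem norm_conjOperator_zero_le (hAB : IsHyperbolic A B μ) (hμ : μ ≤ 1) {T : E × F ≃ₜ E × F}
    {K : ℝ} (hTG : ∀ x, ‖T x - G x‖ ≤ K) (x : E × F) : ‖conjOperator A B G T 0 x‖ ≤ K := by
  have hμ' : (μ : ℝ) ≤ 1 := mod_cast hμ
  refine max_le ?_ ?_
  · calc ‖A.symm (T x + 0 - (G (x + 0) - A.prodCongr B 0)).1‖
        ≤ μ * ‖(T x + 0 - (G (x + 0) - A.prodCongr B 0)).1‖ := hAB.norm_symm_le _
      _ ≤ 1 * ‖T x - G x‖ := by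
          gcongr
          simpa using norm_fst_le (T x - G x)
      _ ≤ K := by simpa using hTG x
  · have h := (norm_snd_le _).trans (hTG (T.symm x))
    rw [T.apply_symm_apply, ← norm_neg, ← Prod.snd_neg, neg_sub] at h
    simpa [conjOperator] using h

theorem conjOperator_fixedPoint {T : E × F ≃ₜ E × F} {w : E × F → E × F}
    (hw : ∀ x, conjOperator A B G T w x = w x) (x : E × F) : T x + w (T x) = G (x + w x) := by
  refine Prod.ext ?_ ?_
  · have h : A.symm (T x + w (T x) - (G (x + w x) - A.prodCongr B (w x))).1 = (w x).1 :=
      congrArg Prod.fst (hw x)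
    rw [A.symm_apply_eq] at h
    simpa [sub_eq_iff_eq_add] using h
  · have h : (conjOperator A B G T w (T x)).2 = (w (T x)).2 := congrArg Prod.snd (hw (T x))
    rw [conjOperator, T.symm_apply_apply, Prod.snd_sub, sub_eq_iff_eq_add'] at h
    exact h.symm

variable [CompleteSpace E] [CompleteSpace F]

open BoundedContinuousFunction in
theorem exists_semiconj (hAB : IsHyperbolic A B μ)
    (hG : ApproximatesLinearOn G (A.prodCongr B : E × F →L[𝕜] E × F) univ κ) (hμκ : μ + κ < 1)
    (T : E × F ≃ₜ E × F) {K : ℝ} (hTG : ∀ x, ‖T x - G x‖ ≤ K) :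
    ∃ h : E × F → E × F, Continuous h ∧ (∃ C, ∀ x, ‖h x - x‖ ≤ C) ∧ ∀ x, h (T x) = G (h x) := by
  have hμ : μ ≤ 1 := le_self_add.trans hμκ.le
  have hGc : Continuous G := continuousOn_univ.1 hG.continuousOn
  have hΓc : ∀ w : (E × F) →ᵇ (E × F), Continuous (conjOperator A B G T w) := fun w => by
    unfold conjOperator
    fun_prop
  have hΓb : ∀ (w : (E × F) →ᵇ (E × F)) x,
      ‖conjOperator A B G T w x‖ ≤ (μ + κ) * ‖w‖ + K := fun w x => by
    have h := hAB.norm_conjOperator_sub_le hG hμ T (w' := 0)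
      (fun y => by simpa using w.norm_coe_le_norm y) x
    exact (norm_le_norm_sub_add _ (conjOperator A B G T 0 x)).trans
      (add_le_add h (hAB.norm_conjOperator_zero_le hμ hTG x))
  let Γ : ((E × F) →ᵇ (E × F)) → ((E × F) →ᵇ (E × F)) := fun w =>
    ofNormedAddCommGroup (conjOperator A B G T w) (hΓc w) _ (hΓb w)
  have hΓ : ContractingWith (μ + κ) Γ :=
    ⟨hμκ, LipschitzWith.of_dist_le_mul fun w w' => (dist_le (by positivity)).2 fun x => by
      rw [dist_eq_norm]
      exact hAB.norm_conjOperator_sub_le hG hμ T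
        (fun y => by rw [← dist_eq_norm]; exact dist_coe_le_dist y) x⟩
  let w := ContractingWith.fixedPoint Γ hΓ
  have hw : ∀ x, conjOperator A B G T w x = w x := DFunLike.congr_fun hΓ.fixedPoint_isFixedPt
  exact ⟨fun x => x + w x, by fun_prop,
    ⟨‖w‖, fun x => by simpa using w.norm_coe_le_norm x⟩, conjOperator_fixedPoint hw⟩

/-- The global Hartman–Grobman theorem. -/
theorem exists_conj (hAB : IsHyperbolic A B μ) {G : E × F ≃ₜ E × F}
    (hG : ApproximatesLinearOn G (A.prodCongr B : E × F →L[𝕜] E × F) univ κ) (hμκ : μ + κ < 1)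
    {K : ℝ} (hb : ∀ x, ‖G x - A.prodCongr B x‖ ≤ K) :
    ∃ H : E × F ≃ₜ E × F, (∃ C, ∀ x, ‖H x - x‖ ≤ C) ∧ ∀ x, H (A.prodCongr B x) = G (H x) := by
  have hlin : ApproximatesLinearOn (A.prodCongr B : E × F → E × F)
      (A.prodCongr B : E × F →L[𝕜] E × F) univ κ := fun x _ y _ => by
    rw [ContinuousLinearEquiv.coe_coe, map_sub, sub_self, norm_zero]
    positivity
  obtain ⟨h, hc, ⟨C, hC⟩, hh⟩ := hAB.exists_semiconj hG hμκ (A.prodCongr B).toHomeomorph (K := K)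
    (fun x => by rw [norm_sub_rev]; exact hb x)
  obtain ⟨k, kc, ⟨C', hC'⟩, hk⟩ := hAB.exists_semiconj hlin hμκ G hb
  have hcomp : ∀ x, ‖k (h x) - x‖ ≤ C' + C ∧ ‖h (k x) - x‖ ≤ C + C' := fun x =>
    ⟨(norm_sub_le_norm_sub_add_norm_sub _ (h x) _).trans (add_le_add (hC' _) (hC _)),
      (norm_sub_le_norm_sub_add_norm_sub _ (k x) _).trans (add_le_add (hC _) (hC' _))⟩
  have hkh : ∀ x, k (h x) = x := fun x =>
    hAB.eqOn_of_semiconj hlin hμκ (S := univ) (T := (A.prodCongr B).toEquiv) (mapsTo_univ _ _)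
      (mapsTo_univ _ _) (h := k ∘ h) (k := id) (fun x _ => (hcomp x).1)
      (fun x _ => (congrArg k (hh x)).trans (hk _)) (fun x _ => rfl) trivial
  have hhk : ∀ x, h (k x) = x := fun x =>
    hAB.eqOn_of_semiconj hG hμκ (S := univ) (T := G.toEquiv) (mapsTo_univ _ _)
      (mapsTo_univ _ _) (h := h ∘ k) (k := id) (fun x _ => (hcomp x).2)
      (fun x _ => (congrArg h (hk x)).trans (hh _)) (fun x _ => rfl) trivial
  exact ⟨⟨⟨h, k, hkh, hhk⟩, hc, kc⟩, ⟨C, hC⟩, hh⟩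

end IsHyperbolic

end Hyperbolic

/-! ### The linear saddle -/

/-- The unstable eigenvalue `9 + 4 √5`. -/
def lam : ℝ := Real.exp sigma

theorem lam_eq : lam = 9 + 4 * √5 := Real.exp_log (by positivity)

theorem lam_ge : 17 ≤ lam := by
  have : (2 : ℝ) ≤ √5 := Real.le_sqrt_of_sq_le (by norm_num)
  linarith [lam_eq]

theorem lam_le : lam ≤ 18 := by
  have : √5 ≤ (9 / 4 : ℝ) := Real.sqrt_le_left (by norm_num) |>.2 (by norm_num)
  linarith [lam_eq]

theorem lam_pos : 0 < lam := Real.exp_pos _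

theorem exp_neg_sigma : Real.exp (-sigma) = lam⁻¹ := Real.exp_neg _

theorem lam_inv_pos : 0 < lam⁻¹ := inv_pos.2 lam_pos

theorem lam_inv_le : lam⁻¹ ≤ 1 / 17 := by
  rw [one_div]
  exact inv_anti₀ (by norm_num) lam_ge

theorem lam_mul_inv : lam * lam⁻¹ = 1 := mul_inv_cancel₀ lam_pos.ne'

theorem plane_ext {v w : Plane} (h0 : v 0 = w 0) (h1 : v 1 = w 1) : v = w :=
  PiLp.ext (Fin.forall_fin_two.2 ⟨h0, h1⟩)

theorem plane_norm_sq (w : Plane) : ‖w‖ ^ 2 = w 0 ^ 2 + w 1 ^ 2 := by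
  simp [EuclideanSpace.norm_sq_eq]

theorem abs_coord_le (w : Plane) (i : Fin 2) : |w i| ≤ ‖w‖ := PiLp.norm_apply_le w i

theorem plane_norm_le (w : Plane) : ‖w‖ ≤ |w 0| + |w 1| := by
  apply le_of_sq_le_sq _ (by positivity)
  rw [plane_norm_sq, add_sq, sq_abs, sq_abs]
  linarith [mul_nonneg (abs_nonneg (w 0)) (abs_nonneg (w 1))]

/-- The identification of the Euclidean plane with `ℝ × ℝ`, which carries the sup norm. -/
def coords : Plane ≃L[ℝ] ℝ × ℝ :=
  (EuclideanSpace.equiv (Fin 2) ℝ).trans (ContinuousLinearEquiv.finTwoArrow ℝ ℝ)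

@[simp] theorem coords_fst (w : Plane) : (coords w).1 = w 0 := rfl

@[simp] theorem coords_snd (w : Plane) : (coords w).2 = w 1 := rfl

theorem norm_coords_le (w : Plane) : ‖coords w‖ ≤ ‖w‖ :=
  max_le (abs_coord_le w 0) (abs_coord_le w 1)

theorem norm_le_coords (w : Plane) : ‖w‖ ≤ 2 * ‖coords w‖ := by
  rw [two_mul]
  exact (plane_norm_le w).trans (add_le_add (norm_fst_le (coords w)) (norm_snd_le (coords w)))

/-- Multiplication by `lam` on the line. -/
def scaling : ℝ ≃L[ℝ] ℝ := ContinuousLinearEquiv.smulLeft (Units.mk0 lam lam_pos.ne')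

/-- The linear map `(x, y) ↦ (e^σ x, e^{-σ} y)`. -/
def saddle : Plane ≃L[ℝ] Plane :=
  coords.trans ((scaling.prodCongr scaling.symm).trans coords.symm)

@[simp] theorem saddle_zero (w : Plane) : saddle w 0 = lam * w 0 := rfl

@[simp] theorem saddle_one (w : Plane) : saddle w 1 = lam⁻¹ * w 1 := rfl

theorem coords_saddle (w : Plane) :
    coords (saddle w) = scaling.prodCongr scaling.symm (coords w) := rfl

theorem isHyperbolic_scaling : IsHyperbolic scaling scaling.symm (1 / 17) := by
  have key : ∀ x, ‖scaling.symm x‖ ≤ (1 / 17 : NNReal) * ‖x‖ := fun x => by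
    change ‖lam⁻¹ * x‖ ≤ _
    rw [norm_mul, Real.norm_of_nonneg lam_inv_pos.le]
    gcongr
    simpa using lam_inv_le
  exact ⟨key, key⟩

theorem norm_saddle_le (w : Plane) : ‖saddle w‖ ≤ lam * ‖w‖ := by
  apply le_of_sq_le_sq _ (mul_nonneg lam_pos.le (norm_nonneg _))
  rw [mul_pow, plane_norm_sq, plane_norm_sq, saddle_zero, saddle_one, mul_pow, mul_pow, mul_add]
  gcongr
  · exact lam_inv_pos.le
  · linarith [lam_ge, lam_inv_le]

theorem le_norm_saddle (w : Plane) : lam⁻¹ * ‖w‖ ≤ ‖saddle w‖ := by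
  apply le_of_sq_le_sq _ (norm_nonneg _)
  rw [mul_pow, plane_norm_sq, plane_norm_sq, saddle_zero, saddle_one, mul_pow, mul_pow, mul_add]
  gcongr
  · exact lam_inv_pos.le
  · linarith [lam_ge, lam_inv_le]

theorem norm_saddle_symm_le (w : Plane) : ‖saddle.symm w‖ ≤ lam * ‖w‖ := by
  have h := le_norm_saddle (saddle.symm w)
  rwa [ContinuousLinearEquiv.apply_symm_apply, inv_mul_le_iff₀ lam_pos] at h

/-- `G` differs from the saddle by a map with Lipschitz constant `1 / 50`. -/
def NearSaddle (G : Plane → Plane) : Prop :=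
  ApproximatesLinearOn G (saddle : Plane →L[ℝ] Plane) univ (1 / 50)

theorem nearSaddle_saddle : NearSaddle saddle := fun x _ y _ => by
  rw [ContinuousLinearEquiv.coe_coe, map_sub, sub_self, norm_zero]
  positivity

theorem nearSaddle_iff {G : Plane → Plane} :
    NearSaddle G ↔ ∀ x y, ‖(G x - saddle x) - (G y - saddle y)‖ ≤ 1 / 50 * ‖x - y‖ := by
  simp only [NearSaddle, ApproximatesLinearOn, mem_univ, true_imp_iff,
    ContinuousLinearEquiv.coe_coe, map_sub, sub_sub_sub_comm (G _) (saddle _), NNReal.coe_div,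
    NNReal.coe_one, NNReal.coe_ofNat]

namespace NearSaddle

variable {G : Plane → Plane}

theorem continuous (hG : NearSaddle G) : Continuous G := continuousOn_univ.1 hG.continuousOn

theorem approximatesLinearOn_coords (hG : NearSaddle G) :
    ApproximatesLinearOn (coords ∘ G ∘ coords.symm)
      (scaling.prodCongr scaling.symm : ℝ × ℝ →L[ℝ] ℝ × ℝ) univ (1 / 25) := fun x _ y _ => by
  obtain ⟨x, rfl⟩ := coords.surjective x
  obtain ⟨y, rfl⟩ := coords.surjective y
  simp only [Function.comp_apply, ContinuousLinearEquiv.symm_apply_apply,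
    ContinuousLinearEquiv.coe_coe]
  rw [← map_sub, ← map_sub, ← coords_saddle, ← map_sub]
  calc ‖coords (G x - G y - saddle (x - y))‖ ≤ (1 / 50 : NNReal) * ‖x - y‖ :=
        (norm_coords_le _).trans (hG x trivial y trivial)
    _ ≤ (1 / 50 : NNReal) * (2 * ‖coords (x - y)‖) := by
        gcongr
        exact norm_le_coords _
    _ = (1 / 25 : NNReal) * ‖coords (x - y)‖ := by
        push_cast
        ring

theorem abs_fst_sub_le (hG : NearSaddle G) (x y : Plane) :
    |(x - y) 0| ≤ 1 / 17 * (|(G x - G y) 0| + 1 / 25 * max |(x - y) 0| |(x - y) 1|) := by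
  have h := isHyperbolic_scaling.norm_fst_sub_le hG.approximatesLinearOn_coords
    (coords x) (coords y)
  simpa [← map_sub, Prod.norm_def] using h

theorem abs_snd_sub_le (hG : NearSaddle G) (x y : Plane) :
    |(G x - G y) 1| ≤ 1 / 17 * |(x - y) 1| + 1 / 25 * max |(x - y) 0| |(x - y) 1| := by
  have h := isHyperbolic_scaling.norm_snd_sub_le hG.approximatesLinearOn_coords
    (coords x) (coords y)
  simpa [← map_sub, Prod.norm_def] using h

theorem unstable (hG : NearSaddle G) (x y : Plane) (h : |(x - y) 1| ≤ |(x - y) 0|) :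
    16 * |(x - y) 0| ≤ |(G x - G y) 0| ∧ 2 * |(G x - G y) 1| ≤ |(G x - G y) 0| := by
  have hfst := hG.abs_fst_sub_le x y
  have hsnd := hG.abs_snd_sub_le x y
  rw [max_eq_left h] at hfst hsnd
  constructor <;> linarith [abs_nonneg ((x - y) 0)]

/-- A Lipschitz perturbation of the saddle, as a homeomorphism. -/
def toHomeomorph (hG : NearSaddle G) : Plane ≃ₜ Plane :=
  ApproximatesLinearOn.toHomeomorph G hG <| Or.inr <| by
    have hn : ‖(saddle.symm : Plane →L[ℝ] Plane)‖₊ ≤ 18 :=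
      ContinuousLinearMap.opNorm_le_bound _ (by norm_num) fun x =>
        (norm_saddle_symm_le x).trans (by gcongr; exact lam_le)
    calc (1 / 50 : NNReal) < 18⁻¹ := by
          rw [one_div]
          exact inv_strictAnti₀ (by norm_num) (by norm_num)
      _ ≤ _ := inv_anti₀ saddle.nnnorm_symm_pos hn

theorem eqOn_of_semiconj (hG : NearSaddle G) {X : Type*} {S : Set X} {T : X ≃ X}
    (hT : MapsTo T S S) (hT' : MapsTo T.symm S S) {h k : X → Plane} {K : ℝ}
    (hb : ∀ x ∈ S, ‖h x - k x‖ ≤ K) (hh : ∀ x ∈ S, h (T x) = G (h x))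
    (hk : ∀ x ∈ S, k (T x) = G (k x)) : EqOn h k S := fun x hx =>
  coords.injective <| isHyperbolic_scaling.eqOn_of_semiconj hG.approximatesLinearOn_coords
    (by rw [← NNReal.coe_lt_coe]; norm_num) hT hT' (h := coords ∘ h) (k := coords ∘ k) (K := K)
    (fun x hx => by
      rw [Function.comp_apply, Function.comp_apply, ← map_sub]
      exact (norm_coords_le _).trans (hb x hx))
    (fun x hx => by simp [hh x hx]) (fun x hx => by simp [hk x hx]) hx

theorem exists_conj (hG : NearSaddle G) {K : ℝ} (hb : ∀ x, ‖G x - saddle x‖ ≤ K) :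
    ∃ H : Plane ≃ₜ Plane, (∃ C, ∀ x, ‖H x - x‖ ≤ C) ∧ ∀ x, H (saddle x) = G (H x) := by
  have hG' : ApproximatesLinearOn
      (coords.symm.toHomeomorph.trans (hG.toHomeomorph.trans coords.toHomeomorph))
      (scaling.prodCongr scaling.symm : ℝ × ℝ →L[ℝ] ℝ × ℝ) univ (1 / 25) :=
    hG.approximatesLinearOn_coords
  obtain ⟨H, ⟨C, hC⟩, hH⟩ := isHyperbolic_scaling.exists_conj hG'
    (by rw [← NNReal.coe_lt_coe]; norm_num) (K := K) fun x => by
      obtain ⟨x, rfl⟩ := coords.surjective x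
      rw [← coords_saddle]
      change ‖coords (G (coords.symm (coords x))) - _‖ ≤ K
      rw [coords.symm_apply_apply, ← map_sub]
      exact (norm_coords_le _).trans (hb x)
  refine ⟨coords.toHomeomorph.trans (H.trans coords.symm.toHomeomorph), ⟨2 * C, fun x => ?_⟩,
    fun x => ?_⟩
  · refine (norm_le_coords _).trans (mul_le_mul_of_nonneg_left ?_ zero_le_two)
    simpa using hC (coords x)
  · change coords.symm (H (coords (saddle x))) = _
    rw [coords_saddle, hH]
    exact coords.symm_apply_apply _

variable {H : Plane → Plane} {C : ℝ}

theorem conj_eqOn_id (hG : NearSaddle G) (hC : ∀ x, ‖H x - x‖ ≤ C)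
    (hH : ∀ x, H (saddle x) = G (H x)) {S : Set Plane} (hS : MapsTo saddle S S)
    (hS' : MapsTo saddle.symm S S) (hGS : EqOn G saddle S) : EqOn H id S :=
  hG.eqOn_of_semiconj (T := saddle.toEquiv) hS hS' (fun x _ => hC x) (fun x _ => hH x)
    fun _ hx => (hGS hx).symm

theorem conj_add (hG : NearSaddle G) (hC : ∀ x, ‖H x - x‖ ≤ C)
    (hH : ∀ x, H (saddle x) = G (H x)) {L : AddSubgroup Plane} (hL : MapsTo saddle L L)
    (hL' : MapsTo saddle.symm L L) (hGL : ∀ x, ∀ l ∈ L, G (x + l) = G x + saddle l) (x : Plane)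
    {l : Plane} (hl : l ∈ L) : H (x + l) = H x + l := by
  refine sub_eq_iff_eq_add.1 <| hG.eqOn_of_semiconj (X := Plane × Plane) (S := {p | p.2 ∈ L})
    (T := saddle.toEquiv.prodCongr saddle.toEquiv) (h := fun p => H (p.1 + p.2) - p.2)
    (k := fun p => H p.1) (K := C + C) (fun p hp => hL hp) (fun p hp => hL' hp)
    (fun p _ => ?_) (fun p hp => ?_) (fun p _ => hH _) (show (x, l).2 ∈ L from hl)
  · calc ‖H (p.1 + p.2) - p.2 - H p.1‖ = ‖(H (p.1 + p.2) - (p.1 + p.2)) - (H p.1 - p.1)‖ := by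
          congr 1
          abel
      _ ≤ C + C := (norm_sub_le _ _).trans (add_le_add (hC _) (hC _))
  · have hGp := hGL (H (p.1 + p.2) - p.2) p.2 hp
    rw [sub_add_cancel, ← hH, map_add] at hGp
    exact sub_eq_iff_eq_add.2 hGp

end NearSaddle

/-! ### Uniformly bounded and Lipschitz families -/

section UniformlyBddLip

variable {ι X E F G : Type*} [PseudoMetricSpace X] [NormedAddCommGroup E] [NormedAddCommGroup F]
  [NormedAddCommGroup G]

/-- On `S`, the function `f` is bounded by `K` and has Lipschitz constant `K`. -/
def BddLipOn (S : Set X) (K : ℝ) (f : X → E) : Prop :=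
  ∀ x ∈ S, ‖f x‖ ≤ K ∧ ∀ y ∈ S, ‖f x - f y‖ ≤ K * dist x y

/-- The functions `f i` are bounded and Lipschitz on `S` with constants of order `w i`. -/
def UniformlyBddLip (S : Set X) (w : ι → ℝ) (f : ι → X → E) : Prop :=
  ∃ K, 0 ≤ K ∧ ∀ i, BddLipOn S (K * w i) (f i)

theorem lipschitzOnWith_inv_Ici {c : ℝ} (hc : 0 < c) :
    LipschitzOnWith (c⁻¹ * c⁻¹).toNNReal (fun a : ℝ => a⁻¹) (Ici c) :=
  LipschitzOnWith.of_dist_le_mul fun a ha b hb => by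
    have ha' : 0 < a := hc.trans_le ha
    have hb' : 0 < b := hc.trans_le hb
    rw [Real.coe_toNNReal _ (by positivity), dist_comm a, Real.dist_eq, Real.dist_eq,
      inv_sub_inv ha'.ne' hb'.ne', abs_div, abs_mul, abs_of_pos ha', abs_of_pos hb',
      div_eq_inv_mul, mul_inv]
    gcongr <;> assumption

theorem lipschitzOnWith_sqrt_Ici {c : ℝ} (hc : 0 < c) :
    LipschitzOnWith (√c)⁻¹.toNNReal Real.sqrt (Ici c) :=
  LipschitzOnWith.of_dist_le_mul fun a ha b hb => by
    have hsc : 0 < √c := Real.sqrt_pos.2 hc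
    have hfactor : (√a - √b) * (√a + √b) = a - b := by
      linarith [Real.mul_self_sqrt (hc.le.trans ha), Real.mul_self_sqrt (hc.le.trans hb)]
    rw [Real.coe_toNNReal _ (by positivity), inv_mul_eq_div, le_div_iff₀ hsc, Real.dist_eq,
      Real.dist_eq, ← hfactor, abs_mul,
      abs_of_nonneg (add_nonneg (Real.sqrt_nonneg a) (Real.sqrt_nonneg b))]
    gcongr
    exact (Real.sqrt_le_sqrt ha).trans (le_add_of_nonneg_right (Real.sqrt_nonneg b))

namespace UniformlyBddLip

variable {S : Set X} {w w' : ι → ℝ} {f g : ι → X → E}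

theorem mono_weight (hf : UniformlyBddLip S w f) (h : ∀ i, w i ≤ w' i) :
    UniformlyBddLip S w' f := by
  obtain ⟨K, hK, H⟩ := hf
  refine ⟨K, hK, fun i x hx => ⟨(H i x hx).1.trans ?_, fun y hy => ((H i x hx).2 y hy).trans ?_⟩⟩
  · exact mul_le_mul_of_nonneg_left (h i) hK
  · exact mul_le_mul_of_nonneg_right (mul_le_mul_of_nonneg_left (h i) hK) dist_nonneg

theorem continuousOn (hf : UniformlyBddLip S w f) (i : ι) : ContinuousOn (f i) S := by
  obtain ⟨K, -, H⟩ := hf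
  refine (LipschitzOnWith.of_dist_le_mul (K := (K * w i).toNNReal) fun x hx y hy => ?_).continuousOn
  rw [dist_eq_norm, Real.coe_toNNReal _ ((norm_nonneg _).trans (H i x hx).1)]
  exact (H i x hx).2 y hy

theorem const (c : E) : UniformlyBddLip S (1 : ι → ℝ) (fun _ _ => c) :=
  ⟨‖c‖, norm_nonneg c, fun i x _ => ⟨by rw [Pi.one_apply, mul_one], fun y _ => by
    rw [sub_self, norm_zero, Pi.one_apply, mul_one]
    positivity⟩⟩

theorem add (hf : UniformlyBddLip S w f) (hg : UniformlyBddLip S w g) :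
    UniformlyBddLip S w (fun i x => f i x + g i x) := by
  obtain ⟨K, hK, H⟩ := hf
  obtain ⟨K', hK', H'⟩ := hg
  refine ⟨K + K', add_nonneg hK hK', fun i x hx => ⟨?_, fun y hy => ?_⟩⟩
  · rw [add_mul]
    exact (norm_add_le _ _).trans (add_le_add (H i x hx).1 (H' i x hx).1)
  · rw [add_mul, add_mul, add_sub_add_comm]
    exact (norm_add_le _ _).trans (add_le_add ((H i x hx).2 y hy) ((H' i x hx).2 y hy))

theorem neg (hf : UniformlyBddLip S w f) : UniformlyBddLip S w (fun i x => -f i x) := by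
  obtain ⟨K, hK, H⟩ := hf
  refine ⟨K, hK, fun i x hx => ⟨(norm_neg _).trans_le (H i x hx).1, fun y hy => ?_⟩⟩
  rw [neg_sub_neg, norm_sub_rev]
  exact (H i x hx).2 y hy

theorem sub (hf : UniformlyBddLip S w f) (hg : UniformlyBddLip S w g) :
    UniformlyBddLip S w (fun i x => f i x - g i x) := by
  simpa only [sub_eq_add_neg] using hf.add hg.neg

theorem bilin [NormedSpace ℝ E] [NormedSpace ℝ F] [NormedSpace ℝ G] (B : E →L[ℝ] F →L[ℝ] G)
    {g : ι → X → F} (hf : UniformlyBddLip S 1 f) (hg : UniformlyBddLip S w g) :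
    UniformlyBddLip S w (fun i x => B (f i x) (g i x)) := by
  obtain ⟨K, hK, H⟩ := hf
  obtain ⟨K', hK', H'⟩ := hg
  simp only [BddLipOn, Pi.one_apply, mul_one] at H
  refine ⟨2 * (‖B‖ * K * K'), by positivity, fun i x hx => ?_⟩
  have hw : 0 ≤ K' * w i := (norm_nonneg _).trans (H' i x hx).1
  refine ⟨?_, fun y hy => ?_⟩
  · calc ‖B (f i x) (g i x)‖ ≤ ‖B‖ * ‖f i x‖ * ‖g i x‖ := B.le_opNorm₂ _ _
      _ ≤ ‖B‖ * K * (K' * w i) := by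
          gcongr
          exacts [(H i x hx).1, (H' i x hx).1]
      _ ≤ 2 * (‖B‖ * K * K') * w i := by
          linarith [mul_nonneg (mul_nonneg (norm_nonneg B) hK) hw]
  · calc ‖B (f i x) (g i x) - B (f i y) (g i y)‖
        = ‖B (f i x - f i y) (g i x) + B (f i y) (g i x - g i y)‖ := by
          simp only [map_sub, sub_apply, sub_add_sub_cancel]
      _ ≤ ‖B‖ * ‖f i x - f i y‖ * ‖g i x‖ + ‖B‖ * ‖f i y‖ * ‖g i x - g i y‖ :=
          (norm_add_le _ _).trans (add_le_add (B.le_opNorm₂ _ _) (B.le_opNorm₂ _ _))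
      _ ≤ ‖B‖ * (K * dist x y) * (K' * w i) + ‖B‖ * K * (K' * w i * dist x y) := by
          gcongr
          exacts [(H i x hx).2 y hy, (H' i x hx).1, (H i y hy).1, (H' i x hx).2 y hy]
      _ = 2 * (‖B‖ * K * K') * w i * dist x y := by ring

theorem smul [NormedSpace ℝ E] {f : ι → X → ℝ} (hf : UniformlyBddLip S 1 f)
    (hg : UniformlyBddLip S w g) : UniformlyBddLip S w (fun i x => f i x • g i x) :=
  hf.bilin (ContinuousLinearMap.lsmul ℝ ℝ) hg

theorem smul_flip [NormedSpace ℝ E] {f : ι → X → ℝ} (hf : UniformlyBddLip S w f)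
    (hg : UniformlyBddLip S 1 g) : UniformlyBddLip S w (fun i x => f i x • g i x) :=
  hg.bilin (ContinuousLinearMap.lsmul ℝ ℝ).flip hf

theorem mul {f g : ι → X → ℝ} (hf : UniformlyBddLip S 1 f) (hg : UniformlyBddLip S w g) :
    UniformlyBddLip S w (fun i x => f i x * g i x) := hf.smul hg

theorem inner [InnerProductSpace ℝ E] (hf : UniformlyBddLip S 1 f) (hg : UniformlyBddLip S w g) :
    UniformlyBddLip S w (fun i x => inner ℝ (f i x) (g i x)) :=
  hf.bilin (innerSL ℝ) hg

theorem comp {φ : E → F} {R : Set E} {L : NNReal} (hφ : LipschitzOnWith L φ R)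
    (hf : UniformlyBddLip S 1 f) (hfR : ∀ i, MapsTo (f i) S R) {a : E} (ha : a ∈ R) :
    UniformlyBddLip S 1 (fun i x => φ (f i x)) := by
  obtain ⟨K, hK, H⟩ := hf
  simp only [UniformlyBddLip, BddLipOn, Pi.one_apply, mul_one] at H ⊢
  have hlip : ∀ b ∈ R, ∀ c ∈ R, ‖φ b - φ c‖ ≤ L * ‖b - c‖ := fun b hb c hc => by
    simpa only [dist_eq_norm] using hφ.dist_le_mul b hb c hc
  refine ⟨‖φ a‖ + L * (K + ‖a‖), by positivity, fun i x hx => ⟨?_, fun y hy => ?_⟩⟩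
  · calc ‖φ (f i x)‖ ≤ ‖φ a‖ + ‖φ (f i x) - φ a‖ := norm_le_norm_add_norm_sub' _ _
      _ ≤ ‖φ a‖ + L * (K + ‖a‖) := by
          gcongr
          refine (hlip _ (hfR i hx) a ha).trans ?_
          gcongr
          exact (norm_sub_le _ _).trans (by gcongr; exact (H i x hx).1)
  · calc ‖φ (f i x) - φ (f i y)‖ ≤ L * (K * dist x y) := by
          refine (hlip _ (hfR i hx) _ (hfR i hy)).trans ?_
          gcongr
          exact (H i x hx).2 y hy
      _ ≤ (‖φ a‖ + L * (K + ‖a‖)) * dist x y := by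
          rw [← mul_assoc]
          gcongr
          nlinarith [norm_nonneg (φ a), mul_nonneg (NNReal.coe_nonneg L) (norm_nonneg a)]

theorem norm (hf : UniformlyBddLip S 1 f) : UniformlyBddLip S 1 (fun i x => ‖f i x‖) :=
  hf.comp lipschitzWith_one_norm.lipschitzOnWith (fun i => mapsTo_univ (f i) S) (mem_univ 0)

theorem inv {f : ι → X → ℝ} {c : ℝ} (hc : 0 < c) (hcf : ∀ i, ∀ x ∈ S, c ≤ f i x)
    (hf : UniformlyBddLip S 1 f) : UniformlyBddLip S 1 (fun i x => (f i x)⁻¹) :=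
  hf.comp (lipschitzOnWith_inv_Ici hc) hcf self_mem_Ici

theorem sqrt {f : ι → X → ℝ} {c : ℝ} (hc : 0 < c) (hcf : ∀ i, ∀ x ∈ S, c ≤ f i x)
    (hf : UniformlyBddLip S 1 f) : UniformlyBddLip S 1 (fun i x => √(f i x)) :=
  hf.comp (lipschitzOnWith_sqrt_Ici hc) hcf self_mem_Ici

theorem average {ρ₀ : ℝ} {T : Set X} {f : ι → ℝ × X → ℝ}
    (hf : UniformlyBddLip (Icc 0 ρ₀ ×ˢ T) w f) :
    UniformlyBddLip (Icc 0 ρ₀ ×ˢ T) w (fun i x => ∫ t in (0 : ℝ)..1, f i (t * x.1, x.2)) := by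
  have mem : ∀ x ∈ Icc 0 ρ₀ ×ˢ T, ∀ t ∈ Icc (0 : ℝ) 1, (t * x.1, x.2) ∈ Icc 0 ρ₀ ×ˢ T :=
    fun x hx t ht => ⟨⟨mul_nonneg ht.1 hx.1.1,
      (mul_le_of_le_one_left hx.1.1 ht.2).trans hx.1.2⟩, hx.2⟩
  have integrable : ∀ i, ∀ x ∈ Icc 0 ρ₀ ×ˢ T,
      IntervalIntegrable (fun t => f i (t * x.1, x.2)) MeasureTheory.volume 0 1 := fun i x hx => by
    refine ContinuousOn.intervalIntegrable ?_
    rw [uIcc_of_le zero_le_one]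
    exact (hf.continuousOn i).comp (by fun_prop) (mem x hx)
  have integral_le : ∀ {h : ℝ → ℝ} {C : ℝ}, (∀ t ∈ Icc (0 : ℝ) 1, ‖h t‖ ≤ C) →
      ‖∫ t in (0 : ℝ)..1, h t‖ ≤ C := fun hC => by
    simpa using intervalIntegral.norm_integral_le_of_norm_le_const fun t ht =>
      hC t (Ioc_subset_Icc_self (uIoc_of_le (zero_le_one' ℝ) ▸ ht))
  obtain ⟨K, hK, H⟩ := hf
  refine ⟨K, hK, fun i x hx => ⟨integral_le fun t ht => (H i _ (mem x hx t ht)).1, fun y hy => ?_⟩⟩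
  rw [← intervalIntegral.integral_sub (integrable i x hx) (integrable i y hy)]
  have hKw : 0 ≤ K * w i := (norm_nonneg _).trans (H i x hx).1
  refine integral_le fun t ht => ((H i _ (mem x hx t ht)).2 _ (mem y hy t ht)).trans ?_
  gcongr
  rw [Prod.dist_eq, Prod.dist_eq, Real.dist_eq, ← mul_sub, abs_mul, abs_of_nonneg ht.1]
  exact max_le_max (mul_le_of_le_one_left (abs_nonneg _) ht.2) le_rfl

end UniformlyBddLip

end UniformlyBddLip

section Polar

variable {E F : Type*} [NormedAddCommGroup E] [NormedSpace ℝ E] [NormedAddCommGroup F]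
  [NormedSpace ℝ F]

/-- The polar coordinates `(|x|², x / |x|)` of a nonzero vector `x`. -/
def polar (x : E) : ℝ × E := (‖x‖ ^ 2, ‖x‖⁻¹ • x)

/-- The polar coordinates of the nonzero vectors of squared norm at most `ρ₀`, together with the
unit sphere of directions at the origin. -/
def polarDomain (E : Type*) [NormedAddCommGroup E] (ρ₀ : ℝ) : Set (ℝ × E) :=
  Icc 0 ρ₀ ×ˢ Metric.sphere (0 : E) 1

variable {τ K : ℝ} {x y : E}

theorem polar_mem_polarDomain (hx : x ≠ 0) (hxτ : ‖x‖ ≤ τ) : polar x ∈ polarDomain E (τ ^ 2) :=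
  ⟨⟨sq_nonneg _, pow_le_pow_left₀ (norm_nonneg x) hxτ 2⟩,
    mem_sphere_zero_iff_norm.2 (norm_smul_inv_norm hx)⟩

theorem norm_mul_dist_polar_le (hx : x ≠ 0) (hy : y ≠ 0) (hxτ : ‖x‖ ≤ τ) (hyτ : ‖y‖ ≤ τ) :
    ‖x‖ * dist (polar x) (polar y) ≤ (2 * τ ^ 2 + 2) * ‖x - y‖ := by
  have hτ : 0 ≤ τ := (norm_nonneg x).trans hxτ
  have hxy : |‖x‖ - ‖y‖| ≤ ‖x - y‖ := abs_norm_sub_norm_le x y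
  have hpos : 0 ≤ τ ^ 2 * ‖x - y‖ := by positivity
  rw [Prod.dist_eq, mul_max_of_nonneg _ _ (norm_nonneg x)]
  refine max_le ?_ ?_
  · calc ‖x‖ * |‖x‖ ^ 2 - ‖y‖ ^ 2| = ‖x‖ * ((‖x‖ + ‖y‖) * |‖x‖ - ‖y‖|) := by
          rw [sq_sub_sq, abs_mul, abs_of_nonneg (by positivity)]
      _ ≤ τ * ((τ + τ) * ‖x - y‖) := by gcongr
      _ ≤ (2 * τ ^ 2 + 2) * ‖x - y‖ := by linarith [norm_nonneg (x - y)]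
  · have hsplit : ‖x‖ • (‖x‖⁻¹ • x - ‖y‖⁻¹ • y) = (x - y) + (‖y‖ - ‖x‖) • ‖y‖⁻¹ • y := by
      rw [smul_sub, sub_smul, smul_inv_smul₀ (norm_ne_zero_iff.2 hx),
        smul_inv_smul₀ (norm_ne_zero_iff.2 hy)]
      abel
    calc ‖x‖ * dist (‖x‖⁻¹ • x) (‖y‖⁻¹ • y) = ‖(x - y) + (‖y‖ - ‖x‖) • ‖y‖⁻¹ • y‖ := by
          rw [dist_eq_norm, ← norm_smul_of_nonneg (norm_nonneg x), hsplit]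
      _ ≤ ‖x - y‖ + |‖x‖ - ‖y‖| * 1 := by
          refine (norm_add_le _ _).trans (le_of_eq ?_)
          rw [norm_smul, Real.norm_eq_abs, abs_sub_comm]
          congr 2
          exact norm_smul_inv_norm hy
      _ ≤ (2 * τ ^ 2 + 2) * ‖x - y‖ := by linarith

theorem norm_smul_polar_sub_le {m : ℝ × E → F} (hm : BddLipOn (polarDomain E (τ ^ 2)) K m)
    (hxτ : ‖x‖ ≤ τ) (hyτ : ‖y‖ ≤ τ) :
    ‖‖x‖ • m (polar x) - ‖y‖ • m (polar y)‖ ≤ (2 * τ ^ 2 + 3) * K * ‖x - y‖ := by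
  have at_zero : ∀ z : E, ‖z‖ ≤ τ → ‖‖z‖ • m (polar z)‖ ≤ (2 * τ ^ 2 + 3) * K * ‖z‖ := by
    intro z hzτ
    rcases eq_or_ne z 0 with rfl | hz
    · simp
    · have hmz := (hm _ (polar_mem_polarDomain hz hzτ)).1
      have hK : 0 ≤ K := (norm_nonneg _).trans hmz
      rw [norm_smul, norm_norm, mul_comm]
      gcongr
      nlinarith [mul_nonneg (sq_nonneg τ) hK]
  rcases eq_or_ne x 0 with rfl | hx
  · simpa using at_zero y hyτ
  rcases eq_or_ne y 0 with rfl | hy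
  · simpa using at_zero x hxτ
  have hmx := hm _ (polar_mem_polarDomain hx hxτ)
  have hmy := hm _ (polar_mem_polarDomain hy hyτ)
  have hK : 0 ≤ K := (norm_nonneg _).trans hmx.1
  calc ‖‖x‖ • m (polar x) - ‖y‖ • m (polar y)‖
      = ‖‖x‖ • (m (polar x) - m (polar y)) + (‖x‖ - ‖y‖) • m (polar y)‖ := by
        rw [smul_sub, sub_smul, sub_add_sub_cancel]
    _ ≤ ‖x‖ * (K * dist (polar x) (polar y)) + ‖x - y‖ * K := by
        refine (norm_add_le _ _).trans ?_
        rw [norm_smul, norm_smul, norm_norm, Real.norm_eq_abs]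
        gcongr
        exacts [hmx.2 _ (polar_mem_polarDomain hy hyτ), abs_norm_sub_norm_le x y, hmy.1]
    _ = K * (‖x‖ * dist (polar x) (polar y)) + ‖x - y‖ * K := by ring
    _ ≤ K * ((2 * τ ^ 2 + 2) * ‖x - y‖) + ‖x - y‖ * K :=
        add_le_add_left (mul_le_mul_of_nonneg_left (norm_mul_dist_polar_le hx hy hxτ hyτ) hK) _
    _ = (2 * τ ^ 2 + 3) * K * ‖x - y‖ := by ring

end Polar

/-! ### Perturbations of the blown-up saddle -/

/-- `u` is bounded by `η` together with its derivative and the Lipschitz constant of the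
derivative. -/
structure SmallC2 (η : ℝ) (u : Plane → Plane) : Prop where
  diff : Differentiable ℝ u
  bound : ∀ x, ‖u x‖ ≤ η
  bound_fderiv : ∀ x, ‖fderiv ℝ u x‖ ≤ η
  lip_fderiv : ∀ x y, ‖fderiv ℝ u x - fderiv ℝ u y‖ ≤ η * ‖x - y‖

theorem SmallC2.lip {η : ℝ} {u : Plane → Plane} (h : SmallC2 η u) (x y : Plane) :
    ‖u x - u y‖ ≤ η * ‖x - y‖ :=
  convex_univ.norm_image_sub_le_of_norm_fderiv_le (fun z _ => h.diff z)
    (fun z _ => h.bound_fderiv z) (mem_univ y) (mem_univ x)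

theorem SmallC2.nonneg {η : ℝ} {u : Plane → Plane} (h : SmallC2 η u) : 0 ≤ η :=
  (norm_nonneg _).trans (h.bound 0)

/-- The blow-up of the origin to the circle of radius `δ`: the radius `r` becomes `√(r² + δ²)`. -/
def blowOut (δ : ℝ) (x : Plane) : Plane := (√(‖x‖ ^ 2 + δ ^ 2) / ‖x‖) • x

/-- The inverse of `blowOut`: the radius `r` becomes `√(r² - δ²)`, which is `0` for `r ≤ δ`. -/
def blowIn (δ : ℝ) (x : Plane) : Plane := (√(‖x‖ ^ 2 - δ ^ 2) / ‖x‖) • x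

/-- The blown-up saddle perturbed by `u` maps the circle of radius `δ` to itself. -/
def PreservesCircle (δ : ℝ) (u : Plane → Plane) : Prop :=
  ∀ e : Plane, ‖e‖ = 1 → ‖(δ / ‖saddle e‖) • saddle e + u (δ • e)‖ = δ

namespace PolarSaddle

variable (δ : ℝ)

/-- The radius of the point blown out of `x = √ρ e`, where `(ρ, e)` is the argument. -/
def outRadius (x : ℝ × Plane) : ℝ := √(x.1 + δ ^ 2)

/-- The point blown out of `x = √ρ e`. -/
def outPoint (x : ℝ × Plane) : Plane := outRadius δ x • x.2

/-- The derivative of `outPoint` in `ρ`. -/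
def outPoint' (x : ℝ × Plane) : Plane := (2 * outRadius δ x)⁻¹ • x.2

/-- The expansion of the direction `e`. -/
def expansion (x : ℝ × Plane) : ℝ := ‖saddle x.2‖

/-- The image of the direction `e`. -/
def imDir (x : ℝ × Plane) : Plane := (expansion x)⁻¹ • saddle x.2

/-- The radius of the image of `outPoint`. -/
def imRadius (x : ℝ × Plane) : ℝ := √(x.1 * expansion x ^ 2 + δ ^ 2)

/-- The image of `outPoint` under the blown-up saddle. -/
def imPoint (x : ℝ × Plane) : Plane := imRadius δ x • imDir x

/-- The derivative of `imPoint` in `ρ`. -/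
def imPoint' (x : ℝ × Plane) : Plane := (expansion x ^ 2 * (2 * imRadius δ x)⁻¹) • imDir x

variable (u : Plane → Plane)

/-- The change of the squared radius caused by the perturbation `u`. -/
def change (x : ℝ × Plane) : ℝ :=
  2 * inner ℝ (imPoint δ x) (u (outPoint δ x)) + inner ℝ (u (outPoint δ x)) (u (outPoint δ x))

/-- The derivative of `change` in `ρ`. -/
def change' (x : ℝ × Plane) : ℝ :=
  2 * (inner ℝ (imPoint' δ x) (u (outPoint δ x)) +
      inner ℝ (imPoint δ x) (fderiv ℝ u (outPoint δ x) (outPoint' δ x)))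
    + 2 * inner ℝ (u (outPoint δ x)) (fderiv ℝ u (outPoint δ x) (outPoint' δ x))

/-- The quotient `change / ρ`, in Hadamard's integral form, which makes sense at `ρ = 0`. -/
def quotient (x : ℝ × Plane) : ℝ := ∫ t in (0 : ℝ)..1, change' δ u (t * x.1, x.2)

/-- The image of `outPoint` under the perturbed map. -/
def pertPoint (x : ℝ × Plane) : Plane := imPoint δ x + u (outPoint δ x)

/-- The expansion of the perturbed map after blowing down. -/
def pertExpansion (x : ℝ × Plane) : ℝ := √(expansion x ^ 2 + quotient δ u x)

/-- The perturbation after blowing down, divided by the radius. The differences of the inverse radii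
and of the expansions are rationalized, so that each term visibly has the size of `u`. -/
def displacement (x : ℝ × Plane) : Plane :=
  pertExpansion δ u x • (‖pertPoint δ u x‖⁻¹ • u (outPoint δ x) -
      ((‖pertPoint δ u x‖ * imRadius δ x * (‖pertPoint δ u x‖ + imRadius δ x))⁻¹ * change δ u x) •
        imPoint δ x) +
    ((pertExpansion δ u x + expansion x)⁻¹ * quotient δ u x) • imDir x

variable {δ u} {ρ₀ η : ℝ} {x : ℝ × Plane}

theorem norm_snd_of_mem (hx : x ∈ polarDomain Plane ρ₀) : ‖x.2‖ = 1 :=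
  mem_sphere_zero_iff_norm.1 hx.2

theorem le_expansion (hx : ‖x.2‖ = 1) : lam⁻¹ ≤ expansion x := by
  simpa only [expansion, hx, mul_one] using le_norm_saddle x.2

theorem expansion_le (hx : ‖x.2‖ = 1) : expansion x ≤ lam := by
  simpa only [expansion, hx, mul_one] using norm_saddle_le x.2

theorem expansion_pos (hx : ‖x.2‖ = 1) : 0 < expansion x :=
  lam_inv_pos.trans_le (le_expansion hx)

theorem norm_imDir (hx : ‖x.2‖ = 1) : ‖imDir x‖ = 1 :=
  norm_smul_inv_norm (norm_ne_zero_iff.1 (expansion_pos hx).ne')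

theorem le_outRadius (hδ : 0 < δ) (hx : 0 ≤ x.1) : δ ≤ outRadius δ x :=
  (Real.le_sqrt' hδ).2 (le_add_of_nonneg_left hx)

theorem le_imRadius (hδ : 0 < δ) (hx : 0 ≤ x.1) : δ ≤ imRadius δ x :=
  (Real.le_sqrt' hδ).2 (le_add_of_nonneg_left (mul_nonneg hx (sq_nonneg _)))

theorem imRadius_sq (hx : 0 ≤ x.1) : imRadius δ x ^ 2 = x.1 * expansion x ^ 2 + δ ^ 2 :=
  Real.sq_sqrt (by positivity)

theorem norm_imPoint (hx : ‖x.2‖ = 1) : ‖imPoint δ x‖ = imRadius δ x := by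
  rw [imPoint, norm_smul, norm_imDir hx, mul_one]
  exact Real.norm_of_nonneg (Real.sqrt_nonneg _)

theorem norm_pertPoint_sq (hx : ‖x.2‖ = 1) :
    ‖pertPoint δ u x‖ ^ 2 = imRadius δ x ^ 2 + change δ u x := by
  rw [pertPoint, norm_add_sq_real, norm_imPoint hx, change, real_inner_self_eq_norm_sq]
  ring

theorem hasDerivAt_change (hδ : 0 < δ) (hu : Differentiable ℝ u) (hx : 0 ≤ x.1) :
    HasDerivAt (fun s => change δ u (s, x.2)) (change' δ u x) x.1 := by
  have hout : HasDerivAt (fun s => outPoint δ (s, x.2)) (outPoint' δ x) x.1 := by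
    have hsq : HasDerivAt (fun s => s + δ ^ 2) 1 x.1 := (hasDerivAt_id x.1).add_const _
    exact ((hsq.sqrt (by positivity)).smul_const x.2).congr_deriv (by rw [one_div]; rfl)
  have him : HasDerivAt (fun s => imPoint δ (s, x.2)) (imPoint' δ x) x.1 := by
    have hsq : HasDerivAt (fun s => s * expansion x ^ 2 + δ ^ 2) (1 * expansion x ^ 2) x.1 :=
      ((hasDerivAt_id x.1).mul_const _).add_const _
    exact ((hsq.sqrt (by positivity)).smul_const (imDir x)).congr_deriv
      (by rw [one_mul, div_eq_mul_inv]; rfl)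
  have huout : HasDerivAt (fun s => u (outPoint δ (s, x.2)))
      (fderiv ℝ u (outPoint δ x) (outPoint' δ x)) x.1 :=
    (hu (outPoint δ x)).hasFDerivAt.comp_hasDerivAt x.1 hout
  refine (((him.inner ℝ huout).const_mul 2).add (huout.inner ℝ huout)).congr_deriv ?_
  rw [change', real_inner_comm (u (outPoint δ x)) (fderiv ℝ u (outPoint δ x) (outPoint' δ x))]
  ring

section Families

variable {ι : Type*}

theorem uniformlyBddLip_fst :
    UniformlyBddLip (polarDomain Plane ρ₀) (1 : ι → ℝ) (fun _ x => x.1) := by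
  refine ⟨|ρ₀| + 1, by positivity, fun i x hx => ⟨?_, fun y _ => ?_⟩⟩
  · rw [Pi.one_apply, Real.norm_of_nonneg hx.1.1]
    linarith [hx.1.2, le_abs_self ρ₀]
  · rw [Pi.one_apply, mul_one, ← dist_eq_norm]
    have hfst : dist x.1 y.1 ≤ dist x y := le_max_left _ _
    exact hfst.trans (le_mul_of_one_le_left dist_nonneg (le_add_of_nonneg_left (abs_nonneg ρ₀)))

theorem uniformlyBddLip_snd :
    UniformlyBddLip (polarDomain Plane ρ₀) (1 : ι → ℝ) (fun _ x => x.2) := by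
  refine ⟨1, zero_le_one, fun i x hx => ⟨?_, fun y _ => ?_⟩⟩
  · rw [norm_snd_of_mem hx, Pi.one_apply, mul_one]
  · rw [Pi.one_apply, mul_one, one_mul, ← dist_eq_norm]
    exact le_max_right _ _

theorem uniformlyBddLip_saddle :
    UniformlyBddLip (polarDomain Plane ρ₀) (1 : ι → ℝ) (fun _ x => saddle x.2) :=
  uniformlyBddLip_snd.comp (saddle : Plane →L[ℝ] Plane).lipschitz.lipschitzOnWith
    (fun _ => mapsTo_univ _ _) (mem_univ 0)

theorem uniformlyBddLip_expansion :
    UniformlyBddLip (polarDomain Plane ρ₀) (1 : ι → ℝ) (fun _ x => expansion x) :=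
  uniformlyBddLip_saddle.norm

theorem uniformlyBddLip_expansion_sq :
    UniformlyBddLip (polarDomain Plane ρ₀) (1 : ι → ℝ) (fun _ x => expansion x ^ 2) := by
  simpa only [sq] using uniformlyBddLip_expansion.mul uniformlyBddLip_expansion

theorem uniformlyBddLip_imDir :
    UniformlyBddLip (polarDomain Plane ρ₀) (1 : ι → ℝ) (fun _ x => imDir x) :=
  (uniformlyBddLip_expansion.inv lam_inv_pos fun _ _ hx => le_expansion (norm_snd_of_mem hx)).smul
    uniformlyBddLip_saddle

theorem uniformlyBddLip_outRadius (hδ : 0 < δ) :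
    UniformlyBddLip (polarDomain Plane ρ₀) (1 : ι → ℝ) (fun _ x => outRadius δ x) :=
  (uniformlyBddLip_fst.add (.const (δ ^ 2))).sqrt (pow_pos hδ 2)
    fun _ _ hx => le_add_of_nonneg_left hx.1.1

theorem uniformlyBddLip_outPoint (hδ : 0 < δ) :
    UniformlyBddLip (polarDomain Plane ρ₀) (1 : ι → ℝ) (fun _ x => outPoint δ x) :=
  (uniformlyBddLip_outRadius hδ).smul uniformlyBddLip_snd

theorem uniformlyBddLip_outPoint' (hδ : 0 < δ) :
    UniformlyBddLip (polarDomain Plane ρ₀) (1 : ι → ℝ) (fun _ x => outPoint' δ x) :=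
  (((UniformlyBddLip.const 2).mul (uniformlyBddLip_outRadius hδ)).inv (c := 2 * δ)
    (by positivity) fun _ _ hx => mul_le_mul_of_nonneg_left (le_outRadius hδ hx.1.1)
      zero_le_two).smul uniformlyBddLip_snd

theorem uniformlyBddLip_imRadius (hδ : 0 < δ) :
    UniformlyBddLip (polarDomain Plane ρ₀) (1 : ι → ℝ) (fun _ x => imRadius δ x) :=
  ((uniformlyBddLip_fst.mul uniformlyBddLip_expansion_sq).add (.const (δ ^ 2))).sqrt (pow_pos hδ 2)
    fun _ _ hx => le_add_of_nonneg_left (mul_nonneg hx.1.1 (sq_nonneg _))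

theorem uniformlyBddLip_imPoint (hδ : 0 < δ) :
    UniformlyBddLip (polarDomain Plane ρ₀) (1 : ι → ℝ) (fun _ x => imPoint δ x) :=
  (uniformlyBddLip_imRadius hδ).smul uniformlyBddLip_imDir

theorem uniformlyBddLip_imPoint' (hδ : 0 < δ) :
    UniformlyBddLip (polarDomain Plane ρ₀) (1 : ι → ℝ) (fun _ x => imPoint' δ x) :=
  (uniformlyBddLip_expansion_sq.mul
    (((UniformlyBddLip.const 2).mul (uniformlyBddLip_imRadius hδ)).inv (c := 2 * δ)
      (by positivity) fun _ _ hx => mul_le_mul_of_nonneg_left (le_imRadius hδ hx.1.1)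
        zero_le_two)).smul uniformlyBddLip_imDir

variable {w : ι → ℝ} {v : ι → Plane → Plane}

theorem uniformlyBddLip_comp_outPoint {E : Type*} [NormedAddCommGroup E] (hδ : 0 < δ)
    {f : ι → Plane → E} (hbound : ∀ i x, ‖f i x‖ ≤ w i)
    (hlip : ∀ i x y, ‖f i x - f i y‖ ≤ w i * ‖x - y‖) :
    UniformlyBddLip (polarDomain Plane ρ₀) w (fun i x => f i (outPoint δ x)) := by
  obtain ⟨K, hK, H⟩ := uniformlyBddLip_outPoint (ρ₀ := ρ₀) (ι := ι) hδ
  refine ⟨1 + K, by positivity, fun i x hx => ?_⟩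
  have hw : 0 ≤ w i := (norm_nonneg _).trans (hbound i 0)
  refine ⟨(hbound i _).trans (le_mul_of_one_le_left hw (le_add_of_nonneg_right hK)), fun y hy => ?_⟩
  calc ‖f i (outPoint δ x) - f i (outPoint δ y)‖ ≤ w i * (K * 1 * dist x y) :=
        (hlip i _ _).trans (mul_le_mul_of_nonneg_left ((H i x hx).2 y hy) hw)
    _ ≤ (1 + K) * w i * dist x y := by linarith [mul_nonneg hw (dist_nonneg (x := x) (y := y))]

theorem uniformlyBddLip_perturbation (hδ : 0 < δ) (hv : ∀ i, SmallC2 (w i) (v i)) :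
    UniformlyBddLip (polarDomain Plane ρ₀) w (fun i x => v i (outPoint δ x)) :=
  uniformlyBddLip_comp_outPoint hδ (fun i => (hv i).bound) fun i => (hv i).lip

theorem uniformlyBddLip_fderiv_perturbation (hδ : 0 < δ) (hv : ∀ i, SmallC2 (w i) (v i)) :
    UniformlyBddLip (polarDomain Plane ρ₀) w
      (fun i x => fderiv ℝ (v i) (outPoint δ x) (outPoint' δ x)) :=
  (uniformlyBddLip_outPoint' hδ).bilin (ContinuousLinearMap.apply ℝ Plane)
    (uniformlyBddLip_comp_outPoint hδ (fun i => (hv i).bound_fderiv) fun i => (hv i).lip_fderiv)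

theorem uniformlyBddLip_change (hδ : 0 < δ) (hw : ∀ i, w i ≤ 1) (hv : ∀ i, SmallC2 (w i) (v i)) :
    UniformlyBddLip (polarDomain Plane ρ₀) w (fun i x => change δ (v i) x) := by
  have hU := uniformlyBddLip_perturbation (ρ₀ := ρ₀) hδ hv
  exact ((UniformlyBddLip.const 2).mul ((uniformlyBddLip_imPoint hδ).inner hU)).add
    ((hU.mono_weight hw).inner hU)

theorem uniformlyBddLip_change' (hδ : 0 < δ) (hw : ∀ i, w i ≤ 1) (hv : ∀ i, SmallC2 (w i) (v i)) :
    UniformlyBddLip (polarDomain Plane ρ₀) w (fun i x => change' δ (v i) x) := by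
  have hU := uniformlyBddLip_perturbation (ρ₀ := ρ₀) hδ hv
  have hD := uniformlyBddLip_fderiv_perturbation (ρ₀ := ρ₀) hδ hv
  exact ((UniformlyBddLip.const 2).mul (((uniformlyBddLip_imPoint' hδ).inner hU).add
    ((uniformlyBddLip_imPoint hδ).inner hD))).add
    ((UniformlyBddLip.const 2).mul ((hU.mono_weight hw).inner hD))

theorem uniformlyBddLip_quotient (hδ : 0 < δ) (hw : ∀ i, w i ≤ 1)
    (hv : ∀ i, SmallC2 (w i) (v i)) :
    UniformlyBddLip (polarDomain Plane ρ₀) w (fun i x => quotient δ (v i) x) :=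
  (uniformlyBddLip_change' hδ hw hv).average

theorem le_norm_pertPoint (hδ : 0 < δ) (hηδ : η ≤ δ / 2) (hu : SmallC2 η u)
    (hx : x ∈ polarDomain Plane ρ₀) : δ / 2 ≤ ‖pertPoint δ u x‖ := by
  have hnorm := norm_imPoint (δ := δ) (norm_snd_of_mem hx)
  have htri := norm_sub_le_norm_add (imPoint δ x) (u (outPoint δ x))
  rw [pertPoint]
  linarith [le_imRadius hδ hx.1.1, hu.bound (outPoint δ x)]

theorem uniformlyBddLip_displacement (hδ : 0 < δ) (hw : ∀ i, w i ≤ 1) (hwδ : ∀ i, w i ≤ δ / 2)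
    (hv : ∀ i, SmallC2 (w i) (v i)) {c : ℝ} (hc : 0 < c)
    (hq : ∀ i, ∀ x ∈ polarDomain Plane ρ₀, c ≤ expansion x ^ 2 + quotient δ (v i) x) :
    UniformlyBddLip (polarDomain Plane ρ₀) w (fun i x => displacement δ (v i) x) := by
  have hU := uniformlyBddLip_perturbation (ρ₀ := ρ₀) hδ hv
  have hQ := uniformlyBddLip_quotient (ρ₀ := ρ₀) hδ hw hv
  have hI := uniformlyBddLip_imPoint (ρ₀ := ρ₀) (ι := ι) hδ
  have hR := uniformlyBddLip_imRadius (ρ₀ := ρ₀) (ι := ι) hδ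
  have hE : UniformlyBddLip (polarDomain Plane ρ₀) 1 (fun i x => pertExpansion δ (v i) x) :=
    (uniformlyBddLip_expansion_sq.add (hQ.mono_weight hw)).sqrt hc hq
  have hN : UniformlyBddLip (polarDomain Plane ρ₀) 1 (fun i x => ‖pertPoint δ (v i) x‖) :=
    (hI.add (hU.mono_weight hw)).norm
  have hN_ge : ∀ i, ∀ x ∈ polarDomain Plane ρ₀, δ / 2 ≤ ‖pertPoint δ (v i) x‖ :=
    fun i _ hx => le_norm_pertPoint hδ (hwδ i) (hv i) hx
  have hden := ((hN.mul hR).mul (hN.add hR)).inv (c := δ / 2 * δ * (δ / 2 + δ)) (by positivity)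
    fun i x hx => by
      have hR_ge := le_imRadius hδ hx.1.1
      have hR_nonneg : 0 ≤ imRadius δ x := hδ.le.trans hR_ge
      have := hN_ge i x hx
      gcongr
  have hsum := (hE.add uniformlyBddLip_expansion).inv lam_inv_pos fun i x hx =>
    (le_expansion (norm_snd_of_mem hx)).trans (le_add_of_nonneg_left (Real.sqrt_nonneg _))
  exact (hE.smul (((hN.inv (half_pos hδ) hN_ge).smul hU).sub
    ((hden.mul (uniformlyBddLip_change hδ hw hv)).smul_flip hI))).add
    ((hsum.mul hQ).smul_flip uniformlyBddLip_imDir)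

end Families

theorem change_eq (hδ : 0 < δ) (hη : η ≤ 1) (hu : SmallC2 η u) (hx : x ∈ polarDomain Plane ρ₀)
    (hzero : change δ u (0, x.2) = 0) : change δ u x = x.1 * quotient δ u x := by
  have hderiv : ∀ t ∈ uIcc (0 : ℝ) 1, HasDerivAt (fun t => change δ u (t * x.1, x.2))
      (x.1 * change' δ u (t * x.1, x.2)) t := by
    intro t ht
    rw [uIcc_of_le zero_le_one] at ht
    have hmul : HasDerivAt (fun t => t * x.1) x.1 t := hasDerivAt_mul_const x.1
    exact (HasDerivAt.comp t (hasDerivAt_change (x := (t * x.1, x.2)) hδ hu.diff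
      (mul_nonneg ht.1 hx.1.1)) hmul).congr_deriv (mul_comm _ _)
  have hcont : ContinuousOn (fun t => change' δ u (t * x.1, x.2)) (uIcc 0 1) := by
    rw [uIcc_of_le zero_le_one]
    refine ((uniformlyBddLip_change' (ρ₀ := ρ₀) (ι := Unit) (w := fun _ => η) (v := fun _ => u) hδ
      (fun _ => hη) fun _ => hu).continuousOn ()).comp (by fun_prop) fun t ht => ?_
    exact ⟨⟨mul_nonneg ht.1 hx.1.1, (mul_le_of_le_one_left hx.1.1 ht.2).trans hx.1.2⟩, hx.2⟩
  have hint := intervalIntegral.integral_eq_sub_of_hasDerivAt hderiv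
    (continuousOn_const.mul hcont).intervalIntegrable
  rw [intervalIntegral.integral_const_mul, one_mul, zero_mul, hzero, sub_zero] at hint
  exact hint.symm

theorem change_zero {e : Plane} (hδ : 0 ≤ δ) (he : ‖e‖ = 1) (hu : PreservesCircle δ u) :
    change δ u (0, e) = 0 := by
  have hpert : pertPoint δ u (0, e) = (δ / ‖saddle e‖) • saddle e + u (δ • e) := by
    simp only [pertPoint, imPoint, imRadius, imDir, expansion, outPoint, outRadius, zero_mul,
      zero_add, Real.sqrt_sq hδ, smul_smul, div_eq_mul_inv]
  have hsq := norm_pertPoint_sq (x := (0, e)) (u := u) (δ := δ) he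
  rw [hpert, hu e he, imRadius_sq le_rfl, zero_mul, zero_add] at hsq
  exact left_eq_add.1 hsq

section Displacement

variable (hδ : 0 < δ) (hx : 0 < x.1) (hx' : ‖x.2‖ = 1) (hq : 0 < expansion x ^ 2 + quotient δ u x)
  (hc : change δ u x = x.1 * quotient δ u x)

include hx hx' hc

theorem norm_pertPoint_sq_eq :
    ‖pertPoint δ u x‖ ^ 2 = δ ^ 2 + x.1 * (expansion x ^ 2 + quotient δ u x) := by
  rw [norm_pertPoint_sq hx', imRadius_sq hx.le, hc]
  ring

include hq

theorem lt_norm_pertPoint : δ < ‖pertPoint δ u x‖ := by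
  refine lt_of_pow_lt_pow_left₀ 2 (norm_nonneg _) ?_
  rw [norm_pertPoint_sq_eq hx hx' hc]
  exact lt_add_of_pos_right _ (mul_pos hx hq)

include hδ

theorem blowIn_pertPoint :
    blowIn δ (pertPoint δ u x) = √x.1 • (saddle x.2 + displacement δ u x) := by
  have hN : 0 < ‖pertPoint δ u x‖ := hδ.trans (lt_norm_pertPoint hx hx' hq hc)
  have he : 0 < expansion x := expansion_pos hx'
  have hI : 0 < imRadius δ x := hδ.trans_le (le_imRadius hδ hx.le)
  have hE : 0 < pertExpansion δ u x := Real.sqrt_pos.2 hq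
  have hsqrt : √(‖pertPoint δ u x‖ ^ 2 - δ ^ 2) = √x.1 * pertExpansion δ u x := by
    rw [norm_pertPoint_sq_eq hx hx' hc, add_sub_cancel_left, Real.sqrt_mul hx.le, pertExpansion]
  have hsaddle : saddle x.2 = expansion x • imDir x := (smul_inv_smul₀ he.ne' _).symm
  have hexpansion : (pertExpansion δ u x + expansion x)⁻¹ * quotient δ u x =
      pertExpansion δ u x - expansion x := by
    have hE_sq : pertExpansion δ u x ^ 2 = expansion x ^ 2 + quotient δ u x := Real.sq_sqrt hq.le
    rw [inv_mul_eq_div, div_eq_iff (by positivity)]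
    linarith
  have hradius : (‖pertPoint δ u x‖ * imRadius δ x * (‖pertPoint δ u x‖ + imRadius δ x))⁻¹ *
      change δ u x = (imRadius δ x)⁻¹ - ‖pertPoint δ u x‖⁻¹ := by
    have hfactor : change δ u x =
        (‖pertPoint δ u x‖ - imRadius δ x) * (‖pertPoint δ u x‖ + imRadius δ x) := by
      linarith [norm_pertPoint_sq (δ := δ) (u := u) hx']
    rw [hfactor]
    field_simp
  have hcancel : (imRadius δ x)⁻¹ • imPoint δ x = imDir x := inv_smul_smul₀ hI.ne' _
  rw [blowIn, hsqrt, displacement, hexpansion, hradius, hsaddle, sub_smul _ _ (imPoint δ x),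
    hcancel, mul_div_assoc, ← smul_smul]
  nth_rw 2 [pertPoint]
  module

end Displacement

theorem exists_abs_quotient_le (hδ : 0 < δ) (ρ₀ : ℝ) {c : ℝ} (hc : 0 < c) :
    ∃ η₁ > 0, ∀ η u, η ≤ η₁ → SmallC2 η u → ∀ x ∈ polarDomain Plane ρ₀, |quotient δ u x| ≤ c := by
  let ι := {q : ℝ × (Plane → Plane) // q.1 ≤ 1 ∧ SmallC2 q.1 q.2}
  obtain ⟨K, hK, HK⟩ := uniformlyBddLip_quotient (ρ₀ := ρ₀) (ι := ι) (w := fun i => i.1.1)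
    (v := fun i => i.1.2) hδ (fun i => i.2.1) (fun i => i.2.2)
  refine ⟨min 1 (c / (K + 1)), by positivity, fun η u hη hu x hx => ?_⟩
  have hηK : η * (K + 1) ≤ c :=
    (le_div_iff₀ (by positivity)).1 (hη.trans (min_le_right _ _))
  calc |quotient δ u x| ≤ K * η := (HK ⟨(η, u), hη.trans (min_le_left _ _), hu⟩ x hx).1
    _ ≤ c := by linarith [hu.nonneg]

theorem sq_expansion_add_quotient_mem (hx : ‖x.2‖ = 1) (hq : |quotient δ u x| ≤ lam⁻¹ ^ 2 / 2) :
    expansion x ^ 2 + quotient δ u x ∈ Icc (lam⁻¹ ^ 2 / 2) (lam ^ 2 + 1) := by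
  have hsmall : lam⁻¹ ^ 2 ≤ 1 :=
    pow_le_one₀ lam_inv_pos.le (lam_inv_le.trans (by norm_num))
  have hlower : lam⁻¹ ^ 2 ≤ expansion x ^ 2 := pow_le_pow_left₀ lam_inv_pos.le (le_expansion hx) 2
  have hupper : expansion x ^ 2 ≤ lam ^ 2 :=
    pow_le_pow_left₀ (expansion_pos hx).le (expansion_le hx) 2
  obtain ⟨hq₁, hq₂⟩ := abs_le.1 hq
  constructor <;> linarith

theorem outPoint_polar (z : Plane) : outPoint δ (polar z) = blowOut δ z := by
  rw [outPoint, outRadius, blowOut, polar, smul_smul, div_eq_mul_inv]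

theorem imPoint_polar {z : Plane} (hz : z ≠ 0) : imPoint δ (polar z) = blowOut δ (saddle z) := by
  have hz' : ‖z‖ ≠ 0 := norm_ne_zero_iff.2 hz
  have hsaddle : ‖saddle z‖ ≠ 0 := norm_ne_zero_iff.2 (saddle.map_ne_zero_iff.2 hz)
  have hexp : expansion (polar z) = ‖z‖⁻¹ * ‖saddle z‖ := by
    rw [expansion, polar, map_smul, norm_smul, norm_inv, norm_norm]
  have hradius : imRadius δ (polar z) = √(‖saddle z‖ ^ 2 + δ ^ 2) := by
    rw [imRadius, hexp, polar, mul_pow, inv_pow, mul_inv_cancel_left₀ (pow_ne_zero 2 hz')]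
  rw [imPoint, hradius, imDir, hexp, blowOut, polar, map_smul, smul_smul, smul_smul]
  congr 1
  field_simp

theorem pertPoint_polar {z : Plane} (hz : z ≠ 0) :
    pertPoint δ u (polar z) = blowOut δ (saddle z) + u (blowOut δ z) := by
  rw [pertPoint, imPoint_polar hz, outPoint_polar]

end PolarSaddle

open PolarSaddle in
theorem blowOut_saddle_add {δ τ η : ℝ} {u : Plane → Plane} (hδ : 0 < δ) (hη : η ≤ 1)
    (hu : SmallC2 η u) (hcirc : PreservesCircle δ u)
    (hq : ∀ x ∈ polarDomain Plane (τ ^ 2), |quotient δ u x| ≤ lam⁻¹ ^ 2 / 2)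
    {x : Plane} (hx : x ≠ 0) (hxτ : ‖x‖ ≤ τ) :
    δ < ‖blowOut δ (saddle x) + u (blowOut δ x)‖ ∧
      ‖blowOut δ (saddle x) + u (blowOut δ x)‖ ^ 2 ≤ δ ^ 2 + (lam ^ 2 + 1) * τ ^ 2 ∧
      blowIn δ (blowOut δ (saddle x) + u (blowOut δ x)) - saddle x =
        ‖x‖ • displacement δ u (polar x) := by
  have hnorm : 0 < ‖x‖ := norm_pos_iff.2 hx
  have hmem := polar_mem_polarDomain hx hxτ
  have hfst : 0 < (polar x).1 := pow_pos hnorm 2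
  have hsnd : ‖(polar x).2‖ = 1 := norm_snd_of_mem hmem
  have hexp := sq_expansion_add_quotient_mem hsnd (hq _ hmem)
  have hpos : 0 < expansion (polar x) ^ 2 + quotient δ u (polar x) :=
    (half_pos (pow_pos lam_inv_pos 2)).trans_le hexp.1
  have hchange := change_eq hδ hη hu hmem (change_zero hδ.le hsnd hcirc)
  rw [← pertPoint_polar hx]
  refine ⟨lt_norm_pertPoint hfst hsnd hpos hchange, ?_, ?_⟩
  · rw [norm_pertPoint_sq_eq hfst hsnd hchange, mul_comm (lam ^ 2 + 1)]
    exact add_le_add le_rfl (mul_le_mul hmem.1.2 hexp.2 hpos.le (sq_nonneg τ))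
  · rw [blowIn_pertPoint hδ hfst hsnd hpos hchange, polar, Real.sqrt_sq hnorm.le, smul_add,
      map_smul, smul_inv_smul₀ hnorm.ne', add_sub_cancel_left]

open PolarSaddle in
/- Only `blowIn` of the perturbed map is singular; in polar coordinates its displacement is `‖x‖`
times a Lipschitz function of size `η`, which is Lipschitz in `x`. -/
theorem exists_blowDown_estimate {δ : ℝ} (hδ : 0 < δ) (τ : ℝ) : ∃ C η₁ : ℝ, 0 < C ∧ 0 < η₁ ∧
    ∀ η u, η ≤ η₁ → SmallC2 η u → PreservesCircle δ u →
      (∀ x, x ≠ 0 → ‖x‖ ≤ τ → δ < ‖blowOut δ (saddle x) + u (blowOut δ x)‖ ∧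
        ‖blowOut δ (saddle x) + u (blowOut δ x)‖ ^ 2 ≤ δ ^ 2 + (lam ^ 2 + 1) * τ ^ 2) ∧
      ∀ g : Plane → Plane, g 0 = 0 →
        (∀ x, x ≠ 0 → ‖x‖ ≤ τ →
          g x = blowIn δ (blowOut δ (saddle x) + u (blowOut δ x)) - saddle x) →
        ∀ x y, ‖x‖ ≤ τ → ‖y‖ ≤ τ → ‖g x - g y‖ ≤ C * η * ‖x - y‖ := by
  have hc : 0 < lam⁻¹ ^ 2 / 2 := half_pos (pow_pos lam_inv_pos 2)
  obtain ⟨η₂, hη₂, quotient_le⟩ := exists_abs_quotient_le hδ (τ ^ 2) hc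
  let η₁ : ℝ := min η₂ (min 1 (δ / 2))
  let ι := {q : ℝ × (Plane → Plane) // q.1 ≤ η₁ ∧ SmallC2 q.1 q.2}
  have hι : ∀ i : ι, i.1.1 ≤ η₂ ∧ i.1.1 ≤ 1 ∧ i.1.1 ≤ δ / 2 := fun i => by
    simpa only [η₁, le_min_iff] using i.2.1
  obtain ⟨C, hC, HC⟩ := uniformlyBddLip_displacement (ρ₀ := τ ^ 2) (ι := ι) (w := fun i => i.1.1)
    (v := fun i => i.1.2) hδ (fun i => (hι i).2.1) (fun i => (hι i).2.2) (fun i => i.2.2) hc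
    fun i x hx => (sq_expansion_add_quotient_mem (norm_snd_of_mem hx)
      (quotient_le _ _ (hι i).1 i.2.2 x hx)).1
  refine ⟨(2 * τ ^ 2 + 3) * C + 1, η₁, by positivity, by positivity, fun η u hη hu hcirc => ?_⟩
  have hη' := hι ⟨(η, u), hη, hu⟩
  have key := fun (x : Plane) => blowOut_saddle_add (x := x) hδ hη'.2.1 hu hcirc
    (quotient_le η u hη'.1 hu)
  refine ⟨fun x hx hxτ => ⟨(key x hx hxτ).1, (key x hx hxτ).2.1⟩, fun g hg₀ hg x y hxτ hyτ => ?_⟩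
  have g_eq : ∀ x, ‖x‖ ≤ τ → g x = ‖x‖ • displacement δ u (polar x) := fun x hxτ => by
    rcases eq_or_ne x 0 with rfl | hx
    · rw [hg₀, norm_zero, zero_smul]
    · exact (hg x hx hxτ).trans (key x hx hxτ).2.2
  calc ‖g x - g y‖ ≤ (2 * τ ^ 2 + 3) * (C * η) * ‖x - y‖ := by
        rw [g_eq x hxτ, g_eq y hyτ]
        exact norm_smul_polar_sub_le (HC ⟨(η, u), hη, hu⟩) hxτ hyτ
    _ ≤ ((2 * τ ^ 2 + 3) * C + 1) * η * ‖x - y‖ := by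
        linarith [mul_nonneg hu.nonneg (norm_nonneg (x - y))]

/-! ### The covering of the torus -/

/-- The covering homomorphism `ℝ² → ℝ² / ℤ²`. -/
def projHom : Plane →+ Torus where
  toFun := proj
  map_zero' := funext fun _ => by simp [proj]
  map_add' z z' := funext fun i => by simp [proj]

theorem continuous_proj : Continuous proj :=
  continuous_pi fun i => (AddCircle.continuous_mk' 1).comp (by fun_prop)

theorem proj_surjective : Function.Surjective proj := fun p => by
  choose f hf using fun i => QuotientAddGroup.mk_surjective (p i)
  exact ⟨WithLp.toLp 2 f, funext hf⟩

theorem isOpenMap_proj : IsOpenMap proj :=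
  (IsOpenMap.piMap (fun _ => QuotientAddGroup.isOpenMap_coe) (by simp)).comp
    (PiLp.homeomorph 2 fun _ : Fin 2 => ℝ).isOpenMap

theorem proj_eq_zero_iff {z : Plane} : proj z = 0 ↔ ∀ i, ∃ n : ℤ, z i = n :=
  funext_iff.trans <| forall_congr' fun i => by
    change (z i : UnitAddCircle) = 0 ↔ _
    rw [AddCircle.coe_eq_zero_iff]
    exact exists_congr fun n => by simp [eq_comm]

theorem torusA_proj (z : Plane) : torusA (proj z) = proj (planeA z) := by
  funext i
  fin_cases i <;> simp [torusA, proj, planeA, ← AddCircle.coe_nsmul]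

theorem torusA_zero : torusA 0 = 0 := by
  funext i
  fin_cases i <;> simp [torusA]

-- The matrix of `A` has determinant `1`, so its inverse has the integer entries `5, -8, -8, 13`.
theorem eq_zero_of_torusA_eq_zero {p : Torus} (hp : torusA p = 0) : p = 0 := by
  have h0 : (13 : ℕ) • p 0 + (8 : ℕ) • p 1 = 0 := congrFun hp 0
  have h1 : (8 : ℕ) • p 0 + (5 : ℕ) • p 1 = 0 := congrFun hp 1
  have hp0 : p 0 = 5 • ((13 : ℕ) • p 0 + (8 : ℕ) • p 1) - 8 • ((8 : ℕ) • p 0 + (5 : ℕ) • p 1) := by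
    abel
  have hp1 : p 1 = 13 • ((8 : ℕ) • p 0 + (5 : ℕ) • p 1) - 8 • ((13 : ℕ) • p 0 + (8 : ℕ) • p 1) := by
    abel
  rw [h0, h1, nsmul_zero, nsmul_zero, sub_zero] at hp0 hp1
  exact funext (Fin.forall_fin_two.2 ⟨hp0, hp1⟩)

theorem two_nsmul_proj_center (i : Fin 4) : 2 • proj (center i) = 0 := by
  rw [← show projHom (center i) = proj (center i) from rfl, ← map_nsmul]
  refine proj_eq_zero_iff.2 fun j => ?_
  fin_cases i <;> fin_cases j <;>
    first | (refine ⟨0, ?_⟩; simp [center]; done) | (refine ⟨1, ?_⟩; simp [center])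

theorem exists_proj_eq_center {z : Plane} (hz : 2 • proj z = 0) :
    ∃ i, proj z = proj (center i) := by
  have hint := proj_eq_zero_iff.1 (show proj (2 • z) = 0 from (map_nsmul projHom 2 z).trans hz)
  obtain ⟨a, ha⟩ := hint 0
  obtain ⟨b, hb⟩ := hint 1
  replace ha : 2 * z 0 = a := by simpa using ha
  replace hb : 2 * z 1 = b := by simpa using hb
  suffices h : ∃ i, ∀ j, ∃ n : ℤ, (z - center i) j = n by
    obtain ⟨i, hi⟩ := h
    exact ⟨i, sub_eq_zero.1 ((map_sub projHom _ _).symm.trans (proj_eq_zero_iff.2 hi))⟩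
  have of_even : ∀ {s : ℝ} {n : ℤ}, 2 * s = n → Even n → ∃ k : ℤ, s - 0 = k := by
    rintro s _ h ⟨k, rfl⟩
    exact ⟨k, by push_cast at h; linarith⟩
  have of_odd : ∀ {s : ℝ} {n : ℤ}, 2 * s = n → Odd n → ∃ k : ℤ, s - 1 / 2 = k := by
    rintro s _ h ⟨k, rfl⟩
    exact ⟨k, by push_cast at h; linarith⟩
  rcases Int.even_or_odd a with a_even | a_odd <;> rcases Int.even_or_odd b with b_even | b_odd
  · exact ⟨0, Fin.forall_fin_two.2 ⟨of_even ha a_even, of_even hb b_even⟩⟩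
  · exact ⟨3, Fin.forall_fin_two.2 ⟨of_even ha a_even, of_odd hb b_odd⟩⟩
  · exact ⟨2, Fin.forall_fin_two.2 ⟨of_odd ha a_odd, of_even hb b_even⟩⟩
  · exact ⟨1, Fin.forall_fin_two.2 ⟨of_odd ha a_odd, of_odd hb b_odd⟩⟩

namespace Data

variable (D : Data)

/-- The covering homomorphism in the linear coordinates. -/
def cover : Plane →+ Torus := projHom.comp (D.P.symm : Plane →+ Plane)

/-- The lattice of deck transformations in the linear coordinates. -/
def deck : AddSubgroup Plane := D.cover.ker

/-- The lattice formed by all lifts of the points `Ωᵢ`. -/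
def centers : AddSubgroup Plane := D.deck.comap (nsmulAddMonoidHom 2)

theorem mem_deck {w : Plane} : w ∈ D.deck ↔ D.cover w = 0 := Iff.rfl

theorem deck_le_centers : D.deck ≤ D.centers := fun _ hw => D.deck.nsmul_mem hw 2

theorem cover_eq_iff {w w' : Plane} : D.cover w = D.cover w' ↔ w - w' ∈ D.deck := by
  rw [mem_deck, map_sub, sub_eq_zero]

theorem continuous_cover : Continuous D.cover := continuous_proj.comp D.P.symm.continuous

theorem cover_surjective : Function.Surjective D.cover :=
  proj_surjective.comp D.P.symm.surjective

theorem isOpenMap_cover : IsOpenMap D.cover :=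
  isOpenMap_proj.comp D.P.symm.toHomeomorph.isOpenMap

theorem chartAt_eq (i : Fin 4) (v : Plane) :
    chartAt D.P i v = proj (center i) + D.cover v :=
  map_add projHom _ _

theorem chartAt_eq_cover_iff {i : Fin 4} {v w : Plane} :
    chartAt D.P i v = D.cover w ↔ D.cover (w - v) = proj (center i) := by
  rw [map_sub, sub_eq_iff_eq_add, chartAt_eq, eq_comm]

theorem sub_mem_centers_iff {w v : Plane} :
    w - v ∈ D.centers ↔ ∃ i, chartAt D.P i v = D.cover w := by
  have htwo : w - v ∈ D.centers ↔ 2 • D.cover (w - v) = 0 := by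
    rw [← map_nsmul]
    exact D.mem_deck
  simp only [chartAt_eq_cover_iff, htwo]
  exact ⟨exists_proj_eq_center, fun ⟨i, hi⟩ => hi ▸ two_nsmul_proj_center i⟩

theorem exists_chartAt_iff {w : Plane} {r : ℝ} :
    (∃ q : Fin 4 × Plane, ‖q.2‖ ≤ r ∧ chartAt D.P q.1 q.2 = D.cover w) ↔
      ∃ c ∈ D.centers, ‖w - c‖ ≤ r := by
  constructor
  · rintro ⟨⟨i, v⟩, hv, hchart⟩
    exact ⟨w - v, D.sub_mem_centers_iff.2 ⟨i, hchart⟩, by rwa [sub_sub_cancel]⟩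
  · rintro ⟨c, hc, hle⟩
    obtain ⟨i, hi⟩ := D.sub_mem_centers_iff.1 (show w - (w - c) ∈ _ by rwa [sub_sub_cancel])
    exact ⟨(i, w - c), hle, hi⟩

theorem torusA_cover (w : Plane) : torusA (D.cover w) = D.cover (saddle w) := by
  have hP : D.P (planeA (D.P.symm w)) = saddle w := by
    rw [D.P_planeA, exp_neg_sigma, ContinuousLinearEquiv.apply_symm_apply]
    rfl
  rw [← hP]
  refine (torusA_proj _).trans (congrArg proj ?_)
  exact (D.P.symm_apply_apply _).symm

theorem saddle_mem_deck_iff {w : Plane} : saddle w ∈ D.deck ↔ w ∈ D.deck := by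
  rw [mem_deck, mem_deck, ← torusA_cover]
  exact ⟨eq_zero_of_torusA_eq_zero, fun h => by rw [h, torusA_zero]⟩

theorem saddle_symm_mem_deck_iff {w : Plane} : saddle.symm w ∈ D.deck ↔ w ∈ D.deck := by
  rw [← saddle_mem_deck_iff, ContinuousLinearEquiv.apply_symm_apply]

theorem saddle_mem_centers_iff {w : Plane} : saddle w ∈ D.centers ↔ w ∈ D.centers := by
  change 2 • saddle w ∈ D.deck ↔ 2 • w ∈ D.deck
  rw [← map_nsmul, saddle_mem_deck_iff]

theorem saddle_symm_mem_centers_iff {w : Plane} : saddle.symm w ∈ D.centers ↔ w ∈ D.centers := by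
  rw [← saddle_mem_centers_iff, ContinuousLinearEquiv.apply_symm_apply]

theorem ε_pos : 0 < D.ε := D.δ_pos.trans D.δ_lt

-- The midpoint of two lifts of distinct points `Ωᵢ` would lie in the closures of two discs.
theorem two_mul_ε_lt_of_not_mem_deck {c c' : Plane} (hc : c ∈ D.centers) (hc' : c' ∈ D.centers)
    (h : c - c' ∉ D.deck) : 2 * D.ε < ‖c - c'‖ := by
  by_contra! hle
  set m := (1 / 2 : ℝ) • (c - c') with hm
  have hm_norm : ‖m‖ ≤ D.ε := by
    rw [hm, norm_smul, Real.norm_of_nonneg (by norm_num)]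
    linarith
  have hmid : c - m = c' + m := by
    rw [hm]
    module
  obtain ⟨i, hi⟩ := D.sub_mem_centers_iff.1 (show c - m - (-m) ∈ _ by rwa [sub_neg_eq_add,
    sub_add_cancel])
  obtain ⟨j, hj⟩ := D.sub_mem_centers_iff.1 (show c' + m - m ∈ _ by rwa [add_sub_cancel_right])
  have hij : i ≠ j := by
    rintro rfl
    refine h (D.cover_eq_iff.1 ?_)
    rw [chartAt_eq_cover_iff] at hi hj
    rw [sub_neg_eq_add, sub_add_cancel] at hi
    rw [add_sub_cancel_right] at hj
    rw [hi, hj]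
  exact disjoint_left.1 (D.disjoint_discs i j hij) ⟨-m, by simpa using hm_norm, hi⟩
    ⟨m, by simpa using hm_norm, hj.trans (congrArg _ hmid.symm)⟩

theorem eq_zero_of_pow_smul_mem_deck {v : Plane} (hv : ∀ n : ℕ, (1 / 2 : ℝ) ^ n • v ∈ D.deck) :
    v = 0 := by
  suffices hz : D.P.symm v = 0 by simpa using hz
  ext i
  have lim : Tendsto (fun n : ℕ => (1 / 2 : ℝ) ^ n * |D.P.symm v i|) atTop (𝓝 0) := by
    simpa using (tendsto_pow_atTop_nhds_zero_of_lt_one (r := (1 / 2 : ℝ)) (by norm_num)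
      (by norm_num)).mul_const |D.P.symm v i|
  obtain ⟨n, hn⟩ := (lim.eventually (gt_mem_nhds one_pos)).exists
  obtain ⟨k, hk⟩ := proj_eq_zero_iff.1 (D.mem_deck.1 (hv n)) i
  replace hk : (1 / 2 : ℝ) ^ n * D.P.symm v i = k := by
    rw [← hk]
    exact congrArg (· i) (map_smul D.P.symm _ _).symm
  have hk_zero : k = 0 := by
    rw [← Int.abs_lt_one_iff, ← Int.cast_lt (R := ℝ), Int.cast_abs, ← hk, abs_mul,
      abs_of_pos (by positivity)]
    simpa using hn
  rw [hk_zero, Int.cast_zero] at hk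
  exact (mul_eq_zero.1 hk).resolve_left (by positivity)

theorem two_mul_ε_lt_of_ne {c c' : Plane} (hc : c ∈ D.centers) (hc' : c' ∈ D.centers)
    (h : c ≠ c') : 2 * D.ε < ‖c - c'‖ := by
  by_cases hdeck : c - c' ∈ D.deck
  swap
  · exact D.two_mul_ε_lt_of_not_mem_deck hc hc' hdeck
  by_contra! hle
  refine h (sub_eq_zero.1 (D.eq_zero_of_pow_smul_mem_deck fun n => ?_))
  induction n with
  | zero => simpa using hdeck
  | succ n ih =>
    by_contra hn
    have hmem : (1 / 2 : ℝ) ^ (n + 1) • (c - c') ∈ D.centers := by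
      change 2 • ((1 / 2 : ℝ) ^ (n + 1) • (c - c')) ∈ D.deck
      convert ih using 1
      rw [pow_succ]
      module
    have hfar := D.two_mul_ε_lt_of_not_mem_deck hmem D.centers.zero_mem (by rwa [sub_zero])
    rw [sub_zero, norm_smul, Real.norm_of_nonneg (by positivity)] at hfar
    have hpow : (1 / 2 : ℝ) ^ (n + 1) * ‖c - c'‖ ≤ ‖c - c'‖ :=
      mul_le_of_le_one_left (norm_nonneg _) (pow_le_one₀ (by norm_num) (by norm_num))
    linarith

theorem eq_of_near {c c' : Plane} (hc : c ∈ D.centers) (hc' : c' ∈ D.centers)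
    (h : ‖c - c'‖ ≤ 2 * D.ε) : c = c' := by
  by_contra hne
  linarith [D.two_mul_ε_lt_of_ne hc hc' hne]

theorem cover_inj_of_near {w w' : Plane} (h : D.cover w = D.cover w')
    (hn : ‖w - w'‖ ≤ 2 * D.ε) : w = w' :=
  sub_eq_zero.1 <| D.eq_of_near (D.deck_le_centers (D.cover_eq_iff.1 h)) D.centers.zero_mem
    (by rwa [sub_zero])

/-! ### Lifts of the surgery maps -/

open Classical in
/-- The lift of `surgery χ` in the linear coordinates. -/
def surgeryLift (χ : ℝ → ℝ) (w : Plane) : Plane :=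
  if h : ∃ c ∈ D.centers, ‖w - c‖ ≤ D.ε then h.choose + radial χ (w - h.choose) else w

/-- The preimage of the island in the linear coordinates. -/
def islandLift : Set Plane := {w | ∀ c ∈ D.centers, D.δ < ‖w - c‖}

variable {D} {χ : ℝ → ℝ}

theorem surgeryLift_of_mem {w c : Plane} (hc : c ∈ D.centers) (h : ‖w - c‖ ≤ D.ε) :
    D.surgeryLift χ w = c + radial χ (w - c) := by
  have hex : ∃ c ∈ D.centers, ‖w - c‖ ≤ D.ε := ⟨c, hc, h⟩
  have hchoose : hex.choose = c := by
    refine D.eq_of_near hex.choose_spec.1 hc ?_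
    rw [← sub_sub_sub_cancel_left _ _ w]
    exact (norm_sub_le _ _).trans (by linarith [hex.choose_spec.2])
  rw [surgeryLift, dif_pos hex, hchoose]

theorem surgeryLift_of_far {w : Plane} (h : ∀ c ∈ D.centers, D.ε < ‖w - c‖) :
    D.surgeryLift χ w = w :=
  dif_neg fun ⟨c, hc, hle⟩ => (h c hc).not_ge hle

theorem surgeryLift_add {w l : Plane} (hl : l ∈ D.centers) :
    D.surgeryLift χ (w + l) = D.surgeryLift χ w + l := by
  by_cases h : ∃ c ∈ D.centers, ‖w - c‖ ≤ D.ε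
  · obtain ⟨c, hc, hle⟩ := h
    rw [surgeryLift_of_mem hc hle, surgeryLift_of_mem (D.centers.add_mem hc hl)
      (by rwa [add_sub_add_right_eq_sub]), add_sub_add_right_eq_sub]
    abel
  · push Not at h
    rw [surgeryLift_of_far h, surgeryLift_of_far]
    intro c hc
    have := h _ (D.centers.sub_mem hc hl)
    rwa [sub_sub_eq_add_sub] at this

theorem surgery_cover (w : Plane) : D.surgery χ (D.cover w) = D.cover (D.surgeryLift χ w) := by
  unfold surgery
  split_ifs with h
  · obtain ⟨hnorm, hchart⟩ := h.choose_spec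
    set q := h.choose
    rw [surgeryLift_of_mem (D.sub_mem_centers_iff.2 ⟨q.1, hchart⟩) (by rwa [sub_sub_cancel]),
      sub_sub_cancel, map_add, D.chartAt_eq_cover_iff.1 hchart, chartAt_eq]
  · rw [D.exists_chartAt_iff] at h
    push Not at h
    rw [surgeryLift_of_far h]

theorem cover_mem_island_iff {w : Plane} : D.cover w ∈ D.island ↔ w ∈ D.islandLift := by
  have hdisc : D.cover w ∈ D.island ↔ ¬ ∃ q : Fin 4 × Plane, ‖q.2‖ ≤ D.δ ∧
      chartAt D.P q.1 q.2 = D.cover w := by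
    simp [island, V]
  rw [hdisc, exists_chartAt_iff]
  simp only [islandLift, mem_ofPred_eq, not_exists, not_and, not_le]

theorem hatF_cover {w : Plane} (hw : w ∈ D.islandLift) : D.hatF (D.cover w) =
    D.cover (D.surgeryLift D.ψinv (saddle (D.surgeryLift D.ψ w))) := by
  have h := cover_mem_island_iff.2 hw
  rw [hatF, dif_neg, Psi, PsiInv, surgery_cover, torusA_cover, surgery_cover]
  simpa [island, V] using h

end Data

namespace Data

/-! ### The radial diffeomorphisms -/

section Radial

variable {χ : ℝ → ℝ}

theorem norm_radial {w : Plane} (hw : w ≠ 0) : ‖radial χ w‖ = √(2 * χ (‖w‖ ^ 2 / 2)) := by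
  rw [radial, norm_smul, norm_div, norm_norm, div_mul_cancel₀ _ (norm_ne_zero_iff.2 hw),
    Real.norm_of_nonneg (Real.sqrt_nonneg _)]

theorem radial_eq_self {w : Plane} (h : χ (‖w‖ ^ 2 / 2) = ‖w‖ ^ 2 / 2) : radial χ w = w := by
  rcases eq_or_ne w 0 with rfl | hw
  · exact smul_zero _
  · rw [radial, h, mul_div_cancel₀ _ two_ne_zero, Real.sqrt_sq (norm_nonneg _),
      div_self (norm_ne_zero_iff.2 hw), one_smul]

theorem radial_radial {χ' : ℝ → ℝ} {w : Plane} (hw : w ≠ 0) (hpos : 0 < χ (‖w‖ ^ 2 / 2))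
    (h : χ' (χ (‖w‖ ^ 2 / 2)) = ‖w‖ ^ 2 / 2) : radial χ' (radial χ w) = w := by
  have hnorm : 0 < ‖w‖ := norm_pos_iff.2 hw
  have hsqrt : 0 < √(2 * χ (‖w‖ ^ 2 / 2)) := Real.sqrt_pos.2 (by linarith)
  rw [radial, norm_radial hw, Real.sq_sqrt (by linarith), mul_div_cancel_left₀ _ two_ne_zero, h,
    mul_div_cancel₀ _ two_ne_zero, Real.sqrt_sq hnorm.le, radial, smul_smul,
    div_mul_div_cancel₀ hsqrt.ne', div_self hnorm.ne', one_smul]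

end Radial

variable (D : Data)

theorem ψ_left : D.ψ (D.δ ^ 2 / 2) = 0 := by
  simpa using D.ψ_inner.self_of_nhdsWithin (mem_Ici.2 le_rfl)

variable {D}

theorem sq_lt : D.δ ^ 2 < D.ε ^ 2 := pow_lt_pow_left₀ D.δ_lt D.δ_pos.le two_ne_zero

theorem ψ_pos {ρ : ℝ} (hρ : ρ ∈ Ioc (D.δ ^ 2 / 2) (D.ε ^ 2 / 2)) : 0 < D.ψ ρ := by
  have hmem := Ioc_subset_Icc_self hρ
  refine (D.ψ_bij.mapsTo hmem).1.lt_of_ne' fun hzero => hρ.1.ne' ?_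
  exact D.ψ_bij.injOn hmem ⟨le_rfl, hmem.1.trans hmem.2⟩ (hzero.trans D.ψ_left.symm)

theorem ψinv_mem {y : ℝ} (hy : y ∈ Icc 0 (D.ε ^ 2 / 2)) :
    D.ψinv y ∈ Icc (D.δ ^ 2 / 2) (D.ε ^ 2 / 2) := by
  obtain ⟨ρ, hρ, rfl⟩ := D.ψ_bij.surjOn hy
  rwa [D.ψinv_inv.1 hρ]

theorem lt_ψinv {y : ℝ} (hy : y ∈ Ioc 0 (D.ε ^ 2 / 2)) : D.δ ^ 2 / 2 < D.ψinv y := by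
  have hmem := Ioc_subset_Icc_self hy
  refine (ψinv_mem hmem).1.lt_of_ne fun heq => hy.1.ne ?_
  rw [← D.ψinv_inv.2 hmem, ← heq, D.ψ_left]

theorem half_sq_mem_Ioc {a r : ℝ} (ha : 0 ≤ a) (har : a < r) (hr : r ≤ D.ε) :
    r ^ 2 / 2 ∈ Ioc (a ^ 2 / 2) (D.ε ^ 2 / 2) := by
  have := ha.trans har.le
  exact ⟨by gcongr, by gcongr⟩

theorem half_sq_norm_mem_Ioc {w : Plane} (hw : w ≠ 0) (hle : ‖w‖ ≤ D.ε) :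
    ‖w‖ ^ 2 / 2 ∈ Ioc 0 (D.ε ^ 2 / 2) := by
  simpa using half_sq_mem_Ioc le_rfl (norm_pos_iff.2 hw) hle

section

variable {w : Plane}

theorem ne_zero_of_δ_lt_norm (hw : D.δ < ‖w‖) : w ≠ 0 := norm_pos_iff.1 (D.δ_pos.trans hw)

theorem radial_ψ_ne_zero (hw : D.δ < ‖w‖) (hle : ‖w‖ ≤ D.ε) : radial D.ψ w ≠ 0 := by
  rw [← norm_pos_iff, norm_radial (ne_zero_of_δ_lt_norm hw), Real.sqrt_pos]
  linarith [ψ_pos (half_sq_mem_Ioc D.δ_pos.le hw hle)]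

theorem norm_radial_ψ_le (hw : D.δ < ‖w‖) (hle : ‖w‖ ≤ D.ε) : ‖radial D.ψ w‖ ≤ D.ε := by
  rw [norm_radial (ne_zero_of_δ_lt_norm hw), Real.sqrt_le_left D.ε_pos.le]
  linarith [(D.ψ_bij.mapsTo (Ioc_subset_Icc_self (half_sq_mem_Ioc D.δ_pos.le hw hle))).2]

theorem lt_norm_radial_ψinv (hw : w ≠ 0) (hle : ‖w‖ ≤ D.ε) : D.δ < ‖radial D.ψinv w‖ := by
  rw [norm_radial hw, Real.lt_sqrt D.δ_pos.le]
  linarith [lt_ψinv (half_sq_norm_mem_Ioc hw hle)]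

theorem norm_radial_ψinv_le (hw : w ≠ 0) (hle : ‖w‖ ≤ D.ε) : ‖radial D.ψinv w‖ ≤ D.ε := by
  rw [norm_radial hw, Real.sqrt_le_left D.ε_pos.le]
  linarith [(ψinv_mem (Ioc_subset_Icc_self (half_sq_norm_mem_Ioc hw hle))).2]

theorem radial_ψinv_radial_ψ (hw : D.δ < ‖w‖) (hle : ‖w‖ ≤ D.ε) :
    radial D.ψinv (radial D.ψ w) = w :=
  have hmem := half_sq_mem_Ioc D.δ_pos.le hw hle
  radial_radial (ne_zero_of_δ_lt_norm hw) (ψ_pos hmem) (D.ψinv_inv.1 (Ioc_subset_Icc_self hmem))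

theorem radial_ψ_radial_ψinv (hw : w ≠ 0) (hle : ‖w‖ ≤ D.ε) :
    radial D.ψ (radial D.ψinv w) = w :=
  have hmem := half_sq_norm_mem_Ioc hw hle
  radial_radial hw ((by positivity : (0 : ℝ) ≤ _).trans_lt (lt_ψinv hmem))
    (D.ψinv_inv.2 (Ioc_subset_Icc_self hmem))

end

/-! ### Blowing up and down -/

variable (D) in
/-- The lift of `Ψ`, which collapses the discs `Vᵢ`. -/
abbrev blowDown : Plane → Plane := D.surgeryLift D.ψ

variable (D) in
/-- The lift of `Ψ⁻¹`. -/
abbrev blowUp : Plane → Plane := D.surgeryLift D.ψinv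

variable (D) in
/-- The points at distance at least `r` from all lifts of the points `Ωᵢ`. -/
def away (r : ℝ) : Set Plane := {x | ∀ c ∈ D.centers, r ≤ ‖x - c‖}

theorem two_mul_ε_lt_norm_add_norm {c c' : Plane} (hc : c ∈ D.centers) (hc' : c' ∈ D.centers)
    (h : c ≠ c') (x : Plane) : 2 * D.ε < ‖x - c‖ + ‖x - c'‖ := by
  rw [norm_sub_rev x c]
  exact (D.two_mul_ε_lt_of_ne hc hc' h).trans_le (norm_sub_le_norm_sub_add_norm_sub c x c')

theorem not_mem_centers_of_near {x c : Plane} (hc : c ∈ D.centers) (hle : ‖x - c‖ ≤ D.ε)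
    (hx : x ≠ c) : x ∉ D.centers :=
  fun hx' => hx (D.eq_of_near hx' hc (by linarith [D.ε_pos]))

theorem mem_islandLift_of_near {x c : Plane} (hc : c ∈ D.centers) (hle : ‖x - c‖ ≤ D.ε)
    (hx : D.δ < ‖x - c‖) : x ∈ D.islandLift := by
  intro c' hc'
  rcases eq_or_ne c c' with rfl | hne
  · exact hx
  · linarith [two_mul_ε_lt_norm_add_norm hc hc' hne x, D.δ_lt]

theorem not_mem_centers_of_mem_away {r : ℝ} (hr : 0 < r) {x : Plane} (hx : x ∈ D.away r) :
    x ∉ D.centers := fun h => hr.not_ge (by simpa using hx x h)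

theorem surgeryLift_surgeryLift {χ χ' : ℝ → ℝ} {w c : Plane} (hc : c ∈ D.centers)
    (hle : ‖w - c‖ ≤ D.ε) (hle' : ‖radial χ (w - c)‖ ≤ D.ε)
    (h : radial χ' (radial χ (w - c)) = w - c) : D.surgeryLift χ' (D.surgeryLift χ w) = w := by
  rw [surgeryLift_of_mem hc hle, surgeryLift_of_mem hc (by rwa [add_sub_cancel_left]),
    add_sub_cancel_left, h, add_sub_cancel]

theorem blowUp_blowDown {w : Plane} (hw : w ∈ D.islandLift) : D.blowUp (D.blowDown w) = w := by
  by_cases h : ∃ c ∈ D.centers, ‖w - c‖ ≤ D.ε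
  · obtain ⟨c, hc, hle⟩ := h
    exact surgeryLift_surgeryLift hc hle (norm_radial_ψ_le (hw c hc) hle)
      (radial_ψinv_radial_ψ (hw c hc) hle)
  · push Not at h
    rw [blowDown, surgeryLift_of_far h, blowUp, surgeryLift_of_far h]

theorem blowDown_not_mem_centers {w : Plane} (hw : w ∈ D.islandLift) :
    D.blowDown w ∉ D.centers := by
  by_cases h : ∃ c ∈ D.centers, ‖w - c‖ ≤ D.ε
  · obtain ⟨c, hc, hle⟩ := h
    rw [blowDown, surgeryLift_of_mem hc hle]
    refine not_mem_centers_of_near hc ?_ ?_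
    · rw [add_sub_cancel_left]
      exact norm_radial_ψ_le (hw c hc) hle
    · exact add_eq_left.not.2 (radial_ψ_ne_zero (hw c hc) hle)
  · push Not at h
    rw [blowDown, surgeryLift_of_far h]
    exact not_mem_centers_of_mem_away D.ε_pos fun c hc => (h c hc).le

theorem blowDown_blowUp {x : Plane} (hx : x ∉ D.centers) : D.blowDown (D.blowUp x) = x := by
  by_cases h : ∃ c ∈ D.centers, ‖x - c‖ ≤ D.ε
  · obtain ⟨c, hc, hle⟩ := h
    have hne : x - c ≠ 0 := sub_ne_zero.2 (ne_of_mem_of_not_mem hc hx).symm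
    exact surgeryLift_surgeryLift hc hle (norm_radial_ψinv_le hne hle)
      (radial_ψ_radial_ψinv hne hle)
  · push Not at h
    rw [blowUp, surgeryLift_of_far h, blowDown, surgeryLift_of_far h]

theorem blowUp_mem_islandLift {x : Plane} (hx : x ∉ D.centers) : D.blowUp x ∈ D.islandLift := by
  by_cases h : ∃ c ∈ D.centers, ‖x - c‖ ≤ D.ε
  · obtain ⟨c, hc, hle⟩ := h
    have hne : x - c ≠ 0 := sub_ne_zero.2 (ne_of_mem_of_not_mem hc hx).symm
    rw [blowUp, surgeryLift_of_mem hc hle]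
    refine mem_islandLift_of_near hc ?_ ?_ <;> rw [add_sub_cancel_left]
    · exact norm_radial_ψinv_le hne hle
    · exact lt_norm_radial_ψinv hne hle
  · push Not at h
    rw [blowUp, surgeryLift_of_far h]
    exact fun c hc => D.δ_lt.trans (h c hc)

theorem exists_lt_norm_radial_ψinv {r : ℝ} (hr : 0 < r) :
    ∃ t, D.δ < t ∧ ∀ w : Plane, r ≤ ‖w‖ → ‖w‖ ≤ D.ε → t ≤ ‖radial D.ψinv w‖ := by
  rcases lt_or_ge D.ε r with hlt | hle
  · exact ⟨D.ε, D.δ_lt, fun w hw hw' => absurd (hw.trans hw') hlt.not_ge⟩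
  have hsub : Icc (r ^ 2 / 2) (D.ε ^ 2 / 2) ⊆ Ioc 0 (D.ε ^ 2 / 2) := fun y hy =>
    ⟨(by positivity : 0 < r ^ 2 / 2).trans_le hy.1, hy.2⟩
  obtain ⟨y₀, hy₀, hmin⟩ := isCompact_Icc.exists_isMinOn (nonempty_Icc.2 (by gcongr))
    (D.ψinv_smooth.continuousOn.mono (hsub.trans Ioc_subset_Icc_self))
  refine ⟨√(2 * D.ψinv y₀), (Real.lt_sqrt D.δ_pos.le).2 (by linarith [lt_ψinv (hsub hy₀)]),
    fun w hw hw' => ?_⟩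
  rw [norm_radial (norm_pos_iff.1 (hr.trans_le hw))]
  have hy₀_le : D.ψinv y₀ ≤ D.ψinv (‖w‖ ^ 2 / 2) := hmin ⟨by gcongr, by gcongr⟩
  exact Real.sqrt_le_sqrt (by linarith)

theorem exists_blowUp_mem_away {r : ℝ} (hr : 0 < r) :
    ∃ t, D.δ < t ∧ ∀ x ∈ D.away r, D.blowUp x ∈ D.away t := by
  obtain ⟨t, hδt, ht⟩ := exists_lt_norm_radial_ψinv (D := D) hr
  refine ⟨min t D.ε, lt_min hδt D.δ_lt, fun x hx c' hc' => ?_⟩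
  by_cases h : ∃ c ∈ D.centers, ‖x - c‖ ≤ D.ε
  · obtain ⟨c, hc, hle⟩ := h
    rw [blowUp, surgeryLift_of_mem hc hle]
    rcases eq_or_ne c c' with rfl | hne
    · rw [add_sub_cancel_left]
      exact (min_le_left _ _).trans (ht _ (hx c hc) hle)
    · have hfar := two_mul_ε_lt_norm_add_norm hc hc' hne (c + radial D.ψinv (x - c))
      rw [add_sub_cancel_left] at hfar
      linarith [min_le_right t D.ε,
        norm_radial_ψinv_le (norm_pos_iff.1 (hr.trans_le (hx c hc))) hle]
  · push Not at h
    rw [blowUp, surgeryLift_of_far h]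
    exact (min_le_right _ _).trans (h c' hc').le

variable (D) in
theorem exists_blowUp_eq_blowOut : ∃ s > 0, D.δ ^ 2 + s ≤ D.ε ^ 2 ∧ ∀ c ∈ D.centers,
    (∀ x, ‖x‖ ^ 2 ≤ s → D.blowUp (c + x) = c + blowOut D.δ x) ∧
    ∀ w, D.δ ≤ ‖w‖ → ‖w‖ ^ 2 ≤ D.δ ^ 2 + s → D.blowDown (c + w) = c + blowIn D.δ w := by
  obtain ⟨b, hb, hψ⟩ := mem_nhdsGE_iff_exists_Icc_subset.1 D.ψ_inner
  set s := min (2 * b - D.δ ^ 2) (D.ε ^ 2 - D.δ ^ 2)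
  have hsb : s ≤ 2 * b - D.δ ^ 2 := min_le_left _ _
  have hsε : s ≤ D.ε ^ 2 - D.δ ^ 2 := min_le_right _ _
  replace hψ : ∀ ρ, D.δ ^ 2 / 2 ≤ ρ → ρ ≤ (D.δ ^ 2 + s) / 2 → D.ψ ρ = ρ - D.δ ^ 2 / 2 :=
    fun ρ hρ hρ' => hψ ⟨hρ, by linarith⟩
  have hψinv : ∀ y, 0 ≤ y → y ≤ s / 2 → D.ψinv y = y + D.δ ^ 2 / 2 := fun y hy hy' => by
    have hinv := D.ψinv_inv.1 (x := y + D.δ ^ 2 / 2) ⟨by linarith, by linarith⟩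
    rwa [hψ _ (by linarith) (by linarith), add_sub_cancel_right] at hinv
  refine ⟨s, lt_min (by linarith [hb]) (sub_pos.2 sq_lt), by linarith, fun c hc =>
    ⟨fun x hx => ?_, fun w hw hws => ?_⟩⟩
  · have hle : ‖x‖ ≤ D.ε := le_of_sq_le_sq (by linarith [sq_nonneg D.δ]) D.ε_pos.le
    rw [blowUp, surgeryLift_of_mem hc (by rwa [add_sub_cancel_left]), add_sub_cancel_left, radial,
      hψinv _ (by positivity) (by linarith), blowOut, ← add_div, mul_div_cancel₀ _ two_ne_zero]
  · have hle : ‖w‖ ≤ D.ε := le_of_sq_le_sq (by linarith) D.ε_pos.le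
    have hsq : D.δ ^ 2 ≤ ‖w‖ ^ 2 := pow_le_pow_left₀ D.δ_pos.le hw 2
    rw [blowDown, surgeryLift_of_mem hc (by rwa [add_sub_cancel_left]), add_sub_cancel_left,
      radial, hψ _ (by linarith) (by linarith), blowIn, ← sub_div, mul_div_cancel₀ _ two_ne_zero]

/-! ### Regularity of blowing up and down -/

/-- The properties, common to `ψ` (with `a = δ`) and `ψ⁻¹` (with `a = 0`), that make
`surgeryLift χ` smooth outside the discs of radius `a`. -/
structure IsProfile (D : Data) (a : ℝ) (χ : ℝ → ℝ) : Prop where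
  nonneg : 0 ≤ a
  smooth : ContDiffOn ℝ ∞ χ (Icc (a ^ 2 / 2) (D.ε ^ 2 / 2))
  pos : ∀ ρ ∈ Ioc (a ^ 2 / 2) (D.ε ^ 2 / 2), 0 < χ ρ
  outer : ∀ᶠ ρ in 𝓝[≤] (D.ε ^ 2 / 2), χ ρ = ρ

variable (D)

theorem isProfile_ψ : D.IsProfile D.δ D.ψ :=
  ⟨D.δ_pos.le, D.ψ_smooth, fun _ => ψ_pos, D.ψ_outer⟩

theorem isProfile_ψinv : D.IsProfile 0 D.ψinv := by
  refine ⟨le_rfl, by simpa using D.ψinv_smooth, fun ρ hρ => ?_, ?_⟩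
  · exact (by positivity : 0 ≤ D.δ ^ 2 / 2).trans_lt (lt_ψinv (by simpa using hρ))
  · have hlt : D.δ ^ 2 / 2 < D.ε ^ 2 / 2 := by linarith [sq_lt (D := D)]
    filter_upwards [D.ψ_outer, Ioc_mem_nhdsLE hlt] with ρ hψ hρ
    simpa only [hψ] using D.ψinv_inv.1 (Ioc_subset_Icc_self hρ)

variable {D}

namespace IsProfile

variable {a : ℝ} {χ : ℝ → ℝ}

theorem exists_outer (h : D.IsProfile a χ) :
    ∃ ε₁ < D.ε, ∀ r ∈ Ioc ε₁ D.ε, χ (r ^ 2 / 2) = r ^ 2 / 2 := by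
  have lim : Tendsto (fun r : ℝ => r ^ 2 / 2) (𝓝[≤] D.ε) (𝓝[≤] (D.ε ^ 2 / 2)) := by
    refine tendsto_nhdsWithin_iff.2 ⟨Continuous.continuousWithinAt (by fun_prop), ?_⟩
    filter_upwards [Ioc_mem_nhdsLE D.ε_pos] with r hr
    exact (by simpa using half_sq_mem_Ioc le_rfl hr.1 hr.2 : _ ∈ Ioc 0 (D.ε ^ 2 / 2)).2
  exact (mem_nhdsLE_iff_exists_Ioc_subset).1 (lim.eventually h.outer)

theorem contDiffAt_radial (h : D.IsProfile a χ) {w : Plane} (hw : a < ‖w‖) (hlt : ‖w‖ < D.ε) :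
    ContDiffAt ℝ ∞ (radial χ) w := by
  have hmem := half_sq_mem_Ioc h.nonneg hw hlt.le
  have hw₀ : w ≠ 0 := norm_pos_iff.1 (h.nonneg.trans_lt hw)
  have hltsq : ‖w‖ ^ 2 / 2 < D.ε ^ 2 / 2 := by gcongr
  have hχ : ContDiffAt ℝ ∞ (fun w : Plane => χ (‖w‖ ^ 2 / 2)) w :=
    (h.smooth.contDiffAt (Icc_mem_nhds hmem.1 hltsq)).comp w
      ((contDiff_norm_sq ℝ).contDiffAt.div_const 2)
  have hpos : 2 * χ (‖w‖ ^ 2 / 2) ≠ 0 := by linarith [h.pos _ hmem]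
  exact (((contDiffAt_const.mul hχ).sqrt hpos).div (contDiffAt_norm ℝ hw₀)
    (norm_ne_zero_iff.2 hw₀)).smul contDiffAt_id

theorem contDiffAt_surgeryLift (h : D.IsProfile a χ) {w : Plane}
    (hw : ∀ c ∈ D.centers, a < ‖w - c‖) : ContDiffAt ℝ ∞ (D.surgeryLift χ) w := by
  by_cases hex : ∃ c ∈ D.centers, ‖w - c‖ < D.ε
  · obtain ⟨c, hc, hlt⟩ := hex
    have hcomp : ContDiffAt ℝ ∞ (radial χ ∘ fun z => z - c) w :=
      (h.contDiffAt_radial (hw c hc) hlt).comp w (contDiffAt_id.sub contDiffAt_const)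
    refine (contDiffAt_const.add hcomp).congr_of_eventuallyEq (f₁ := D.surgeryLift χ) (f := fun z =>
      c + (radial χ ∘ fun z => z - c) z) ?_
    filter_upwards [Metric.isOpen_ball.mem_nhds (mem_ball_iff_norm.2 hlt)] with z hz
    exact surgeryLift_of_mem hc (mem_ball_iff_norm.1 hz).le
  · push Not at hex
    obtain ⟨ε₁, hε₁, houter⟩ := h.exists_outer
    refine contDiffAt_id.congr_of_eventuallyEq ?_
    filter_upwards [Metric.ball_mem_nhds w (sub_pos.2 hε₁)] with z hz
    by_cases hz' : ∃ c ∈ D.centers, ‖z - c‖ ≤ D.ε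
    · obtain ⟨c, hc, hle⟩ := hz'
      have htri := norm_sub_le_norm_sub_add_norm_sub w z c
      rw [mem_ball_iff_norm'] at hz
      rw [surgeryLift_of_mem hc hle, radial_eq_self (houter _ ⟨by linarith [hex c hc], hle⟩),
        add_sub_cancel, id]
    · push Not at hz'
      exact surgeryLift_of_far hz'

end IsProfile

theorem contDiffAt_blowDown {w : Plane} (hw : w ∈ D.islandLift) : ContDiffAt ℝ ∞ D.blowDown w :=
  D.isProfile_ψ.contDiffAt_surgeryLift hw

theorem contDiffAt_blowUp {x : Plane} (hx : x ∉ D.centers) : ContDiffAt ℝ ∞ D.blowUp x :=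
  D.isProfile_ψinv.contDiffAt_surgeryLift fun _ hc =>
    norm_sub_pos_iff.2 (ne_of_mem_of_not_mem hc hx).symm

variable (D) in
theorem exists_deck_near : ∃ R : ℝ, ∀ x, ∃ l ∈ D.deck, ‖x - l‖ ≤ R := by
  refine ⟨‖(D.P : Plane →L[ℝ] Plane)‖ * 2, fun x => ?_⟩
  let z := D.P.symm x
  let integral : Plane := !₂[(⌊z 0⌋ : ℝ), (⌊z 1⌋ : ℝ)]
  refine ⟨D.P integral, ?_, ?_⟩
  · refine D.mem_deck.2 (proj_eq_zero_iff.2 ?_)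
    rw [show ((D.P.symm : Plane →+ Plane) (D.P integral)) = integral from D.P.symm_apply_apply _]
    exact Fin.forall_fin_two.2 ⟨⟨⌊z 0⌋, rfl⟩, ⟨⌊z 1⌋, rfl⟩⟩
  · have hx : x - D.P integral = D.P (z - integral) := by
      rw [map_sub, ContinuousLinearEquiv.apply_symm_apply]
    have hfract : ∀ s : ℝ, |s - ⌊s⌋| ≤ 1 := fun s => by
      rw [← Int.fract, abs_of_nonneg (Int.fract_nonneg s)]
      exact (Int.fract_lt_one s).le
    have h₀ : |(z - integral) 0| ≤ 1 := hfract (z 0)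
    have h₁ : |(z - integral) 1| ≤ 1 := hfract (z 1)
    rw [hx]
    refine ((D.P : Plane →L[ℝ] Plane).le_opNorm _).trans ?_
    gcongr
    linarith [plane_norm_le (z - integral)]

end Data

section LipC1

variable {E F : Type*} [NormedAddCommGroup E] [NormedSpace ℝ E] [NormedAddCommGroup F]
  [NormedSpace ℝ F]

/-- `f` is differentiable on `S`, and `f` and its derivative are `M`-Lipschitz on `S`. -/
structure LipC1On (M : NNReal) (f : E → F) (S : Set E) : Prop where
  differentiableAt : ∀ x ∈ S, DifferentiableAt ℝ f x
  lipschitzOnWith : LipschitzOnWith M f S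
  lipschitzOnWith_fderiv : LipschitzOnWith M (fderiv ℝ f) S

namespace LipC1On

variable {M M' : NNReal} {f : E → F} {S T : Set E}

theorem mono (h : LipC1On M f S) (hM : M ≤ M') (hTS : T ⊆ S) : LipC1On M' f T :=
  ⟨fun x hx => h.differentiableAt x (hTS hx), (h.lipschitzOnWith.mono hTS).weaken hM,
    (h.lipschitzOnWith_fderiv.mono hTS).weaken hM⟩

theorem preimage_sub_right {l : E} {l' : F} (h : LipC1On M f S) (hf : ∀ x, f (x + l) = f x + l') :
    LipC1On M f ((· - l) ⁻¹' S) := by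
  have hf' : f = fun x => f (x - l) + l' := funext fun x => by rw [← hf, sub_add_cancel]
  have hfderiv : fderiv ℝ f = fun x => fderiv ℝ f (x - l) := funext fun x => by
    conv_lhs => rw [hf', fderiv_add_const, fderiv_comp_sub]
  refine ⟨fun x hx => ?_, ?_, ?_⟩
  · rw [hf']
    exact (differentiableAt_comp_sub l).2 (h.differentiableAt _ hx) |>.add_const l'
  · rw [hf']
    exact LipschitzOnWith.of_dist_le_mul fun x hx y hy => by
      simpa using h.lipschitzOnWith.dist_le_mul _ hx _ hy
  · rw [hfderiv]
    exact LipschitzOnWith.of_dist_le_mul fun x hx y hy => by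
      simpa using h.lipschitzOnWith_fderiv.dist_le_mul _ hx _ hy

theorem norm_second_difference_le (h : LipC1On M f S) (hS : Convex ℝ S) {a b u v : E}
    (ha : a ∈ S) (hb : b ∈ S) (hau : a + u ∈ S) (hav : a + v ∈ S) (hbv : b + v ∈ S) :
    ‖(f (a + u) - f a) - (f (b + v) - f b)‖ ≤ M * ‖u - v‖ + M * ‖v‖ * ‖a - b‖ := by
  have hfst : ‖f (a + u) - f (a + v)‖ ≤ M * ‖u - v‖ := by
    simpa using h.lipschitzOnWith.norm_sub_le hau hav
  have hsnd : ‖(f (a + v) - f a) - (f (b + v) - f b)‖ ≤ M * ‖v‖ * ‖a - b‖ := by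
    have hmem : ∀ x ∈ segment ℝ b a, x ∈ S ∧ x + v ∈ S := fun x hx =>
      ⟨hS.segment_subset hb ha hx, hS.segment_subset hbv hav <| by
        simpa only [add_comm _ v] using (mem_segment_translate ℝ v).2 hx⟩
    have hderiv : ∀ x ∈ segment ℝ b a, HasFDerivWithinAt (fun x => f (x + v) - f x)
        (fderiv ℝ f (x + v) - fderiv ℝ f x) (segment ℝ b a) x := fun x hx =>
      (((hasFDerivAt_comp_add_right v).2 (h.differentiableAt _ (hmem x hx).2).hasFDerivAt).sub
        (h.differentiableAt x (hmem x hx).1).hasFDerivAt).hasFDerivWithinAt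
    refine (convex_segment b a).norm_image_sub_le_of_norm_hasFDerivWithin_le hderiv
      (fun x hx => ?_) (left_mem_segment ℝ b a) (right_mem_segment ℝ b a)
    simpa using h.lipschitzOnWith_fderiv.norm_sub_le (hmem x hx).2 (hmem x hx).1
  rw [← sub_add_sub_cancel _ (f (a + v) - f a)]
  refine (norm_add_le _ _).trans (add_le_add ?_ hsnd)
  rwa [sub_sub_sub_cancel_right]

end LipC1On

theorem exists_lipC1On_of_contDiffAt {f : E → F} {x : E} (hf : ContDiffAt ℝ 2 f x) :
    ∃ M, ∃ t ∈ 𝓝 x, LipC1On M f t := by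
  obtain ⟨K, s, hs, hK⟩ := (hf.of_le one_le_two).exists_lipschitzOnWith
  obtain ⟨K', s', hs', hK'⟩ := (hf.fderiv_right (m := 1) (by norm_num)).exists_lipschitzOnWith
  have hdiff : ∀ᶠ y in 𝓝 x, DifferentiableAt ℝ f y :=
    (hf.eventually (by simp)).mono fun y hy => hy.differentiableAt (by simp)
  exact ⟨max K K', _, inter_mem (inter_mem hs hs') hdiff, fun y hy => hy.2,
    (hK.mono fun y hy => hy.1.1).weaken (le_max_left _ _),
    (hK'.mono fun y hy => hy.1.2).weaken (le_max_right _ _)⟩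

end LipC1

namespace Data

variable {D : Data}

theorem isClosed_away (r : ℝ) : IsClosed (D.away r) := by
  simp only [away, ofPred_forall]
  exact isClosed_biInter fun c _ => isClosed_le continuous_const (by fun_prop)

theorem sub_mem_away {r : ℝ} {x l : Plane} (hx : x ∈ D.away r) (hl : l ∈ D.centers) :
    x - l ∈ D.away r := fun c hc => by
  simpa only [sub_sub, add_comm] using hx _ (D.centers.add_mem hl hc)

-- Both the map and the set are invariant under deck transformations, so a compact set suffices.
theorem exists_lipC1On {f : Plane → Plane} {r : ℝ} (hf : ∀ z ∈ D.away r, ContDiffAt ℝ 2 f z)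
    (hf_add : ∀ l ∈ D.deck, ∀ x, f (x + l) = f x + l) :
    ∃ M : NNReal, ∃ s > 0, ∀ z ∈ D.away r, LipC1On M f (Metric.ball z s) := by
  obtain ⟨R, hR⟩ := D.exists_deck_near
  have hcompact : IsCompact (D.away r ∩ Metric.closedBall 0 R) :=
    (isCompact_closedBall 0 R).inter_left (isClosed_away r)
  obtain ⟨M, s, hs, hM⟩ : ∃ M : NNReal, ∃ s > 0, ∀ z ∈ D.away r ∩ Metric.closedBall 0 R,
      LipC1On M f (Metric.ball z s) := by
    refine hcompact.induction_on (p := fun K => ∃ M : NNReal, ∃ s > 0, ∀ z ∈ K,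
      LipC1On M f (Metric.ball z s)) ⟨0, 1, one_pos, fun z hz => hz.elim⟩ ?_ ?_ ?_
    · rintro K K' hK ⟨M, s, hs, hM⟩
      exact ⟨M, s, hs, fun z hz => hM z (hK hz)⟩
    · rintro K K' ⟨M, s, hs, hM⟩ ⟨M', s', hs', hM'⟩
      refine ⟨max M M', min s s', lt_min hs hs', ?_⟩
      rintro z (hz | hz)
      · exact (hM z hz).mono (le_max_left _ _) (Metric.ball_subset_ball (min_le_left _ _))
      · exact (hM' z hz).mono (le_max_right _ _) (Metric.ball_subset_ball (min_le_right _ _))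
    · rintro z ⟨hz, -⟩
      obtain ⟨M, t, ht, hM⟩ := exists_lipC1On_of_contDiffAt (hf z hz)
      obtain ⟨s, hs, hst⟩ := Metric.mem_nhds_iff.1 ht
      refine ⟨Metric.ball z (s / 2), mem_nhdsWithin_of_mem_nhds (Metric.ball_mem_nhds z
        (half_pos hs)), M, s / 2, half_pos hs, fun z' hz' => hM.mono le_rfl ?_⟩
      exact (Metric.ball_subset_ball' (by linarith [Metric.mem_ball.1 hz'])).trans hst
  refine ⟨M, s, hs, fun z hz => ?_⟩
  obtain ⟨l, hl, hle⟩ := hR z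
  have htranslate := (hM (z - l) ⟨sub_mem_away hz (D.deck_le_centers hl),
    mem_closedBall_zero_iff.2 hle⟩).preimage_sub_right (hf_add l hl)
  rwa [show (· - l) ⁻¹' Metric.ball (z - l) s = Metric.ball z s by ext; simp] at htranslate

theorem exists_lipC1On_blowUp {r : ℝ} (hr : 0 < r) :
    ∃ M : NNReal, ∃ s > 0, ∀ z ∈ D.away r, LipC1On M D.blowUp (Metric.ball z s) :=
  exists_lipC1On (fun _ hz => (contDiffAt_blowUp (not_mem_centers_of_mem_away hr hz)).of_le
    (by norm_cast)) fun _ hl _ => surgeryLift_add (D.deck_le_centers hl)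

theorem exists_lipC1On_blowDown {r : ℝ} (hr : D.δ < r) :
    ∃ M : NNReal, ∃ s > 0, ∀ z ∈ D.away r, LipC1On M D.blowDown (Metric.ball z s) :=
  exists_lipC1On (fun _ hz => (contDiffAt_blowDown fun c hc => hr.trans_le (hz c hc)).of_le
    (by norm_cast)) fun _ hl _ => surgeryLift_add (D.deck_le_centers hl)

end Data

theorem norm_sub_le_of_norm_sub_le_of_near {E F : Type*} [NormedAddCommGroup E] [NormedSpace ℝ E]
    [SeminormedAddCommGroup F] {f : E → F} {r K : ℝ} (hr : 0 < r)
    (hf : ∀ x y, ‖x - y‖ ≤ r → ‖f x - f y‖ ≤ K * ‖x - y‖) (x y : E) :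
    ‖f x - f y‖ ≤ K * ‖x - y‖ := by
  obtain ⟨n, hn⟩ := exists_nat_ge (‖x - y‖ / r)
  have hn' : (0 : ℝ) < n + 1 := n.cast_add_one_pos
  let p (i : ℕ) : E := x + (i / (n + 1) : ℝ) • (y - x)
  have hp (i : ℕ) : ‖p i - p (i + 1)‖ = ‖x - y‖ / (n + 1) := by
    have hstep : p i - p (i + 1) = ((n : ℝ) + 1)⁻¹ • (x - y) := by
      simp only [p]
      push_cast
      module
    rw [hstep, norm_smul, Real.norm_of_nonneg (by positivity), inv_mul_eq_div]
  have hle : ‖x - y‖ / (n + 1) ≤ r := by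
    rw [div_le_iff₀ hn']
    rw [div_le_iff₀ hr] at hn
    nlinarith
  have hsum := dist_le_range_sum_of_dist_le (f := f ∘ p) (n + 1)
    (d := fun _ => K * (‖x - y‖ / (n + 1))) fun {i} _ => by
      rw [← hp i, dist_eq_norm]
      exact hf _ _ ((hp i).trans_le hle)
  have hfirst : p 0 = x := by simp [p]
  have hlast : p (n + 1) = y := by
    simp only [p]
    rw [Nat.cast_add_one, div_self hn'.ne', one_smul, add_sub_cancel]
  rw [Function.comp_apply, Function.comp_apply, hfirst, hlast, dist_eq_norm, Finset.sum_const,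
    Finset.card_range, nsmul_eq_mul, Nat.cast_add_one] at hsum
  exact hsum.trans_eq (by field_simp)

theorem SmallC2.translate {η : ℝ} {u : Plane → Plane} (h : SmallC2 η u) (c : Plane) :
    SmallC2 η (fun x => u (c + x)) where
  diff x := (h.diff (c + x)).comp x (differentiableAt_id.const_add c)
  bound x := h.bound _
  bound_fderiv x := by
    rw [fderiv_comp_add_left]
    exact h.bound_fderiv _
  lip_fderiv x y := by
    rw [fderiv_comp_add_left, fderiv_comp_add_left]
    simpa using h.lip_fderiv (c + x) (c + y)

theorem LipC1On.norm_second_difference_le_of_ball {E F : Type*} [NormedAddCommGroup E]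
    [NormedSpace ℝ E] [NormedAddCommGroup F] [NormedSpace ℝ F] {M : NNReal} {f : E → F}
    {a b u v : E} {s : ℝ} (hs : 0 < s) (h : LipC1On M f (Metric.ball a s)) (hab : ‖a - b‖ ≤ s / 4)
    (hu : ‖u‖ ≤ s / 4) (hv : ‖v‖ ≤ s / 4) :
    ‖(f (a + u) - f a) - (f (b + v) - f b)‖ ≤ M * ‖u - v‖ + M * ‖v‖ * ‖a - b‖ := by
  refine h.norm_second_difference_le (convex_ball a s) (Metric.mem_ball_self hs) ?_ ?_ ?_ ?_
  · rw [mem_ball_iff_norm']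
    linarith
  · rw [mem_ball_iff_norm, add_sub_cancel_left]
    linarith
  · rw [mem_ball_iff_norm, add_sub_cancel_left]
    linarith
  · rw [mem_ball_iff_norm', ← sub_sub]
    linarith [norm_sub_le (a - b) v]

namespace Data

variable (D : Data) (u : Plane → Plane)

/-- The lift of `F̂` perturbed by `u` maps all lifts of the circles `∂Vᵢ` to such lifts. -/
def KeepsCircles : Prop := ∀ c ∈ D.centers, PreservesCircle D.δ fun x => u (c + x)

/-- The perturbation by `u` of the lift of `F̂` on the island, evaluated at `blowUp x`. -/
def perturbed (x : Plane) : Plane := D.blowUp (saddle x) + u (D.blowUp x)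

open Classical in
/-- The conjugate by `Ψ` of the lift of `F̂` perturbed by `u`, extended to the lifts of the
points `Ωᵢ`. -/
def blownDownMap (x : Plane) : Plane :=
  if x ∈ D.centers then saddle x else D.blowDown (D.perturbed u x)

variable {D u}

theorem blownDownMap_of_mem {x : Plane} (hx : x ∈ D.centers) : D.blownDownMap u x = saddle x :=
  if_pos hx

theorem blownDownMap_of_not_mem {x : Plane} (hx : x ∉ D.centers) :
    D.blownDownMap u x = D.blowDown (D.perturbed u x) := if_neg hx

theorem blowUp_add {l : Plane} (hl : l ∈ D.centers) (x : Plane) :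
    D.blowUp (x + l) = D.blowUp x + l := surgeryLift_add hl

theorem blowDown_add {l : Plane} (hl : l ∈ D.centers) (w : Plane) :
    D.blowDown (w + l) = D.blowDown w + l := surgeryLift_add hl

theorem blownDownMap_add (hu : ∀ w, ∀ l ∈ D.deck, u (w + l) = u w) (x : Plane) {l : Plane}
    (hl : l ∈ D.deck) : D.blownDownMap u (x + l) = D.blownDownMap u x + saddle l := by
  have hlc := D.deck_le_centers hl
  have hsaddle := D.saddle_mem_centers_iff.2 hlc
  by_cases hx : x ∈ D.centers
  · rw [blownDownMap_of_mem hx, blownDownMap_of_mem (D.centers.add_mem hx hlc), map_add]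
  · have hx' : x + l ∉ D.centers := mt (D.centers.add_mem_cancel_right hlc).1 hx
    rw [blownDownMap_of_not_mem hx, blownDownMap_of_not_mem hx', perturbed, map_add,
      blowUp_add hsaddle, blowUp_add hlc, hu _ _ hl, add_right_comm, blowDown_add hsaddle,
      perturbed]

theorem saddle_mem_away {r : ℝ} {x : Plane} (hx : x ∈ D.away r) :
    saddle x ∈ D.away (lam⁻¹ * r) := fun c hc => by
  have hle := le_norm_saddle (x - saddle.symm c)
  rw [map_sub, ContinuousLinearEquiv.apply_symm_apply] at hle
  exact (mul_le_mul_of_nonneg_left (hx _ (D.saddle_symm_mem_centers_iff.2 hc))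
    lam_inv_pos.le).trans hle

theorem away_anti {r r' : ℝ} (h : r ≤ r') : D.away r' ⊆ D.away r :=
  fun _ hx c hc => h.trans (hx c hc)

theorem away_subset_islandLift {r : ℝ} (hr : D.δ < r) : D.away r ⊆ D.islandLift :=
  fun _ hx c hc => hr.trans_le (hx c hc)

variable (D) in
theorem exists_perturbed_eq : ∃ τ > 0, τ < D.ε ∧ D.δ ^ 2 + (lam ^ 2 + 1) * τ ^ 2 ≤ D.ε ^ 2 ∧
    ∀ c ∈ D.centers,
      (∀ u v, ‖v‖ ≤ τ →
        D.perturbed u (c + v) = saddle c + (blowOut D.δ (saddle v) + u (c + blowOut D.δ v))) ∧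
      ∀ w, D.δ ≤ ‖w‖ → ‖w‖ ^ 2 ≤ D.δ ^ 2 + (lam ^ 2 + 1) * τ ^ 2 →
        D.blowDown (c + w) = c + blowIn D.δ w := by
  obtain ⟨s, hs, hsε, H⟩ := D.exists_blowUp_eq_blowOut
  have hτ : 0 < √(s / (lam ^ 2 + 1)) := Real.sqrt_pos.2 (by positivity)
  have hτs : (lam ^ 2 + 1) * √(s / (lam ^ 2 + 1)) ^ 2 = s := by
    rw [Real.sq_sqrt (by positivity)]
    field_simp
  set τ := √(s / (lam ^ 2 + 1))
  have hτε : τ < D.ε := lt_of_pow_lt_pow_left₀ 2 D.ε_pos.le (by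
    nlinarith [pow_pos D.δ_pos 2, mul_nonneg (sq_nonneg lam) (sq_nonneg τ)])
  refine ⟨τ, hτ, hτε, by rwa [hτs], fun c hc =>
    ⟨fun u v hv => ?_, by simpa only [hτs] using (H c hc).2⟩⟩
  have hvτ : ‖v‖ ^ 2 ≤ τ ^ 2 := by gcongr
  have hsaddle : ‖saddle v‖ ^ 2 ≤ (lam * ‖v‖) ^ 2 := by
    gcongr
    exact norm_saddle_le v
  rw [perturbed, map_add, (H _ (D.saddle_mem_centers_iff.2 hc)).1 _ (by nlinarith),
    (H c hc).1 v (by nlinarith [mul_nonneg (sq_nonneg lam) (sq_nonneg τ)]), add_assoc]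

variable (D) in
theorem exists_estimate_near : ∃ τ C η₁ : ℝ, 0 < τ ∧ 0 < C ∧ 0 < η₁ ∧ ∀ η u, η ≤ η₁ →
    SmallC2 η u → D.KeepsCircles u → ∀ c ∈ D.centers,
      (∀ x, x ≠ c → ‖x - c‖ ≤ τ → D.perturbed u x ∈ D.islandLift) ∧
      ∀ x y, ‖x - c‖ ≤ τ → ‖y - c‖ ≤ τ →
        ‖(D.blownDownMap u x - saddle x) - (D.blownDownMap u y - saddle y)‖ ≤
          C * η * ‖x - y‖ := by
  obtain ⟨τ, hτ, hτε, hτ_sq, Hτ⟩ := D.exists_perturbed_eq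
  obtain ⟨C, η₁, hC, hη₁, H⟩ := exists_blowDown_estimate D.δ_pos τ
  refine ⟨τ, C, η₁, hτ, hC, hη₁, fun η u hη hu hcirc c hc => ?_⟩
  obtain ⟨annulus, estimate⟩ := H η _ hη (hu.translate c) (hcirc c hc)
  have hsc := D.saddle_mem_centers_iff.2 hc
  constructor
  · intro x hx hxτ
    obtain ⟨hgt, hle⟩ := annulus (x - c) (sub_ne_zero.2 hx) hxτ
    rw [← add_sub_cancel c x, (Hτ c hc).1 u _ hxτ]
    refine mem_islandLift_of_near hsc ?_ ?_
    · rw [add_sub_cancel_left]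
      exact le_of_sq_le_sq (hle.trans hτ_sq) D.ε_pos.le
    · rwa [add_sub_cancel_left]
  · intro x y hx hy
    have hlip := estimate (fun v => D.blownDownMap u (c + v) - saddle (c + v))
      (by simp [blownDownMap_of_mem hc]) (fun v hv hvτ => ?_) (x - c) (y - c) hx hy
    · simpa using hlip
    · obtain ⟨hgt, hle⟩ := annulus v hv hvτ
      have hmem : c + v ∉ D.centers :=
        not_mem_centers_of_near hc (by rw [add_sub_cancel_left]; linarith) (by simpa using hv)
      rw [blownDownMap_of_not_mem hmem, (Hτ c hc).1 u v hvτ, (Hτ _ hsc).2 _ hgt.le hle, map_add,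
        add_sub_add_left_eq_sub]

theorem exists_blowUp_saddle_add_mem_away {r : ℝ} (hr : 0 < r) :
    ∃ t η₁ : ℝ, D.δ < t ∧ 0 < η₁ ∧
      ∀ x ∈ D.away r, ∀ v, ‖v‖ ≤ η₁ → D.blowUp (saddle x) + v ∈ D.away t := by
  obtain ⟨t, ht, H⟩ := exists_blowUp_mem_away (D := D) (mul_pos lam_inv_pos hr)
  refine ⟨(D.δ + t) / 2, (t - D.δ) / 2, by linarith, by linarith, fun x hx v hv c hc => ?_⟩
  have hle := H _ (saddle_mem_away hx) c hc
  have htri := norm_sub_le_norm_add (D.blowUp (saddle x) - c) v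
  rw [sub_add_eq_add_sub] at htri
  linarith

theorem exists_lipschitz_blowUp {r : ℝ} (hr : 0 < r) :
    ∃ M s : ℝ, 0 ≤ M ∧ 0 < s ∧ ∀ x ∈ D.away r, ∀ y, ‖x - y‖ ≤ s →
      ‖D.blowUp x - D.blowUp y‖ ≤ M * ‖x - y‖ := by
  obtain ⟨M, s, hs, H⟩ := exists_lipC1On_blowUp (D := D) hr
  refine ⟨M, s / 2, M.2, half_pos hs, fun x hx y hxy =>
    (H x hx).lipschitzOnWith.norm_sub_le (Metric.mem_ball_self hs) ?_⟩
  rw [Metric.mem_ball, dist_comm, dist_eq_norm]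
  linarith

theorem norm_blownDownMap_sub_le {x y : Plane} {M s η : ℝ} {N : NNReal} (hs : 0 < s)
    (hdown : LipC1On N D.blowDown (Metric.ball (D.blowUp (saddle x)) s)) (hu : SmallC2 η u)
    (hη : η ≤ s / 4) (hx : x ∉ D.centers) (hy : y ∉ D.centers)
    (hup : ‖D.blowUp x - D.blowUp y‖ ≤ M * ‖x - y‖)
    (hupSaddle : ‖D.blowUp (saddle x) - D.blowUp (saddle y)‖ ≤ M * (lam * ‖x - y‖))
    (hclose : M * (lam * ‖x - y‖) ≤ s / 4) :
    ‖(D.blownDownMap u x - saddle x) - (D.blownDownMap u y - saddle y)‖ ≤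
      (N * M + N * M * lam) * η * ‖x - y‖ := by
  have key := hdown.norm_second_difference_le_of_ball hs (hupSaddle.trans hclose)
    ((hu.bound (D.blowUp x)).trans hη) ((hu.bound (D.blowUp y)).trans hη)
  rw [blowDown_blowUp (mt D.saddle_mem_centers_iff.1 hx),
    blowDown_blowUp (mt D.saddle_mem_centers_iff.1 hy)] at key
  rw [blownDownMap_of_not_mem hx, blownDownMap_of_not_mem hy]
  have hη₀ := hu.nonneg
  calc _ ≤ N * ‖u (D.blowUp x) - u (D.blowUp y)‖ +
          N * ‖u (D.blowUp y)‖ * ‖D.blowUp (saddle x) - D.blowUp (saddle y)‖ := key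
    _ ≤ N * (η * (M * ‖x - y‖)) + N * η * (M * (lam * ‖x - y‖)) := by
        gcongr
        · exact (hu.lip _ _).trans (by gcongr)
        · exact hu.bound _
    _ = _ := by ring

variable (D) in
theorem exists_estimate_away {r : ℝ} (hr : 0 < r) : ∃ r₀ C η₁ : ℝ, 0 < r₀ ∧ 0 < C ∧ 0 < η₁ ∧
    ∀ η u, η ≤ η₁ → SmallC2 η u →
      (∀ x ∈ D.away r, D.perturbed u x ∈ D.islandLift) ∧
      ∀ x ∈ D.away r, ∀ y ∈ D.away r, ‖x - y‖ ≤ r₀ →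
        ‖(D.blownDownMap u x - saddle x) - (D.blownDownMap u y - saddle y)‖ ≤
          C * η * ‖x - y‖ := by
  have hr' : 0 < lam⁻¹ * r := mul_pos lam_inv_pos hr
  have hr'r : lam⁻¹ * r ≤ r := mul_le_of_le_one_left hr.le (lam_inv_le.trans (by norm_num))
  obtain ⟨t, η₁, ht, hη₁, mem_away⟩ := exists_blowUp_saddle_add_mem_away (D := D) hr
  obtain ⟨M, s, hM, hs, lipUp⟩ := exists_lipschitz_blowUp (D := D) hr'
  obtain ⟨N, s', hs', lipDown⟩ := exists_lipC1On_blowDown (D := D) ht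
  have hlam := lam_pos
  have hlam_ge := lam_ge
  refine ⟨min s (s' / (4 * (M + 1))) / lam, N * M + N * M * lam + 1, min η₁ (s' / 4),
    by positivity, by positivity, by positivity, fun η u hη hu =>
    ⟨fun x hx => away_subset_islandLift ht (mem_away x hx _ ((hu.bound _).trans
      (hη.trans (min_le_left _ _)))), fun x hx y hy hxy => ?_⟩⟩
  have hη₀ := hu.nonneg
  rw [le_div_iff₀ hlam, mul_comm] at hxy
  have hsaddle : ‖saddle x - saddle y‖ ≤ lam * ‖x - y‖ := by
    rw [← map_sub]
    exact norm_saddle_le _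
  have hxys : lam * ‖x - y‖ ≤ s := hxy.trans (min_le_left _ _)
  have hxys' : M * (lam * ‖x - y‖) ≤ s' / 4 := by
    have := hxy.trans (min_le_right _ _)
    rw [le_div_iff₀ (by positivity)] at this
    nlinarith [mul_nonneg hlam.le (norm_nonneg (x - y))]
  have hup : ‖D.blowUp x - D.blowUp y‖ ≤ M * ‖x - y‖ :=
    lipUp x (away_anti hr'r hx) y (by nlinarith [norm_nonneg (x - y)])
  have hupSaddle : ‖D.blowUp (saddle x) - D.blowUp (saddle y)‖ ≤ M * (lam * ‖x - y‖) :=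
    (lipUp _ (saddle_mem_away hx) _ (hsaddle.trans hxys)).trans (by gcongr)
  refine (norm_blownDownMap_sub_le hs' (lipDown _ ?_) hu (hη.trans (min_le_right _ _))
    (not_mem_centers_of_mem_away hr hx) (not_mem_centers_of_mem_away hr hy) hup hupSaddle
    hxys').trans ?_
  · simpa using mem_away x hx 0 (by simpa using hη₁.le)
  · gcongr ?_ * _ * _
    exact (lt_add_one _).le

variable (D) in
theorem exists_nearSaddle : ∃ η₀ > 0, ∀ u, SmallC2 η₀ u → D.KeepsCircles u →
    (∀ x ∉ D.centers, D.perturbed u x ∈ D.islandLift) ∧ NearSaddle (D.blownDownMap u) := by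
  obtain ⟨τ, C, η₁, hτ, hC, hη₁, Hnear⟩ := D.exists_estimate_near
  obtain ⟨r₀, C', η₂, hr₀, hC', hη₂, Haway⟩ := D.exists_estimate_away (half_pos hτ)
  set η₀ := min (min η₁ η₂) (1 / (50 * (C + C')))
  have hη₀ : 0 < η₀ := by positivity
  refine ⟨η₀, hη₀, fun u hu hcirc => ?_⟩
  have near := Hnear η₀ u ((min_le_left _ _).trans (min_le_left _ _)) hu hcirc
  obtain ⟨away_mem, away_lip⟩ := Haway η₀ u ((min_le_left _ _).trans (min_le_right _ _)) hu
  have hsmall : η₀ * (50 * (C + C')) ≤ 1 := (le_div_iff₀ (by positivity)).1 (min_le_right _ _)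
  refine ⟨fun x hx => ?_, nearSaddle_iff.2 (norm_sub_le_of_norm_sub_le_of_near
    (f := fun x => D.blownDownMap u x - saddle x) (lt_min hr₀ (half_pos hτ)) fun x y hxy => ?_)⟩
  · by_cases h : ∃ c ∈ D.centers, ‖x - c‖ ≤ τ
    · obtain ⟨c, hc, hle⟩ := h
      exact (near c hc).1 x (ne_of_mem_of_not_mem hc hx).symm hle
    · push Not at h
      exact away_mem x fun c hc => by linarith [h c hc]
  · by_cases h : ∃ c ∈ D.centers, ‖x - c‖ < τ / 2 ∨ ‖y - c‖ < τ / 2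
    · obtain ⟨c, hc, h⟩ := h
      have hxyτ := hxy.trans (min_le_right _ _)
      have htri := norm_sub_le_norm_sub_add_norm_sub x y c
      have htri' := norm_sub_le_norm_sub_add_norm_sub y x c
      rw [norm_sub_rev y x] at htri'
      refine ((near c hc).2 x y (by rcases h with h | h <;> linarith)
        (by rcases h with h | h <;> linarith)).trans ?_
      gcongr
      nlinarith
    · push Not at h
      refine (away_lip x (fun c hc => (h c hc).1) y (fun c hc => (h c hc).2)
        (hxy.trans (min_le_left _ _))).trans ?_
      gcongr
      nlinarith

-- The displacement vanishes at the centres, and is Lipschitz.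
theorem exists_norm_blownDownMap_sub_le (h : NearSaddle (D.blownDownMap u)) :
    ∃ K, ∀ x, ‖D.blownDownMap u x - saddle x‖ ≤ K := by
  obtain ⟨R, hR⟩ := D.exists_deck_near
  refine ⟨1 / 50 * R, fun x => ?_⟩
  obtain ⟨l, hl, hle⟩ := hR x
  have hdist := nearSaddle_iff.1 h x l
  rw [blownDownMap_of_mem (D.deck_le_centers hl), sub_self, sub_zero] at hdist
  linarith

end Data

namespace NearSaddle

variable {G : Plane → Plane} {x y : Plane}

theorem norm_sub_le (hG : NearSaddle G) (x y : Plane) : ‖G x - G y‖ ≤ 19 * ‖x - y‖ := by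
  have hsaddle : ‖saddle (x - y)‖ ≤ 18 * ‖x - y‖ :=
    (norm_saddle_le _).trans (mul_le_mul_of_nonneg_right lam_le (norm_nonneg _))
  calc ‖G x - G y‖ = ‖(G x - saddle x - (G y - saddle y)) + saddle (x - y)‖ := by
        rw [map_sub]; congr 1; abel
    _ ≤ 1 / 50 * ‖x - y‖ + 18 * ‖x - y‖ := norm_add_le_of_le (nearSaddle_iff.1 hG x y) hsaddle
    _ ≤ 19 * ‖x - y‖ := by linarith [norm_nonneg (x - y)]

theorem iterate_unstable (hG : NearSaddle G) (h : |(x - y) 1| ≤ |(x - y) 0|) (n : ℕ) :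
    16 ^ n * |(x - y) 0| ≤ |(G^[n] x - G^[n] y) 0| ∧
      |(G^[n] x - G^[n] y) 1| ≤ |(G^[n] x - G^[n] y) 0| := by
  induction n with
  | zero => simpa using h
  | succ n ih =>
    rw [Function.iterate_succ_apply', Function.iterate_succ_apply', pow_succ]
    have hstep := hG.unstable _ _ ih.2
    have hnonneg := abs_nonneg ((G (G^[n] x) - G (G^[n] y)) 1)
    exact ⟨by linarith [ih.1, hstep.1], by linarith [hstep.2]⟩

theorem iterate_cone (hG : NearSaddle G) (h : 2 * |(x - y) 1| ≤ |(x - y) 0|) (n : ℕ) :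
    2 * |(G^[n] x - G^[n] y) 1| ≤ |(G^[n] x - G^[n] y) 0| := by
  cases n with
  | zero => exact h
  | succ n =>
    rw [Function.iterate_succ_apply', Function.iterate_succ_apply']
    have hcone : |(x - y) 1| ≤ |(x - y) 0| := by linarith [abs_nonneg ((x - y) 1)]
    exact (hG.unstable _ _ (hG.iterate_unstable hcone n).2).2

end NearSaddle

/-! ### Blowing up unstable directions -/

theorem abs_inner_le_of_cones {d x : Plane} (hd : 2 * |d 1| ≤ |d 0|) (hx : |x 0| ≤ |x 1|) :
    |inner ℝ d x| ≤ 19 / 20 * (‖d‖ * ‖x‖) := by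
  have hinner : inner ℝ d x = d 0 * x 0 + d 1 * x 1 := by
    rw [PiLp.inner_apply, Fin.sum_univ_two]
    simp [mul_comm]
  have hle : |inner ℝ d x| ≤ 3 / 2 * (|d 0| * |x 1|) := by
    have hfst : |d 0| * |x 0| ≤ |d 0| * |x 1| := by gcongr
    have hsnd : 2 * |d 1| * |x 1| ≤ |d 0| * |x 1| := by gcongr
    rw [hinner]
    refine (abs_add_le _ _).trans ?_
    rw [abs_mul, abs_mul]
    linarith
  have hcross : 1 / 2 * (|d 0| * |x 1|) ≤ |d 0 * x 1 - d 1 * x 0| := by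
    have hprod : 2 * |d 1| * |x 0| ≤ |d 0| * |x 1| := by gcongr
    have := abs_sub_abs_le_abs_sub (d 0 * x 1) (d 1 * x 0)
    rw [abs_mul, abs_mul] at this
    linarith
  have hsq : inner ℝ d x ^ 2 ≤ 9 * (d 0 * x 1 - d 1 * x 0) ^ 2 := by
    have := sq_le_sq.2 (show |inner ℝ d x| ≤ |3 * (d 0 * x 1 - d 1 * x 0)| by
      rw [abs_mul, abs_of_pos (by norm_num : (0 : ℝ) < 3)]
      linarith)
    linarith
  have hlagrange : ‖d‖ ^ 2 * ‖x‖ ^ 2 = inner ℝ d x ^ 2 + (d 0 * x 1 - d 1 * x 0) ^ 2 := by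
    rw [hinner, plane_norm_sq, plane_norm_sq]
    ring
  refine le_of_sq_le_sq ?_ (by positivity)
  rw [sq_abs, mul_pow, mul_pow, hlagrange]
  nlinarith [sq_nonneg (inner ℝ d x : ℝ)]

theorem abs_norm_sub_norm_le_of_cones {x x' : Plane} (hx0 : x ≠ 0) (hx : |x 0| ≤ |x 1|)
    (hd : 2 * |(x' - x) 1| ≤ |(x' - x) 0|) (hn : ‖x' - x‖ ≤ 1 / 100 * ‖x‖) :
    |‖x'‖ - ‖x‖| ≤ 24 / 25 * ‖x' - x‖ := by
  have hpos : 0 < ‖x‖ := norm_pos_iff.2 hx0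
  have hsum : 199 / 100 * ‖x‖ ≤ ‖x'‖ + ‖x‖ := by
    linarith [norm_sub_le_norm_add x' (x' - x), norm_sub_norm_le x x', norm_sub_rev x x']
  have hfactor : (‖x'‖ - ‖x‖) * (‖x'‖ + ‖x‖) = 2 * inner ℝ (x' - x) x + ‖x' - x‖ ^ 2 := by
    rw [norm_sub_sq_real, inner_sub_left, real_inner_self_eq_norm_sq]
    ring
  have hsmall : ‖x' - x‖ ^ 2 ≤ 1 / 100 * (‖x' - x‖ * ‖x‖) := by
    nlinarith [norm_nonneg (x' - x)]
  have hprod : |‖x'‖ - ‖x‖| * (‖x'‖ + ‖x‖) ≤ 191 / 100 * (‖x' - x‖ * ‖x‖) := by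
    rw [← abs_of_pos (show 0 < ‖x'‖ + ‖x‖ by linarith), ← abs_mul, hfactor, abs_le]
    have hinner := abs_le.1 (abs_inner_le_of_cones hd hx)
    constructor <;> linarith [sq_nonneg ‖x' - x‖]
  have hcancel : |‖x'‖ - ‖x‖| * (199 / 100) ≤ 191 / 100 * ‖x' - x‖ := by
    refine le_of_mul_le_mul_right ?_ hpos
    linarith [mul_le_mul_of_nonneg_left hsum (abs_nonneg (‖x'‖ - ‖x‖))]
  linarith [norm_nonneg (x' - x)]

theorem one_le_sqrt_div_norm {δ : ℝ} {x : Plane} (hx : x ≠ 0) :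
    1 ≤ √(‖x‖ ^ 2 + δ ^ 2) / ‖x‖ := by
  have hpos : 0 < ‖x‖ := norm_pos_iff.2 hx
  rw [one_le_div hpos]
  exact Real.le_sqrt_of_sq_le (by linarith [sq_nonneg δ])

-- By the law of cosines `‖x' - x‖² = (‖x'‖ - ‖x‖)² + 2 (‖x'‖ ‖x‖ - ⟪x', x⟫)`; blowing out does not
-- decrease the second term, and the first one is not most of the sum when `x' - x` is transversal
-- to `x`.
theorem le_norm_blowOut_sub {δ : ℝ} {x x' : Plane} (hx0 : x ≠ 0) (hx : |x 0| ≤ |x 1|)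
    (hd : 2 * |(x' - x) 1| ≤ |(x' - x) 0|) (hn : ‖x' - x‖ ≤ 1 / 100 * ‖x‖) :
    1 / 4 * ‖x' - x‖ ≤ ‖blowOut δ x' - blowOut δ x‖ := by
  have hpos : 0 < ‖x‖ := norm_pos_iff.2 hx0
  have hx'0 : x' ≠ 0 := by
    rintro rfl
    rw [zero_sub, norm_neg] at hn
    linarith
  have hk : 1 ≤ √(‖x‖ ^ 2 + δ ^ 2) / ‖x‖ := one_le_sqrt_div_norm hx0
  have hk' : 1 ≤ √(‖x'‖ ^ 2 + δ ^ 2) / ‖x'‖ := one_le_sqrt_div_norm hx'0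
  set k := √(‖x‖ ^ 2 + δ ^ 2) / ‖x‖ with k_def
  set k' := √(‖x'‖ ^ 2 + δ ^ 2) / ‖x'‖ with k'_def
  have hblow : ‖blowOut δ x' - blowOut δ x‖ ^ 2 =
      (k' * ‖x'‖ - k * ‖x‖) ^ 2 + 2 * (k' * k * (‖x'‖ * ‖x‖ - inner ℝ x' x)) := by
    rw [blowOut, blowOut, ← k_def, ← k'_def, norm_sub_sq_real, norm_smul, norm_smul,
      real_inner_smul_left, real_inner_smul_right, Real.norm_of_nonneg (by linarith),
      Real.norm_of_nonneg (by linarith)]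
    ring
  have hcosines : ‖x' - x‖ ^ 2 = (‖x'‖ - ‖x‖) ^ 2 + 2 * (‖x'‖ * ‖x‖ - inner ℝ x' x) := by
    rw [norm_sub_sq_real]
    ring
  have hradial : (‖x'‖ - ‖x‖) ^ 2 ≤ (24 / 25) ^ 2 * ‖x' - x‖ ^ 2 := by
    rw [← sq_abs, ← mul_pow]
    exact pow_le_pow_left₀ (abs_nonneg _) (abs_norm_sub_norm_le_of_cones hx0 hx hd hn) 2
  have hangular : ‖x'‖ * ‖x‖ - inner ℝ x' x ≤ k' * k * (‖x'‖ * ‖x‖ - inner ℝ x' x) :=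
    le_mul_of_one_le_left (sub_nonneg.2 (real_inner_le_norm x' x))
      (one_le_mul_of_one_le_of_one_le hk' hk)
  refine le_of_sq_le_sq ?_ (norm_nonneg _)
  rw [hblow, mul_pow]
  linarith [sq_nonneg (k' * ‖x'‖ - k * ‖x‖), sq_nonneg ‖x' - x‖]

namespace Data

variable {D : Data} {x c : Plane}

theorem isClosed_centers : IsClosed (D.centers : Set Plane) :=
  (isClosed_singleton.preimage D.continuous_cover).preimage (continuous_const_smul 2)

theorem eventually_not_mem_centers (hx : x ∉ D.centers) : ∀ᶠ y in 𝓝 x, y ∉ D.centers :=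
  isClosed_centers.isOpen_compl.mem_nhds hx

theorem continuousAt_blowUp (hx : x ∉ D.centers) : ContinuousAt D.blowUp x :=
  (contDiffAt_blowUp hx).continuousAt

variable (D) in
/-- Near `x`, the lift of `Ψ⁻¹` contracts unstable directions at most by the factor `κ`. -/
def ExpandsUnstable (κ : ℝ) (x : Plane) : Prop :=
  ∀ᶠ x' in 𝓝 x, 2 * |(x' - x) 1| ≤ |(x' - x) 0| → κ * ‖x' - x‖ ≤ ‖D.blowUp x' - D.blowUp x‖

variable (D) in
theorem exists_expandsUnstable_away {r : ℝ} (hr : 0 < r) :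
    ∃ κ > 0, ∀ x ∈ D.away r, D.ExpandsUnstable κ x := by
  obtain ⟨t, ht, hup⟩ := D.exists_blowUp_mem_away hr
  obtain ⟨M, s, hs, hM⟩ := D.exists_lipC1On_blowDown ht
  refine ⟨((M : ℝ) + 1)⁻¹, by positivity, fun x hx => ?_⟩
  have hxc := not_mem_centers_of_mem_away hr hx
  filter_upwards [(continuousAt_blowUp hxc).eventually (Metric.ball_mem_nhds _ hs),
    eventually_not_mem_centers hxc] with x' hball hx'c _
  have hlip := (hM _ (hup x hx)).lipschitzOnWith.norm_sub_le hball (Metric.mem_ball_self hs)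
  rw [blowDown_blowUp hx'c, blowDown_blowUp hxc] at hlip
  rw [inv_mul_le_iff₀ (by positivity)]
  linarith [norm_nonneg (D.blowUp x' - D.blowUp x)]

variable (D) in
theorem exists_expandsUnstable_near : ∃ τ > 0, ∀ c ∈ D.centers, ∀ x, x ≠ c → ‖x - c‖ < τ →
    |(x - c) 0| ≤ |(x - c) 1| → D.ExpandsUnstable (1 / 4) x := by
  obtain ⟨s, hs, -, hblow⟩ := D.exists_blowUp_eq_blowOut
  refine ⟨√s, Real.sqrt_pos.2 hs, fun c hc x hne hlt hcone => ?_⟩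
  have heq : ∀ y, ‖y - c‖ < √s → D.blowUp y = c + blowOut D.δ (y - c) := fun y hy => by
    simpa using (hblow c hc).1 (y - c) ((Real.lt_sqrt (norm_nonneg _)).1 hy).le
  have hcont : Continuous fun x' : Plane => ‖x' - c‖ := by fun_prop
  have hpos : 0 < ‖x - c‖ := norm_sub_pos_iff.2 hne
  filter_upwards [hcont.continuousAt.eventually_lt continuousAt_const hlt,
    Metric.closedBall_mem_nhds x (show 0 < 1 / 100 * ‖x - c‖ by positivity)] with x' hx' hball hd
  rw [heq x' hx', heq x hlt, add_sub_add_left_eq_sub, ← sub_sub_sub_cancel_right x' x c]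
  rw [← sub_sub_sub_cancel_right x' x c] at hd
  rw [mem_closedBall_iff_norm, ← sub_sub_sub_cancel_right x' x c] at hball
  exact le_norm_blowOut_sub (sub_ne_zero.2 hne) hcone hd hball

/-! ### Orbits that stay near the centres -/

section

variable {G : Plane → Plane} {y : Plane} {τ : ℝ}

theorem iterate_mem_centers_of_forall_near (hG : NearSaddle G)
    (hfix : ∀ x ∈ D.centers, G x = saddle x) (hτ : 10 * τ ≤ D.ε) (hc : c ∈ D.centers)
    (hlt : ‖y - c‖ < τ) (hnear : ∀ k, ∃ c' ∈ D.centers, ‖G^[k] y - c'‖ < τ) (k : ℕ) :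
    G^[k] c ∈ D.centers ∧ ‖G^[k] y - G^[k] c‖ < τ := by
  induction k with
  | zero => exact ⟨hc, hlt⟩
  | succ k ih =>
    have hmem : G^[k + 1] c ∈ D.centers := by
      rw [Function.iterate_succ_apply', hfix _ ih.1]
      exact D.saddle_mem_centers_iff.2 ih.1
    have hle : ‖G^[k + 1] y - G^[k + 1] c‖ ≤ 19 * τ := by
      rw [Function.iterate_succ_apply', Function.iterate_succ_apply']
      exact (hG.norm_sub_le _ _).trans (by linarith [ih.2])
    obtain ⟨c', hc', hlt'⟩ := hnear (k + 1)
    have heq : c' = G^[k + 1] c := by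
      refine D.eq_of_near hc' hmem ?_
      rw [← sub_sub_sub_cancel_left _ _ (G^[k + 1] y)]
      exact (_root_.norm_sub_le _ _).trans (by linarith)
    exact ⟨hmem, heq ▸ hlt'⟩

theorem abs_fst_le_abs_snd_of_forall_near (hG : NearSaddle G)
    (hfix : ∀ x ∈ D.centers, G x = saddle x) (hτ : 10 * τ ≤ D.ε) (hc : c ∈ D.centers)
    (hlt : ‖y - c‖ < τ) (hnear : ∀ k, ∃ c' ∈ D.centers, ‖G^[k] y - c'‖ < τ) :
    |(y - c) 0| ≤ |(y - c) 1| := by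
  by_contra! hcone
  have hpos : 0 < |(y - c) 0| := (abs_nonneg _).trans_lt hcone
  obtain ⟨k, hk⟩ := pow_unbounded_of_one_lt (τ / |(y - c) 0|) (show (1 : ℝ) < 16 by norm_num)
  rw [div_lt_iff₀ hpos] at hk
  have hexpand := (hG.iterate_unstable hcone.le k).1
  have hcoord := abs_coord_le (G^[k] y - G^[k] c) 0
  linarith [(iterate_mem_centers_of_forall_near hG hfix hτ hc hlt hnear k).2]

theorem exists_frequently_expandsUnstable (hG : NearSaddle G)
    (hfix : ∀ x ∈ D.centers, G x = saddle x) (hx : ∀ n, G^[n] x ∉ D.centers) :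
    ∃ κ > 0, ∃ᶠ n in atTop, D.ExpandsUnstable κ (G^[n] x) := by
  obtain ⟨τ₁, hτ₁, hexp⟩ := D.exists_expandsUnstable_near
  set τ := min τ₁ (D.ε / 10)
  have hτ : 0 < τ := lt_min hτ₁ (by linarith [D.ε_pos])
  have hτε : 10 * τ ≤ D.ε := by linarith [min_le_right τ₁ (D.ε / 10)]
  by_cases hfar : ∃ᶠ n in atTop, G^[n] x ∈ D.away τ
  · obtain ⟨κ, hκ, hκexp⟩ := D.exists_expandsUnstable_away hτ
    exact ⟨κ, hκ, hfar.mono fun n hn => hκexp _ hn⟩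
  rw [not_frequently, eventually_atTop] at hfar
  obtain ⟨N, hN⟩ := hfar
  have hnear : ∀ n ≥ N, ∃ c ∈ D.centers, ‖G^[n] x - c‖ < τ := fun n hn => by
    simpa [away] using hN n hn
  refine ⟨1 / 4, by norm_num, (eventually_atTop.2 ⟨N, fun n hn => ?_⟩).frequently⟩
  obtain ⟨c, hc, hlt⟩ := hnear n hn
  refine hexp c hc _ (fun h => hx n (h ▸ hc)) (hlt.trans_le (min_le_left _ _)) ?_
  refine abs_fst_le_abs_snd_of_forall_near hG hfix hτε hc hlt fun k => ?_
  rw [← Function.iterate_add_apply]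
  exact hnear (k + n) (by omega)

end

end Data

theorem le_norm_deriv_of_eventually_le {F : Type*} [NormedAddCommGroup F] [NormedSpace ℝ F]
    {f : ℝ → F} {f' : F} {a c : ℝ} (hf : HasDerivAt f f' a)
    (h : ∀ᶠ t in 𝓝 a, c * |t - a| ≤ ‖f t - f a‖) : c ≤ ‖f'‖ := by
  refine ge_of_tendsto hf.tendsto_slope.norm ?_
  filter_upwards [h.filter_mono nhdsWithin_le_nhds, self_mem_nhdsWithin] with t ht hne
  rw [slope_def_module, norm_smul, norm_inv, Real.norm_eq_abs, ← div_eq_inv_mul,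
    le_div_iff₀ (abs_pos.2 (sub_ne_zero.2 hne))]
  exact ht

theorem lyapunov_pos_of_frequently_le {T : Torus → Torus} {p : Torus} {c r : ℝ} (hc : 0 < c)
    (hr : 1 < r) (h : ∃ᶠ n in atTop, c * r ^ n ≤ ‖torusFDeriv T^[n] p‖) : 0 < lyapunov T p := by
  have hs : 1 < √r := Real.lt_sqrt_of_sq_lt (by simpa using hr)
  have hlarge : ∀ᶠ n : ℕ in atTop, 1 ≤ c * √r ^ n :=
    ((tendsto_pow_atTop_atTop_of_one_lt hs).const_mul_atTop hc).eventually_ge_atTop 1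
  have hlog : ∃ᶠ n : ℕ in atTop, ((Real.log √r : ℝ) : EReal) ≤
      ((1 / (n : ℝ) * Real.log ‖torusFDeriv T^[n] p‖ : ℝ) : EReal) := by
    refine (h.and_eventually (hlarge.and (eventually_gt_atTop 0))).mono ?_
    rintro n ⟨hle, hone, hn⟩
    have hpow : √r ^ n ≤ ‖torusFDeriv T^[n] p‖ :=
      calc √r ^ n ≤ c * √r ^ n * √r ^ n := le_mul_of_one_le_left (by positivity) hone
        _ = c * r ^ n := by
          rw [mul_assoc, ← mul_pow, Real.mul_self_sqrt (zero_le_one.trans hr.le)]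
        _ ≤ ‖torusFDeriv T^[n] p‖ := hle
    rw [EReal.coe_le_coe_iff, one_div, ← div_eq_inv_mul, le_div_iff₀ (by exact_mod_cast hn),
      mul_comm, ← Real.log_pow]
    exact Real.log_le_log (by positivity) hpow
  exact (EReal.coe_pos.2 (Real.log_pos hs)).trans_le (le_limsup_of_frequently_le hlog)

namespace Data

variable {D : Data}

theorem isOpen_islandLift : IsOpen D.islandLift := by
  have hV : ∀ i, IsCompact (D.V i) := fun i => by
    refine (isCompact_closedBall _ _).image ?_
    rw [funext (D.chartAt_eq i)]
    exact continuous_const.add D.continuous_cover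
  have hisland : IsOpen D.island := (isCompact_iUnion hV).isClosed.isOpen_compl
  convert hisland.preimage D.continuous_cover using 1
  ext w
  exact cover_mem_island_iff.symm

/-! ### Derivatives of torus maps in the linear coordinates -/

section

variable {T : Torus → Torus} {S : Plane → Plane} {w : Plane}

theorem eventually_sub_eq_of_cover_eq {f g : Plane → Plane} (hf : ContinuousAt f w)
    (hg : ContinuousAt g w) (h : ∀ᶠ v in 𝓝 w, D.cover (f v) = D.cover (g v)) :
    ∀ᶠ v in 𝓝 w, f v - g v = f w - g w := by
  filter_upwards [h, (hf.sub hg).eventually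
    (Metric.closedBall_mem_nhds _ (show 0 < 2 * D.ε by linarith [D.ε_pos]))] with v hv hnear
  refine D.cover_inj_of_near ?_ (mem_closedBall_iff_norm.1 hnear)
  rw [map_sub, map_sub, hv, h.self_of_nhds, sub_self, sub_self]

theorem hasTorusFDerivAt_of_cover_eq {B : Plane →L[ℝ] Plane}
    (hTS : ∀ᶠ v in 𝓝 w, T (D.cover v) = D.cover (S v)) (hS : HasFDerivAt S B w) :
    HasTorusFDerivAt T ((D.P.symm : Plane →L[ℝ] Plane) ∘L B ∘L D.P) (D.cover w) := by
  rw [← D.P.apply_symm_apply w] at hTS hS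
  refine ⟨D.P.symm w, fun v => D.P.symm (S (D.P v)), rfl, ?_,
    D.P.symm.hasFDerivAt.comp _ (hS.comp _ D.P.hasFDerivAt)⟩
  filter_upwards [D.P.continuous.continuousAt.eventually hTS] with v hv
  have hcover : D.cover (D.P v) = proj v := congrArg proj (D.P.symm_apply_apply v)
  rw [← hcover, hv]
  rfl

theorem hasFDerivAt_of_cover_eq {A : Plane →L[ℝ] Plane}
    (hTS : ∀ᶠ v in 𝓝 w, T (D.cover v) = D.cover (S v)) (hS : ContinuousAt S w)
    (hA : HasTorusFDerivAt T A (D.cover w)) :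
    HasFDerivAt S ((D.P : Plane →L[ℝ] Plane) ∘L A ∘L D.P.symm) w := by
  obtain ⟨z, g, hz, hg, hgA⟩ := hA
  have hl : D.P z - w ∈ D.deck := by
    rw [← D.cover_eq_iff, ← hz]
    exact congrArg proj (D.P.symm_apply_apply z)
  have hback : D.P.symm (w + (D.P z - w)) = z := by
    rw [add_sub_cancel, D.P.symm_apply_apply]
  set f : Plane → Plane := fun v => D.P (g (D.P.symm (v + (D.P z - w))))
  have hf : HasFDerivAt f ((D.P : Plane →L[ℝ] Plane) ∘L A ∘L D.P.symm) w := by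
    rw [← hback] at hgA
    exact D.P.hasFDerivAt.comp w
      (hgA.comp w (D.P.symm.hasFDerivAt.comp w ((hasFDerivAt_id w).add_const _)))
  have hcover : ∀ᶠ v in 𝓝 w, D.cover (S v) = D.cover (f v) := by
    have hcont : Continuous fun v => D.P.symm (v + (D.P z - w)) := by fun_prop
    have hlim : ∀ᶠ v in 𝓝 w, proj (g (D.P.symm (v + (D.P z - w)))) =
        T (proj (D.P.symm (v + (D.P z - w)))) := by
      rw [← hback] at hg
      exact (hcont.tendsto w).eventually hg
    filter_upwards [hlim, hTS] with v hgv hTv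
    have hfv : D.cover (f v) = proj (g (D.P.symm (v + (D.P z - w)))) :=
      congrArg proj (D.P.symm_apply_apply _)
    have hv : D.cover (v + (D.P z - w)) = D.cover v := by
      rw [cover_eq_iff, add_sub_cancel_left]
      exact hl
    rw [hfv, hgv, ← hTv, ← hv]
    rfl
  have heq : S =ᶠ[𝓝 w] fun v => f v + (S w - f w) := by
    filter_upwards [eventually_sub_eq_of_cover_eq hS hf.continuousAt hcover] with v hv
    rw [← hv, add_sub_cancel]
  exact (hf.add_const _).congr_of_eventuallyEq heq

theorem norm_fderiv_le_of_cover_eq (hTS : ∀ᶠ v in 𝓝 w, T (D.cover v) = D.cover (S v))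
    (hS : DifferentiableAt ℝ S w) :
    ‖fderiv ℝ S w‖ ≤ ‖(D.P : Plane →L[ℝ] Plane)‖ *
      (‖torusFDeriv T (D.cover w)‖ * ‖(D.P.symm : Plane →L[ℝ] Plane)‖) := by
  have hex : ∃ L, HasTorusFDerivAt T L (D.cover w) :=
    ⟨_, hasTorusFDerivAt_of_cover_eq hTS hS.hasFDerivAt⟩
  have hspec : HasTorusFDerivAt T (torusFDeriv T (D.cover w)) (D.cover w) := by
    rw [torusFDeriv, dif_pos hex]
    exact hex.choose_spec
  rw [(hasFDerivAt_of_cover_eq hTS hS.continuousAt hspec).fderiv]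
  refine (ContinuousLinearMap.opNorm_comp_le _ _).trans ?_
  gcongr
  exact ContinuousLinearMap.opNorm_comp_le _ _

end

/-! ### Lyapunov exponents -/

variable (D) in
/-- On the island the torus map `T` is the perturbation by `u` of `F̂`, where `u` is periodic and so
small that the perturbation leaves the island invariant and its conjugate by `Ψ` is close to the
linear saddle. -/
structure IsPerturbation (u : Plane → Plane) (T : Torus → Torus) : Prop where
  differentiable : Differentiable ℝ u
  periodic : ∀ w, ∀ l ∈ D.deck, u (w + l) = u w
  perturbed_mem : ∀ x ∉ D.centers, D.perturbed u x ∈ D.islandLift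
  nearSaddle : NearSaddle (D.blownDownMap u)
  map_cover : ∀ x ∉ D.centers, T (D.cover (D.blowUp x)) = D.cover (D.perturbed u x)

variable (D) in
/-- The lift to the plane of the perturbation by `u` of `F̂` on the island. -/
def perturbedLift (u : Plane → Plane) (w : Plane) : Plane := D.perturbed u (D.blowDown w)

namespace IsPerturbation

variable {u : Plane → Plane} {T : Torus → Torus} {x w : Plane} {n : ℕ}

theorem blowUp_blownDownMap (h : D.IsPerturbation u T) (hx : x ∉ D.centers) :
    D.blowUp (D.blownDownMap u x) = D.perturbed u x := by
  rw [blownDownMap_of_not_mem hx, blowUp_blowDown (h.perturbed_mem x hx)]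

theorem iterate_not_mem_centers (h : D.IsPerturbation u T) (hx : x ∉ D.centers) (n : ℕ) :
    (D.blownDownMap u)^[n] x ∉ D.centers := by
  refine MapsTo.iterate (s := (D.centers : Set Plane)ᶜ) (fun y hy => ?_) n hx
  rw [blownDownMap_of_not_mem hy]
  exact blowDown_not_mem_centers (h.perturbed_mem y hy)

theorem iterate_cover (h : D.IsPerturbation u T) (hx : x ∉ D.centers) (n : ℕ) :
    T^[n] (D.cover (D.blowUp x)) = D.cover (D.blowUp ((D.blownDownMap u)^[n] x)) := by
  induction n with
  | zero => rfl
  | succ n ih =>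
    have hn := h.iterate_not_mem_centers hx n
    rw [Function.iterate_succ_apply', Function.iterate_succ_apply', ih, h.map_cover _ hn,
      h.blowUp_blownDownMap hn]

theorem iterate_perturbedLift (h : D.IsPerturbation u T) (hx : x ∉ D.centers) (n : ℕ) :
    (D.perturbedLift u)^[n] (D.blowUp x) = D.blowUp ((D.blownDownMap u)^[n] x) := by
  induction n with
  | zero => rfl
  | succ n ih =>
    have hn := h.iterate_not_mem_centers hx n
    rw [Function.iterate_succ_apply', Function.iterate_succ_apply', ih, perturbedLift,
      blowDown_blowUp hn, h.blowUp_blownDownMap hn]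

theorem mapsTo_perturbedLift (h : D.IsPerturbation u T) :
    MapsTo (D.perturbedLift u) D.islandLift D.islandLift := fun _ hw =>
  h.perturbed_mem _ (blowDown_not_mem_centers hw)

theorem differentiableOn_perturbedLift (h : D.IsPerturbation u T) :
    DifferentiableOn ℝ (D.perturbedLift u) D.islandLift := fun w hw => by
  have hx := blowDown_not_mem_centers hw
  have hdown := (contDiffAt_blowDown hw).differentiableAt (by simp)
  have hup := (contDiffAt_blowUp hx).differentiableAt (by simp)
  have hsaddle := (contDiffAt_blowUp (mt D.saddle_mem_centers_iff.1 hx)).differentiableAt (by simp)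
  have hperturbed : DifferentiableAt ℝ (D.perturbed u) (D.blowDown w) :=
    (hsaddle.comp _ saddle.differentiableAt).add (h.differentiable.differentiableAt.comp _ hup)
  exact (hperturbed.comp w hdown).differentiableWithinAt

theorem iterate_cover_perturbedLift (h : D.IsPerturbation u T) (hw : w ∈ D.islandLift) (n : ℕ) :
    T^[n] (D.cover w) = D.cover ((D.perturbedLift u)^[n] w) := by
  rw [← blowUp_blowDown hw, h.iterate_cover (blowDown_not_mem_centers hw),
    h.iterate_perturbedLift (blowDown_not_mem_centers hw)]

theorem differentiableAt_iterate_perturbedLift (h : D.IsPerturbation u T) (hw : w ∈ D.islandLift)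
    (n : ℕ) : DifferentiableAt ℝ (D.perturbedLift u)^[n] w :=
  (h.differentiableOn_perturbedLift.iterate h.mapsTo_perturbedLift n).differentiableAt
    (isOpen_islandLift.mem_nhds hw)

theorem le_norm_fderiv_iterate (h : D.IsPerturbation u T) (hx : x ∉ D.centers) {κ : ℝ}
    (hκ : 0 < κ) (hexp : D.ExpandsUnstable κ ((D.blownDownMap u)^[n] x)) :
    κ * 16 ^ n ≤
      ‖fderiv ℝ (D.perturbedLift u)^[n] (D.blowUp x)‖ * ‖fderiv ℝ D.blowUp x‖ := by
  set e : Plane := EuclideanSpace.single 0 1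
  set line : ℝ → Plane := fun t => x + t • e
  have hline0 : line 0 = x := by simp [line]
  have hline : HasDerivAt line e 0 := by
    simpa only [id, one_smul] using ((hasDerivAt_id (0 : ℝ)).smul_const e).const_add x
  have hlim : Tendsto line (𝓝 0) (𝓝 x) := hline0 ▸ hline.continuousAt
  set φ : ℝ → Plane := fun t => (D.perturbedLift u)^[n] (D.blowUp (line t))
  have hφ : HasDerivAt φ (fderiv ℝ (D.perturbedLift u)^[n] (D.blowUp x)
      (fderiv ℝ D.blowUp x e)) 0 := by
    have hup := ((contDiffAt_blowUp hx).differentiableAt (by simp)).hasFDerivAt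
    have hiter := (h.differentiableAt_iterate_perturbedLift (blowUp_mem_islandLift hx)
      n).hasFDerivAt
    exact (hiter.comp x hup).comp_hasDerivAt_of_eq 0 hline hline0.symm
  have hexpand : ∀ᶠ t in 𝓝 0, κ * 16 ^ n * |t - 0| ≤ ‖φ t - φ 0‖ := by
    filter_upwards [hlim.eventually (eventually_not_mem_centers hx),
      ((h.nearSaddle.continuous.iterate n).tendsto x |>.comp hlim).eventually hexp]
      with t ht hexp_t
    have hfst : (line t - x) 0 = t := by simp [line, e]
    have hsnd : (line t - x) 1 = 0 := by simp [line, e]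
    have hcone : 2 * |(line t - x) 1| ≤ |(line t - x) 0| := by simp [hsnd]
    have hgrow := (h.nearSaddle.iterate_unstable (by simp [hsnd] : |(line t - x) 1| ≤ _) n).1
    have hcoord := abs_coord_le ((D.blownDownMap u)^[n] (line t) - (D.blownDownMap u)^[n] x) 0
    rw [hfst] at hgrow
    simp only [φ, hline0, sub_zero, h.iterate_perturbedLift ht, h.iterate_perturbedLift hx]
    rw [mul_assoc]
    exact (mul_le_mul_of_nonneg_left (hgrow.trans hcoord) hκ.le).trans
      (hexp_t (h.nearSaddle.iterate_cone hcone n))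
  refine (le_norm_deriv_of_eventually_le hφ hexpand).trans ?_
  refine (ContinuousLinearMap.le_opNorm _ _).trans ?_
  gcongr
  simpa [e] using (fderiv ℝ D.blowUp x).le_opNorm e

theorem lyapunov_pos (h : D.IsPerturbation u T) {p : Torus} (hp : p ∈ D.island) :
    0 < lyapunov T p := by
  obtain ⟨w, rfl⟩ := D.cover_surjective p
  have hw := cover_mem_island_iff.1 hp
  have hx := blowDown_not_mem_centers hw
  obtain ⟨κ, hκ, hfreq⟩ := exists_frequently_expandsUnstable h.nearSaddle
    (fun y hy => blownDownMap_of_mem hy) (h.iterate_not_mem_centers hx)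
  set Q := ‖(D.P : Plane →L[ℝ] Plane)‖ * ‖(D.P.symm : Plane →L[ℝ] Plane)‖ *
    ‖fderiv ℝ D.blowUp (D.blowDown w)‖ + 1
  have hQ : 0 < Q := by positivity
  refine lyapunov_pos_of_frequently_le (div_pos hκ hQ) (show (1 : ℝ) < 16 by norm_num)
    (hfreq.mono fun n hexp => ?_)
  have hlift : ∀ᶠ v in 𝓝 w, T^[n] (D.cover v) = D.cover ((D.perturbedLift u)^[n] v) := by
    filter_upwards [isOpen_islandLift.mem_nhds hw] with v hv
    exact h.iterate_cover_perturbedLift hv n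
  have hgrow := h.le_norm_fderiv_iterate hx hκ hexp
  rw [blowUp_blowDown hw] at hgrow
  have hnorm := norm_fderiv_le_of_cover_eq hlift (h.differentiableAt_iterate_perturbedLift hw n)
  rw [div_mul_eq_mul_div, div_le_iff₀ hQ]
  refine hgrow.trans ((mul_le_mul_of_nonneg_right hnorm (norm_nonneg _)).trans ?_)
  linarith [norm_nonneg (torusFDeriv T^[n] (D.cover w))]

end IsPerturbation

end Data

theorem ConjugateOn.transitiveOn {f g : Torus → Torus} {K : Set Torus} (h : ConjugateOn f g K)
    (hf : TransitiveOn f K) : TransitiveOn g K := by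
  obtain ⟨hfK, hgK, e, he⟩ := h
  refine ⟨hgK.image_eq, fun U V hU hV hUK hVK => ?_⟩
  have pullback : ∀ W : Set Torus, IsOpen W → (W ∩ K).Nonempty → ∃ W' : Set Torus, IsOpen W' ∧
      (W' ∩ K).Nonempty ∧ ∀ p : K, (p : Torus) ∈ W' → (e p : Torus) ∈ W := by
    rintro W hW ⟨q, hqW, hq⟩
    obtain ⟨W', hW', heq⟩ :=
      isOpen_induced_iff.1 (hW.preimage (continuous_subtype_val.comp e.continuous))
    have hmem : ∀ p : K, (p : Torus) ∈ W' ↔ (e p : Torus) ∈ W := Set.ext_iff.1 heq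
    refine ⟨W', hW', ⟨e.symm ⟨q, hq⟩, ?_, (e.symm ⟨q, hq⟩).2⟩, fun p => (hmem p).1⟩
    rwa [hmem, e.apply_symm_apply]
  obtain ⟨U', hU', hU'K, hUU'⟩ := pullback U hU hUK
  obtain ⟨V', hV', hV'K, hVV'⟩ := pullback V hV hVK
  obtain ⟨n, _, ⟨p, ⟨hpU, hp⟩, rfl⟩, hpV, hpK⟩ := hf.2 U' V' hU' hV' hU'K hV'K
  have hconj : (e ⟨f^[n] p, hpK⟩ : Torus) = g^[n] (e ⟨p, hp⟩) := by
    have hiter := congrArg Subtype.val ((he.iterate_right n).eq ⟨p, hp⟩)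
    rw [MapsTo.iterate_restrict, MapsTo.iterate_restrict] at hiter
    exact hiter
  refine ⟨n, _, ⟨e ⟨p, hp⟩, ⟨hUU' _ hpU, (e ⟨p, hp⟩).2⟩, rfl⟩, ?_⟩
  rw [← hconj]
  exact ⟨hVV' _ hpV, (e _).2⟩

/-! ### Transitivity of the linear saddle modulo the lattice -/

theorem iterate_saddle_zero (n : ℕ) (w : Plane) : (saddle^[n] w) 0 = lam ^ n * w 0 := by
  induction n with
  | zero => simp
  | succ n ih => rw [Function.iterate_succ_apply', saddle_zero, ih, pow_succ', mul_assoc]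

theorem iterate_saddle_one (n : ℕ) (w : Plane) : (saddle^[n] w) 1 = lam⁻¹ ^ n * w 1 := by
  induction n with
  | zero => simp
  | succ n ih => rw [Function.iterate_succ_apply', saddle_one, ih, pow_succ', mul_assoc]

theorem exists_iterate_saddle_near {x y : Plane} {r : ℝ} (hx : |x 0| < r) (hy : |y 1| < r) :
    ∃ n z, ‖z - x‖ < 2 * r ∧ ‖saddle^[n] z - y‖ < 2 * r := by
  have hr : 0 < r := (abs_nonneg _).trans_lt hx
  have hpow : Tendsto (fun n : ℕ => lam⁻¹ ^ n) atTop (𝓝 0) :=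
    tendsto_pow_atTop_nhds_zero_of_lt_one lam_inv_pos.le (lam_inv_le.trans_lt (by norm_num))
  have hsmall : ∀ a : ℝ, ∀ᶠ n : ℕ in atTop, |lam⁻¹ ^ n * a| < r := fun a => by
    have hlim : Tendsto (fun n : ℕ => |lam⁻¹ ^ n * a|) atTop (𝓝 0) := by
      simpa using (hpow.mul_const a).abs
    exact hlim.eventually (gt_mem_nhds hr)
  obtain ⟨n, hxn, hyn⟩ := ((hsmall (x 1)).and (hsmall (y 0))).exists
  have hinv : lam ^ n * lam⁻¹ ^ n = 1 := by rw [← mul_pow, lam_mul_inv, one_pow]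
  refine ⟨n, !₂[lam⁻¹ ^ n * y 0, x 1], (plane_norm_le _).trans_lt ?_,
    (plane_norm_le _).trans_lt ?_⟩
  · simp only [PiLp.sub_apply, Matrix.cons_val_zero, Matrix.cons_val_one, sub_self, abs_zero]
    linarith [abs_sub (lam⁻¹ ^ n * y 0) (x 0)]
  · simp only [PiLp.sub_apply, iterate_saddle_zero, iterate_saddle_one, Matrix.cons_val_zero,
      Matrix.cons_val_one, ← mul_assoc, hinv, one_mul, sub_self, abs_zero]
    linarith [abs_sub (lam⁻¹ ^ n * x 1) (y 1)]

theorem dense_of_lam_inv_mul_mem {S : AddSubgroup ℝ} (hne : S ≠ ⊥)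
    (hS : ∀ a ∈ S, lam⁻¹ * a ∈ S) : Dense (S : Set ℝ) := by
  refine S.dense_or_cyclic.resolve_right ?_
  rintro ⟨a, ha⟩
  rw [← AddSubgroup.zmultiples_eq_closure] at ha
  have ha0 : a ≠ 0 := fun h => hne (by rw [ha, h, AddSubgroup.zmultiples_zero_eq_bot])
  have hmem := hS a (ha ▸ AddSubgroup.mem_zmultiples a)
  rw [ha] at hmem
  obtain ⟨k, hk⟩ := AddSubgroup.mem_zmultiples_iff.1 hmem
  rw [zsmul_eq_mul] at hk
  have hklam : (k : ℝ) = lam⁻¹ := mul_right_cancel₀ ha0 hk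
  have hpos : 0 < k := by exact_mod_cast hklam ▸ lam_inv_pos
  have hlt : k < 1 := by
    have : (k : ℝ) < 1 := hklam ▸ lam_inv_le.trans_lt (by norm_num)
    exact_mod_cast this
  omega

namespace Data

variable {D : Data}

variable (D) in
/-- The group of values of the `i`-th coordinate on the lattice of deck transformations. -/
def coordValues (i : Fin 2) : AddSubgroup ℝ :=
  D.deck.map (EuclideanSpace.proj i : Plane →L[ℝ] ℝ).toLinearMap.toAddMonoidHom

theorem mem_coordValues {i : Fin 2} {a : ℝ} :
    a ∈ D.coordValues i ↔ ∃ l ∈ D.deck, l i = a := Iff.rfl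

theorem apply_single_mem_deck (j : Fin 2) : D.P (EuclideanSpace.single j 1) ∈ D.deck := by
  rw [mem_deck]
  change proj (D.P.symm (D.P (EuclideanSpace.single j 1))) = 0
  rw [D.P.symm_apply_apply, proj_eq_zero_iff]
  intro k
  by_cases hjk : k = j
  · exact ⟨1, by simp [hjk]⟩
  · exact ⟨0, by simp [hjk]⟩

theorem coordValues_ne_bot (i : Fin 2) : D.coordValues i ≠ ⊥ := by
  intro hbot
  have hzero : ∀ j, D.P (EuclideanSpace.single j 1) i = 0 := fun j => by
    rw [← AddSubgroup.mem_bot, ← hbot]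
    exact mem_coordValues.2 ⟨_, apply_single_mem_deck j, rfl⟩
  obtain ⟨z, hz⟩ := D.P.surjective (EuclideanSpace.single i 1)
  have hdecomp : z = z 0 • EuclideanSpace.single 0 1 + z 1 • EuclideanSpace.single 1 1 := by
    apply plane_ext <;> simp
  rw [hdecomp, map_add, map_smul, map_smul] at hz
  simpa [hzero] using congrArg (fun v : Plane => v i) hz

theorem dense_coordValues (i : Fin 2) : Dense (D.coordValues i : Set ℝ) := by
  refine dense_of_lam_inv_mul_mem (coordValues_ne_bot i) fun a ha => ?_
  obtain ⟨l, hl, rfl⟩ := mem_coordValues.1 ha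
  fin_cases i
  · exact mem_coordValues.2 ⟨saddle.symm l, D.saddle_symm_mem_deck_iff.2 hl, rfl⟩
  · exact mem_coordValues.2 ⟨saddle l, D.saddle_mem_deck_iff.2 hl, rfl⟩

theorem exists_deck_abs_sub_lt (x : Plane) (i : Fin 2) {r : ℝ} (hr : 0 < r) :
    ∃ l ∈ D.deck, |(x - l) i| < r := by
  obtain ⟨a, ha, hlt⟩ := (dense_coordValues (D := D) i).exists_dist_lt (x i) hr
  obtain ⟨l, hl, rfl⟩ := mem_coordValues.1 ha
  exact ⟨l, hl, hlt⟩

theorem exists_iterate_saddle_add_mem {x y : Plane} {U V : Set Plane} (hU : U ∈ 𝓝 x)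
    (hV : V ∈ 𝓝 y) : ∃ n, ∃ z ∈ U, ∃ l ∈ D.deck, saddle^[n] z + l ∈ V := by
  obtain ⟨r, hr, hrU⟩ := Metric.mem_nhds_iff.1 hU
  obtain ⟨s, hs, hsV⟩ := Metric.mem_nhds_iff.1 hV
  have hmin : 0 < min r s / 2 := half_pos (lt_min hr hs)
  obtain ⟨l, hl, hxl⟩ := exists_deck_abs_sub_lt (D := D) x 0 hmin
  obtain ⟨m, hm, hym⟩ := exists_deck_abs_sub_lt (D := D) y 1 hmin
  obtain ⟨n, z, hzx, hzy⟩ := exists_iterate_saddle_near hxl hym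
  have hiter : saddle^[n] l ∈ D.deck :=
    MapsTo.iterate (f := saddle) (s := (D.deck : Set Plane))
      (fun _ h => D.saddle_mem_deck_iff.2 h) n hl
  refine ⟨n, z + l, hrU ?_, m - saddle^[n] l, D.deck.sub_mem hm hiter, hsV ?_⟩
  · rw [mem_ball_iff_norm, show z + l - x = z - (x - l) by abel]
    linarith [min_le_left r s]
  · rw [mem_ball_iff_norm, iterate_map_add,
      show saddle^[n] z + saddle^[n] l + (m - saddle^[n] l) - y = saddle^[n] z - (y - m) by abel]
    linarith [min_le_right r s]

/-! ### Maps of the island covered by maps of the plane -/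

theorem exists_of_mem_island {p : Torus} (hp : p ∈ D.island) :
    ∃ x ∉ D.centers, D.cover (D.blowUp x) = p := by
  obtain ⟨w, rfl⟩ := D.cover_surjective p
  have hw := cover_mem_island_iff.1 hp
  exact ⟨D.blowDown w, blowDown_not_mem_centers hw, by rw [blowUp_blowDown hw]⟩

theorem cover_blowUp_mem_island {x : Plane} (hx : x ∉ D.centers) :
    D.cover (D.blowUp x) ∈ D.island :=
  cover_mem_island_iff.2 (blowUp_mem_islandLift hx)

theorem cover_blowUp_add (x : Plane) {l : Plane} (hl : l ∈ D.deck) :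
    D.cover (D.blowUp (x + l)) = D.cover (D.blowUp x) := by
  rw [blowUp_add (D.deck_le_centers hl), cover_eq_iff, add_sub_cancel_left]
  exact hl

theorem sub_mem_deck_of_cover_blowUp_eq {x y : Plane} (hx : x ∉ D.centers) (hy : y ∉ D.centers)
    (h : D.cover (D.blowUp x) = D.cover (D.blowUp y)) : x - y ∈ D.deck := by
  have hl := D.cover_eq_iff.1 h
  have hadd := blowDown_add (D.deck_le_centers hl) (D.blowUp y)
  rw [add_sub_cancel, blowDown_blowUp hx, blowDown_blowUp hy] at hadd
  rwa [hadd, add_sub_cancel_left]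

variable (D) in
/-- `H` fixes the lifts of the points `Ωᵢ` and commutes with the deck transformations, so that it
covers a homeomorphism of the torus, hence of the island through `Ψ`. -/
structure Equivariant (H : Plane ≃ₜ Plane) : Prop where
  apply_eq : ∀ x ∈ D.centers, H x = x
  apply_add : ∀ x, ∀ l ∈ D.deck, H (x + l) = H x + l

variable (D) in
/-- The map of the island that an equivariant map `H` of the plane covers through `Ψ`. -/
def islandMap (H : Plane → Plane) (p : Torus) : Torus :=
  D.cover (D.blowUp (H (D.blowDown (Function.surjInv D.cover_surjective p))))

namespace Equivariant

variable {H : Plane ≃ₜ Plane} {x : Plane}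

theorem symm (hH : D.Equivariant H) : D.Equivariant H.symm where
  apply_eq x hx := by rw [H.symm_apply_eq, hH.apply_eq x hx]
  apply_add x l hl := by rw [H.symm_apply_eq, hH.apply_add _ l hl, H.apply_symm_apply]

theorem apply_not_mem (hH : D.Equivariant H) (hx : x ∉ D.centers) : H x ∉ D.centers := fun h => by
  have hfix := hH.symm.apply_eq _ h
  rw [H.symm_apply_apply] at hfix
  exact hx (hfix ▸ h)

theorem islandMap_cover (hH : D.Equivariant H) (w : Plane) :
    D.islandMap H (D.cover w) = D.cover (D.blowUp (H (D.blowDown w))) := by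
  have hl := D.cover_eq_iff.1 (Function.surjInv_eq D.cover_surjective (D.cover w))
  rw [islandMap, ← cover_blowUp_add (H (D.blowDown w)) hl, ← hH.apply_add _ _ hl,
    ← blowDown_add (D.deck_le_centers hl), add_sub_cancel]

theorem islandMap_cover_blowUp (hH : D.Equivariant H) (hx : x ∉ D.centers) :
    D.islandMap H (D.cover (D.blowUp x)) = D.cover (D.blowUp (H x)) := by
  rw [hH.islandMap_cover, blowDown_blowUp hx]

theorem mapsTo_islandMap (hH : D.Equivariant H) : MapsTo (D.islandMap H) D.island D.island := by
  intro p hp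
  obtain ⟨x, hx, rfl⟩ := exists_of_mem_island hp
  rw [hH.islandMap_cover_blowUp hx]
  exact cover_blowUp_mem_island (hH.apply_not_mem hx)

theorem islandMap_symm_islandMap (hH : D.Equivariant H) {p : Torus} (hp : p ∈ D.island) :
    D.islandMap H.symm (D.islandMap H p) = p := by
  obtain ⟨x, hx, rfl⟩ := exists_of_mem_island hp
  rw [hH.islandMap_cover_blowUp hx, hH.symm.islandMap_cover_blowUp (hH.apply_not_mem hx),
    H.symm_apply_apply]

theorem continuousOn_islandMap (hH : D.Equivariant H) : ContinuousOn (D.islandMap H) D.island := by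
  refine fun p hp => ContinuousAt.continuousWithinAt ?_
  obtain ⟨w, rfl⟩ := D.cover_surjective p
  have hw := cover_mem_island_iff.1 hp
  have hcomp : D.islandMap H ∘ D.cover = fun w => D.cover (D.blowUp (H (D.blowDown w))) :=
    funext hH.islandMap_cover
  rw [ContinuousAt, ← D.isOpenMap_cover.map_nhds_eq D.continuous_cover.continuousAt,
    tendsto_map'_iff, hcomp, hH.islandMap_cover]
  have hdown : ContinuousAt (fun w => H (D.blowDown w)) w :=
    H.continuous.continuousAt.comp (contDiffAt_blowDown hw).continuousAt
  have hup : ContinuousAt D.blowUp (H (D.blowDown w)) :=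
    continuousAt_blowUp (hH.apply_not_mem (blowDown_not_mem_centers hw))
  exact D.continuous_cover.continuousAt.comp (hup.comp (f := fun w => H (D.blowDown w)) hdown)

/-- The homeomorphism of the island that `H` covers through `Ψ`. -/
def islandHomeo (hH : D.Equivariant H) : D.island ≃ₜ D.island where
  toFun := hH.mapsTo_islandMap.restrict
  invFun := hH.symm.mapsTo_islandMap.restrict
  left_inv p := Subtype.ext (hH.islandMap_symm_islandMap p.2)
  right_inv p := Subtype.ext (hH.symm.islandMap_symm_islandMap p.2)
  continuous_toFun := hH.continuousOn_islandMap.mapsToRestrict hH.mapsTo_islandMap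
  continuous_invFun := hH.symm.continuousOn_islandMap.mapsToRestrict hH.symm.mapsTo_islandMap

end Equivariant

/-! ### Conjugacy and transitivity on the island -/

theorem blownDownMap_zero : D.blownDownMap 0 = saddle := by
  funext x
  by_cases hx : x ∈ D.centers
  · exact blownDownMap_of_mem hx
  · rw [blownDownMap_of_not_mem hx, perturbed, Pi.zero_apply, add_zero,
      blowDown_blowUp (mt D.saddle_mem_centers_iff.1 hx)]

theorem hatF_cover_blowUp {x : Plane} (hx : x ∉ D.centers) :
    D.hatF (D.cover (D.blowUp x)) = D.cover (D.blowUp (saddle x)) := by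
  rw [hatF_cover (blowUp_mem_islandLift hx)]
  change D.cover (D.blowUp (saddle (D.blowDown (D.blowUp x)))) = _
  rw [blowDown_blowUp hx]

variable (D) in
theorem isPerturbation_hatF : D.IsPerturbation 0 D.hatF where
  differentiable := differentiable_const 0
  periodic _ _ _ := rfl
  perturbed_mem x hx := by
    rw [perturbed, Pi.zero_apply, add_zero]
    exact blowUp_mem_islandLift (mt D.saddle_mem_centers_iff.1 hx)
  nearSaddle := blownDownMap_zero (D := D) ▸ nearSaddle_saddle
  map_cover x hx := by rw [hatF_cover_blowUp hx, perturbed, Pi.zero_apply, add_zero]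

namespace IsPerturbation

variable {u : Plane → Plane} {T : Torus → Torus} {x : Plane}

theorem blownDownMap_not_mem (h : D.IsPerturbation u T) (hx : x ∉ D.centers) :
    D.blownDownMap u x ∉ D.centers := h.iterate_not_mem_centers hx 1

theorem map_cover_blowUp (h : D.IsPerturbation u T) (hx : x ∉ D.centers) :
    T (D.cover (D.blowUp x)) = D.cover (D.blowUp (D.blownDownMap u x)) := h.iterate_cover hx 1

theorem bijOn (h : D.IsPerturbation u T) : BijOn T D.island D.island := by
  refine ⟨fun p hp => ?_, fun p hp q hq hpq => ?_, fun p hp => ?_⟩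
  · obtain ⟨x, hx, rfl⟩ := exists_of_mem_island hp
    rw [h.map_cover_blowUp hx]
    exact cover_blowUp_mem_island (h.blownDownMap_not_mem hx)
  · obtain ⟨x, hx, rfl⟩ := exists_of_mem_island hp
    obtain ⟨y, hy, rfl⟩ := exists_of_mem_island hq
    rw [h.map_cover_blowUp hx, h.map_cover_blowUp hy] at hpq
    have hl := D.saddle_symm_mem_deck_iff.2 <|
      sub_mem_deck_of_cover_blowUp_eq (h.blownDownMap_not_mem hx) (h.blownDownMap_not_mem hy) hpq
    have hadd := blownDownMap_add h.periodic y hl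
    rw [saddle.apply_symm_apply, add_sub_cancel] at hadd
    rw [← h.nearSaddle.toHomeomorph.injective hadd, cover_blowUp_add y hl]
  · obtain ⟨y, hy, rfl⟩ := exists_of_mem_island hp
    obtain ⟨x, rfl : D.blownDownMap u x = y⟩ := h.nearSaddle.toHomeomorph.surjective y
    have hx : x ∉ D.centers := fun hx =>
      hy (blownDownMap_of_mem hx ▸ D.saddle_mem_centers_iff.2 hx)
    exact ⟨_, cover_blowUp_mem_island hx, h.map_cover_blowUp hx⟩

theorem exists_equivariant_conj (h : D.IsPerturbation u T) :
    ∃ H, D.Equivariant H ∧ ∀ x, H (saddle x) = D.blownDownMap u (H x) := by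
  obtain ⟨K, hK⟩ := exists_norm_blownDownMap_sub_le h.nearSaddle
  obtain ⟨H, ⟨C, hC⟩, hH⟩ := h.nearSaddle.exists_conj hK
  refine ⟨H, ⟨?_, fun x l hl => ?_⟩, hH⟩
  · exact h.nearSaddle.conj_eqOn_id hC hH (fun _ => D.saddle_mem_centers_iff.2)
      (fun _ => D.saddle_symm_mem_centers_iff.2) fun _ => blownDownMap_of_mem
  · exact h.nearSaddle.conj_add hC hH (fun _ => D.saddle_mem_deck_iff.2)
      (fun _ => D.saddle_symm_mem_deck_iff.2) (fun x l => blownDownMap_add h.periodic x) x hl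

theorem conjugateOn (h : D.IsPerturbation u T) : ConjugateOn D.hatF T D.island := by
  obtain ⟨H, hequiv, hconj⟩ := h.exists_equivariant_conj
  refine ⟨D.isPerturbation_hatF.bijOn, h.bijOn, hequiv.islandHomeo, fun p => Subtype.ext ?_⟩
  obtain ⟨x, hx, hp⟩ := exists_of_mem_island p.2
  change D.islandMap H (D.hatF p) = T (D.islandMap H p)
  rw [← hp, hatF_cover_blowUp hx, hequiv.islandMap_cover_blowUp hx, hequiv.islandMap_cover_blowUp
    (mt D.saddle_mem_centers_iff.1 hx), hconj, h.map_cover_blowUp (hequiv.apply_not_mem hx)]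

end IsPerturbation

variable (D) in
theorem transitiveOn_hatF : TransitiveOn D.hatF D.island := by
  refine ⟨D.isPerturbation_hatF.bijOn.image_eq, fun U V hU hV hUK hVK => ?_⟩
  have lift : ∀ W : Set Torus, IsOpen W → (W ∩ D.island).Nonempty →
      ∃ x, ∀ᶠ z in 𝓝 x, z ∉ D.centers ∧ D.cover (D.blowUp z) ∈ W := by
    rintro W hW ⟨p, hpW, hp⟩
    obtain ⟨x, hx, rfl⟩ := exists_of_mem_island hp
    exact ⟨x, (eventually_not_mem_centers hx).and
      ((D.continuous_cover.continuousAt.comp (continuousAt_blowUp hx)).eventually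
        (hW.mem_nhds hpW))⟩
  obtain ⟨x, hx⟩ := lift U hU hUK
  obtain ⟨y, hy⟩ := lift V hV hVK
  obtain ⟨n, z, ⟨hz, hzU⟩, l, hl, hlc, hlV⟩ := exists_iterate_saddle_add_mem (D := D) hx hy
  refine ⟨n, _, ⟨D.cover (D.blowUp z), ⟨hzU, cover_blowUp_mem_island hz⟩, rfl⟩, ?_⟩
  rw [D.isPerturbation_hatF.iterate_cover hz, blownDownMap_zero, ← cover_blowUp_add _ hl]
  exact ⟨hlV, cover_blowUp_mem_island hlc⟩

end Data

/-! ### Perturbations of the blown-up map -/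

section SmallC2

variable {u : Plane → Plane} {η η' : ℝ}

theorem SmallC2.mono (h : SmallC2 η u) (hη : η ≤ η') : SmallC2 η' u where
  diff := h.diff
  bound x := (h.bound x).trans hη
  bound_fderiv x := (h.bound_fderiv x).trans hη
  lip_fderiv x y := (h.lip_fderiv x y).trans (by gcongr)

theorem smallC2_of_norm_iteratedFDeriv_le (hu : ContDiff ℝ 2 u)
    (h : ∀ k : ℕ, k ≤ 2 → ∀ z, ‖iteratedFDeriv ℝ k u z‖ ≤ η) : SmallC2 η u where
  diff := hu.differentiable (by norm_num)
  bound z := by simpa using h 0 (by norm_num) z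
  bound_fderiv z := by simpa only [norm_iteratedFDeriv_one] using h 1 (by norm_num) z
  lip_fderiv x y := by
    have hdiff : Differentiable ℝ (fderiv ℝ u) :=
      (hu.fderiv_right (m := 1) (by norm_num)).differentiable (by norm_num)
    have hbound : ∀ z, ‖fderiv ℝ (fderiv ℝ u) z‖ ≤ η := fun z => by
      rw [← norm_iteratedFDeriv_one, norm_iteratedFDeriv_fderiv]
      exact h 2 le_rfl z
    exact convex_univ.norm_image_sub_le_of_norm_fderiv_le (fun z _ => hdiff z)
      (fun z _ => hbound z) (mem_univ y) (mem_univ x)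

theorem norm_comp_comp_le {𝕜 E F G H : Type*} [NontriviallyNormedField 𝕜]
    [SeminormedAddCommGroup E] [NormedSpace 𝕜 E] [SeminormedAddCommGroup F] [NormedSpace 𝕜 F]
    [SeminormedAddCommGroup G] [NormedSpace 𝕜 G] [SeminormedAddCommGroup H] [NormedSpace 𝕜 H]
    (P : G →L[𝕜] H) (Q : E →L[𝕜] F) (B : F →L[𝕜] G) : ‖P.comp (B.comp Q)‖ ≤ ‖P‖ * ‖B‖ * ‖Q‖ := by
  refine (ContinuousLinearMap.opNorm_comp_le _ _).trans ?_
  rw [mul_assoc]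
  gcongr
  exact ContinuousLinearMap.opNorm_comp_le _ _

theorem SmallC2.conj (h : SmallC2 η u) (P : Plane ≃L[ℝ] Plane) :
    SmallC2 (‖(P : Plane →L[ℝ] Plane)‖ * (1 + ‖(P.symm : Plane →L[ℝ] Plane)‖) ^ 2 * η)
      (fun w => P (u (P.symm w))) := by
  set p := ‖(P : Plane →L[ℝ] Plane)‖
  set q := ‖(P.symm : Plane →L[ℝ] Plane)‖
  have hη : 0 ≤ η := h.nonneg
  have : 0 ≤ p := norm_nonneg _
  have hq : 0 ≤ q := norm_nonneg _
  let A : (Plane →L[ℝ] Plane) → (Plane →L[ℝ] Plane) := fun B =>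
    (P : Plane →L[ℝ] Plane).comp (B.comp (P.symm : Plane →L[ℝ] Plane))
  have hA : ∀ B, ‖A B‖ ≤ p * ‖B‖ * q := norm_comp_comp_le _ _
  have hderiv : ∀ w, HasFDerivAt (fun w => P (u (P.symm w))) (A (fderiv ℝ u (P.symm w))) w :=
    fun w => P.hasFDerivAt.comp w ((h.diff _).hasFDerivAt.comp w P.symm.hasFDerivAt)
  have hfactor : ∀ s, s ≤ (1 + q) ^ 2 → p * η * s ≤ p * (1 + q) ^ 2 * η := fun s hs => by
    rw [mul_right_comm p]
    gcongr
  refine ⟨fun w => (hderiv w).differentiableAt, fun w => ?_, fun w => ?_, fun w w' => ?_⟩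
  · calc ‖P (u (P.symm w))‖ ≤ p * ‖u (P.symm w)‖ := (P : Plane →L[ℝ] Plane).le_opNorm _
      _ ≤ p * η * 1 := by rw [mul_one]; gcongr; exact h.bound _
      _ ≤ p * (1 + q) ^ 2 * η := hfactor 1 (by nlinarith)
  · calc ‖fderiv ℝ (fun w => P (u (P.symm w))) w‖ ≤ p * ‖fderiv ℝ u (P.symm w)‖ * q := by
          rw [(hderiv w).fderiv]; exact hA _
      _ ≤ p * η * q := by gcongr; exact h.bound_fderiv _
      _ ≤ p * (1 + q) ^ 2 * η := hfactor q (by nlinarith)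
  · have hsymm : ‖P.symm w - P.symm w'‖ ≤ q * ‖w - w'‖ := by
      rw [← map_sub]
      exact (P.symm : Plane →L[ℝ] Plane).le_opNorm _
    have hsub : A (fderiv ℝ u (P.symm w)) - A (fderiv ℝ u (P.symm w')) =
        A (fderiv ℝ u (P.symm w) - fderiv ℝ u (P.symm w')) := by
      simp only [A, ContinuousLinearMap.sub_comp, ContinuousLinearMap.comp_sub]
    rw [(hderiv w).fderiv, (hderiv w').fderiv, hsub]
    calc ‖A (fderiv ℝ u (P.symm w) - fderiv ℝ u (P.symm w'))‖
        ≤ p * (η * (q * ‖w - w'‖)) * q := by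
          refine (hA _).trans ?_
          gcongr
          exact (h.lip_fderiv _ _).trans (by gcongr)
      _ = p * η * q ^ 2 * ‖w - w'‖ := by ring
      _ ≤ p * (1 + q) ^ 2 * η * ‖w - w'‖ :=
          mul_le_mul_of_nonneg_right (hfactor (q ^ 2) (by nlinarith)) (norm_nonneg _)

end SmallC2

theorem blowOut_smul {δ t : ℝ} (ht : 0 < t) (v : Plane) :
    blowOut δ (t • v) = (√(t ^ 2 * ‖v‖ ^ 2 + δ ^ 2) / ‖v‖) • v := by
  rw [blowOut, norm_smul, Real.norm_eq_abs, abs_of_pos ht, mul_pow, smul_smul]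
  congr 1
  rcases eq_or_ne ‖v‖ 0 with hv | hv
  · simp [hv]
  · field_simp

theorem tendsto_blowOut_smul {δ : ℝ} (hδ : 0 ≤ δ) (v : Plane) :
    Tendsto (fun t : ℝ => blowOut δ (t • v)) (𝓝[>] 0) (𝓝 ((δ / ‖v‖) • v)) := by
  have hcont : Continuous fun t : ℝ => (√(t ^ 2 * ‖v‖ ^ 2 + δ ^ 2) / ‖v‖) • v := by fun_prop
  have hzero : (√(0 ^ 2 * ‖v‖ ^ 2 + δ ^ 2) / ‖v‖) • v = (δ / ‖v‖) • v := by
    rw [zero_pow two_ne_zero, zero_mul, zero_add, Real.sqrt_sq hδ]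
  rw [← hzero]
  refine ((hcont.tendsto 0).mono_left nhdsWithin_le_nhds).congr' ?_
  filter_upwards [self_mem_nhdsWithin] with t ht
  exact (blowOut_smul ht v).symm

namespace Data

variable {D : Data} {u : Plane → Plane} {F : Torus → Torus}

theorem tendsto_blowUp_add_smul {c : Plane} (hc : c ∈ D.centers) (v : Plane) :
    Tendsto (fun t : ℝ => D.blowUp (c + t • v)) (𝓝[>] 0) (𝓝 (c + (D.δ / ‖v‖) • v)) := by
  obtain ⟨s, hs, -, hblow⟩ := D.exists_blowUp_eq_blowOut
  refine ((tendsto_blowOut_smul D.δ_pos.le v).const_add c).congr' ?_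
  have hcont : Continuous fun t : ℝ => ‖t • v‖ ^ 2 := by fun_prop
  have hsmall : ∀ᶠ t : ℝ in 𝓝 0, ‖t • v‖ ^ 2 < s :=
    hcont.tendsto 0 |>.eventually_lt_const (by simpa using hs)
  filter_upwards [hsmall.filter_mono nhdsWithin_le_nhds] with t ht
  exact ((hblow c hc).1 _ ht.le).symm

/-- Both sides are limits, along the ray from `c` in the direction `e`, of the two sides of
`hmap`. -/
theorem map_cover_circle (hF : Continuous F) (hu : Continuous u)
    (hmap : ∀ x ∉ D.centers, F (D.cover (D.blowUp x)) = D.cover (D.perturbed u x))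
    {c e : Plane} (hc : c ∈ D.centers) (he : ‖e‖ = 1) :
    F (D.cover (c + D.δ • e)) =
      D.cover (saddle c + (D.δ / ‖saddle e‖) • saddle e + u (c + D.δ • e)) := by
  have hblow : Tendsto (fun t : ℝ => D.blowUp (c + t • e)) (𝓝[>] 0) (𝓝 (c + D.δ • e)) := by
    simpa only [he, div_one] using tendsto_blowUp_add_smul hc e
  have himage : Tendsto (fun t : ℝ => D.blowUp (saddle (c + t • e))) (𝓝[>] 0)
      (𝓝 (saddle c + (D.δ / ‖saddle e‖) • saddle e)) := by
    simpa only [map_add, map_smul] using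
      tendsto_blowUp_add_smul (D.saddle_mem_centers_iff.2 hc) (saddle e)
  have hmem : ∀ᶠ t : ℝ in 𝓝[>] 0, c + t • e ∉ D.centers := by
    filter_upwards [Ioc_mem_nhdsGT D.ε_pos] with t ht
    refine not_mem_centers_of_near hc ?_ ?_
    · rw [add_sub_cancel_left, norm_smul, he, mul_one, Real.norm_of_nonneg ht.1.le]
      exact ht.2
    · rw [Ne, add_eq_left, smul_eq_zero, not_or]
      exact ⟨ht.1.ne', norm_ne_zero_iff.1 (he ▸ one_ne_zero)⟩
  refine tendsto_nhds_unique_of_eventuallyEq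
    (((hF.comp D.continuous_cover).tendsto _).comp hblow)
    ((D.continuous_cover.tendsto _).comp (himage.add ((hu.tendsto _).comp hblow))) ?_
  exact hmem.mono fun t ht => hmap _ ht

theorem cover_mem_iUnion_circle_iff {w : Plane} :
    D.cover w ∈ ⋃ i, D.circle i ↔ ∃ v, ‖v‖ = D.δ ∧ w - v ∈ D.centers := by
  simp only [circle, mem_iUnion, mem_image, mem_sphere_zero_iff_norm, sub_mem_centers_iff]
  tauto

theorem keepsCircles (hF : Continuous F) (hu : Continuous u)
    (hsmall : ∀ x, ‖u x‖ ≤ 2 * (D.ε - D.δ))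
    (hmap : ∀ x ∉ D.centers, F (D.cover (D.blowUp x)) = D.cover (D.perturbed u x))
    (hcirc : MapsTo F (⋃ i, D.circle i) (⋃ i, D.circle i)) : D.KeepsCircles u := by
  intro c hc e he
  have hδ := D.δ_pos
  set X := (D.δ / ‖saddle e‖) • saddle e with hX
  have hX_norm : ‖X‖ ≤ D.δ := by
    rw [hX, norm_smul, norm_div, norm_norm, Real.norm_of_nonneg hδ.le, div_mul_comm]
    exact mul_le_of_le_one_left hδ.le (div_self_le_one _)
  have hcircle : D.cover (c + D.δ • e) ∈ ⋃ i, D.circle i :=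
    cover_mem_iUnion_circle_iff.2 ⟨D.δ • e, by
      rw [norm_smul, he, mul_one, Real.norm_of_nonneg hδ.le], by rwa [add_sub_cancel_right]⟩
  have himage := hcirc hcircle
  rw [map_cover_circle hF hu hmap hc he] at himage
  obtain ⟨v, hv, hmem⟩ := cover_mem_iUnion_circle_iff.1 himage
  have hsub : saddle c + X + u (c + D.δ • e) - v - saddle c = X + u (c + D.δ • e) - v := by abel
  have hcenter : saddle c + X + u (c + D.δ • e) - v = saddle c := by
    refine D.eq_of_near hmem (D.saddle_mem_centers_iff.2 hc) ?_
    rw [hsub]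
    linarith [norm_sub_le (X + u (c + D.δ • e)) v, norm_add_le X (u (c + D.δ • e)),
      hsmall (c + D.δ • e)]
  rw [hcenter, sub_self] at hsub
  rw [sub_eq_zero.1 hsub.symm, hv]

theorem periodic_of_map_cover_eq {G : Torus → Torus}
    (h : ∀ w, F (D.cover w) = G (D.cover w) + D.cover (u w)) (hsmall : ∀ x, ‖u x‖ ≤ D.ε) (w : Plane)
    {l : Plane} (hl : l ∈ D.deck) : u (w + l) = u w := by
  have hcover : D.cover (w + l) = D.cover w := by
    rwa [cover_eq_iff, add_sub_cancel_left]
  refine D.cover_inj_of_near (add_left_cancel (a := G (D.cover w)) ?_) ?_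
  · rw [← h, ← hcover, h]
  · linarith [norm_sub_le (u (w + l)) (u w), hsmall w, hsmall (w + l)]

variable (D) in
theorem exists_isPerturbation : ∃ η > 0, ∀ u F, SmallC2 η u → Continuous F →
    (∀ w, F (D.cover w) = D.hatF (D.cover w) + D.cover (u w)) →
    MapsTo F (⋃ i, D.circle i) (⋃ i, D.circle i) → D.IsPerturbation u F := by
  obtain ⟨η₀, hη₀, hnear⟩ := D.exists_nearSaddle
  have hδε : 0 < 2 * (D.ε - D.δ) := by linarith [D.δ_lt]
  refine ⟨min η₀ (min (2 * (D.ε - D.δ)) D.ε), lt_min hη₀ (lt_min hδε D.ε_pos),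
    fun u F hu hF hFu hcirc => ?_⟩
  have hmap : ∀ x ∉ D.centers, F (D.cover (D.blowUp x)) = D.cover (D.perturbed u x) :=
    fun x hx => by rw [hFu, hatF_cover_blowUp hx, perturbed, map_add]
  have hkeep : D.KeepsCircles u := keepsCircles hF hu.diff.continuous
    (fun x => (hu.bound x).trans ((min_le_right _ _).trans (min_le_left _ _))) hmap hcirc
  obtain ⟨hmem, hsaddle⟩ := hnear u (hu.mono (min_le_left _ _)) hkeep
  have hper : ∀ w, ∀ l ∈ D.deck, u (w + l) = u w := fun w _ => periodic_of_map_cover_eq hFu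
    (fun x => (hu.bound x).trans ((min_le_right _ _).trans (min_le_right _ _))) w
  exact ⟨hu.diff, hper, hmem, hsaddle, hmap⟩

variable (D) in
theorem exists_isPerturbation_of_c2Close : ∃ η > 0, ∀ F, Continuous F → C2Close η F D.hatF →
    MapsTo F (⋃ i, D.circle i) (⋃ i, D.circle i) → ∃ u, D.IsPerturbation u F := by
  obtain ⟨η, hη, hpert⟩ := D.exists_isPerturbation
  set K := ‖(D.P : Plane →L[ℝ] Plane)‖ * (1 + ‖(D.P.symm : Plane →L[ℝ] Plane)‖) ^ 2 with hK
  have hKpos : 0 < K := by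
    have := D.P.norm_pos
    positivity
  refine ⟨η / K, div_pos hη hKpos, fun F hF ⟨u, hu, hFu, hclose⟩ hcirc => ?_⟩
  have hsmall := (smallC2_of_norm_iteratedFDeriv_le hu fun k hk z => (hclose k hk z).le).conj D.P
  rw [← hK, mul_div_cancel₀ _ hKpos.ne'] at hsmall
  refine ⟨_, hpert _ F hsmall hF (fun w => ?_) hcirc⟩
  change F (proj (D.P.symm w)) = D.hatF (proj (D.P.symm w)) + proj (D.P.symm (D.P _))
  rw [D.P.symm_apply_apply, hFu]

end Data

end BlowUp

end

theorem theorem3p2_general (D : BlowUp.Data) :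
    (∀ p ∈ D.island, 0 < BlowUp.lyapunov D.hatF p) ∧
    BlowUp.TransitiveOn D.hatF D.island ∧
    ∃ η > 0, ∀ F : BlowUp.Torus → BlowUp.Torus, Continuous F → BlowUp.C2Close η F D.hatF →
      MapsTo F (⋃ i, D.circle i) (⋃ i, D.circle i) →
        (∀ p ∈ D.island, 0 < BlowUp.lyapunov F p) ∧
        BlowUp.ConjugateOn D.hatF F D.island ∧
        BlowUp.TransitiveOn F D.island := by
  refine ⟨fun p => D.isPerturbation_hatF.lyapunov_pos, D.transitiveOn_hatF, ?_⟩
  obtain ⟨η, hη, h⟩ := D.exists_isPerturbation_of_c2Close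
  refine ⟨η, hη, fun F hF hclose hcirc => ?_⟩
  obtain ⟨u, hu⟩ := h F hF hclose hcirc
  exact ⟨fun p => hu.lyapunov_pos, hu.conjugateOn, hu.conjugateOn.transitiveOn D.transitiveOn_hatF⟩

theorem theorem3p2 (D : BlowUp.Data) :
    (∀ p ∈ D.island, 0 < BlowUp.lyapunov D.hatF p) ∧
    BlowUp.TransitiveOn D.hatF D.island ∧
    ∃ η : ℝ, 0 < η ∧ ∀ F : BlowUp.Torus ≃ₜ BlowUp.Torus,
      BlowUp.TorusContDiff 2 F → BlowUp.TorusContDiff 2 F.symm →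
      BlowUp.C2Close η F D.hatF →
      (∀ i, F '' D.circle i = D.circle i) →
        (∀ p ∈ D.island, 0 < BlowUp.lyapunov F p) ∧
        BlowUp.ConjugateOn D.hatF F D.island ∧
        BlowUp.TransitiveOn F D.island := by
  obtain ⟨hlyap, htrans, η, hη, h⟩ := theorem3p2_general D
  exact ⟨hlyap, htrans, η, hη, fun F _ _ hclose hcirc => h F F.continuous hclose <|
    mapsTo_iUnion_iUnion fun i => mapsTo_iff_image_subset.2 (hcirc i).subset⟩
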